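/- **Model.** Let $n\ge 1$. A switch has $n$ input ports, $n$ output ports and $n^2$ queues, indexed by pairs $k=(i,j)$. In slot $t$ the queue lengths $\mathbf q(t)\in\mathbb Z_{\ge0}^{n^2}$ evolve by $\mathbf q(t+1)=[\mathbf q(t)+\mathbf a(t)-\mathbf s(t)]^+=\mathbf q(t)+\mathbf a(t)-\mathbf s(t)+\mathbf u(t)$, where $\mathbf u(t)$ is the unused service. The schedule $\mathbf s(t)$ is a permutation matrix; under MaxWeight it maximizes $\sum_k q_k(t)s_k$ over all permutation matrices (ties broken by any, possibly randomized, rule depending on $\mathbf q(t)$ only). The arrivals $\mathbf a(t)$ are nonnegative integer vectors, i.i.d. in $t$, independent of the past and of $\mathbf s(t)$, with independent coordinates bounded by a constant $a_{\max}$. In the system with parameter $\epsilon\in(0,1)$ they have mean $(1-\epsilon)\boldsymbol\nu$, where $\nu_k>0$ for all $k$ and all row and column sums of $\boldsymbol\nu$ are $1$; $a_{\max}$ does not depend on $\epsilon$, and the variances are (or converge, as $\epsilon\to0$, to) $v_k$. **Notation.** $\mathbf B$ is the $n^2\times 2n$ matrix with $(\mathbf B\mathbf w)_{(i,j)}=w_i+w_{n+j}$,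 $\mathcal S=\mathbf B\mathbb R^{2n}$, $\mathcal K=\mathbf B[0,\infty)^{2n}$, and $\langle x,y\rangle=\sum_kx_ky_k$ (bilinear, also for complex vectors). $\Theta$ is the set of $\boldsymbol\theta\in\mathbb C^{n^2}$ with $\mathrm{Re}\,\boldsymbol\theta,\mathrm{Im}\,\boldsymbol\theta\in\mathcal S$ and $\mathrm{Re}(\mathbf B^T\boldsymbol\theta)\le 0$ coordinatewise. The functional equation is $$\Big(-\tfrac1n\sum_k\theta_k+\tfrac12\sum_k v_k\theta_k^2\Big)L(\boldsymbol\theta)=-\langle\boldsymbol\theta,\mathbf M(\boldsymbol\theta)\rangle .\qquad(1)$$ A *transform solution* is a pair $(L,\mathbf M)$ of functions on $\Theta$ satisfying (1) on $\Theta$ such that $L(\boldsymbol\theta)=\int e^{\langle\boldsymbol\theta,y\rangle}\,d\mu(y)$ for a probability measure $\mu$ on $\mathcal K$ and, for each $k$, $M_k(\boldsymbol\theta)=\int e^{\langle\boldsymbol\theta,y\rangle}\,d\mu_k(y)$ for a finite measure $\mu_k$ on the face $\{y\in\mathcal K:y_k=0\}$. The *uniqueness conjecture* for $(n,v)$ says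 that there is exactly one transform solution. **Statement.** For every $\epsilon\in(0,1)$ the switch under MaxWeight has a unique steady-state distribution. With expectations under it (and $\mathbf u$ the unused service in the slot that starts from $\mathbf q$), put $L_\epsilon(\boldsymbol\theta)=\mathbb E[e^{\epsilon\langle\boldsymbol\theta,\mathbf q\rangle}]$ and $M_{\epsilon,k}(\boldsymbol\theta)=\frac1\epsilon\mathbb E[u_ke^{\epsilon\langle\boldsymbol\theta,\mathbf q\rangle}]$. 1. For every $\boldsymbol\theta\in\Theta$, $L_\epsilon(\boldsymbol\theta)$ and $M_{\epsilon,k}(\boldsymbol\theta)$ are finite and bounded for all small $\epsilon>0$, and the limits $L(\boldsymbol\theta)=\lim_{\epsilon\to0}L_\epsilon(\boldsymbol\theta)$, $M_k(\boldsymbol\theta)=\lim_{\epsilon\to0}M_{\epsilon,k}(\boldsymbol\theta)$, taken along $\epsilon\to0$ or along any subsequence for which they exist, satisfy (1). Every sequence $\epsilon_m\downarrow0$ has a subsequence along which these limits exist for all $\boldsymbol\theta\in\Theta$ and form a transform solution. If the uniqueness conjecture holds for $(n,v)$, the limits along $\epsilon\to0$ exist for all $\boldsymbol\theta\in\Theta$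 and form the transform solution. 2. If the uniqueness conjecture holds for $(n,v)$ and $v_k=\sigma^2$ for all $k$, with $\sigma>0$, then, as $\epsilon\to0$, the vector $\epsilon\mathbf q$ converges in distribution to the vector with entries $$\Upsilon_i+\Upsilon_{n+j}-2\min_{1\le l\le 2n}\Upsilon_l ,\qquad 1\le i,j\le n,$$ where $\Upsilon_1,\dots,\Upsilon_{2n}$ are independent exponential random variables with mean $\sigma^2/2$. -/

import Mathlib

open MeasureTheory ProbabilityTheory Filter Topology
open scoped Matrix

noncomputable section

namespace InputQueuedSwitch

/-- The pairs (input port, output port) of a switch of size `n`; they index the `n ^ 2` queues. -/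
abbrev Pair (n : ℕ) : Type := Fin n × Fin n

/-- The `2 n` ports: `Sum.inl i` is the input port `i`, `Sum.inr j` is the output port `j`. -/
abbrev Port (n : ℕ) : Type := Fin n ⊕ Fin n

/-- Vectors of packet counts (queue lengths, arrivals in one slot, schedules). -/
abbrev Counts (n : ℕ) : Type := Pair n → ℕ

/-! ### The switch -/

/-- The set of schedules: 0/1 vectors that are perfect matchings of inputs and outputs. -/
def schedules (n : ℕ) : Set (Counts n) :=
  {s | (∀ k, s k = 0 ∨ s k = 1) ∧ (∀ j, ∑ i, s (i, j) = 1) ∧ (∀ i, ∑ j, s (i, j) = 1)}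

/-- The weight of the schedule `s` when the queue lengths are `q`. -/
def weight {n : ℕ} (q s : Counts n) : ℕ := ∑ k, q k * s k

/-- A (possibly randomized) scheduling rule `T`, which draws the schedule from the law `T q` when
the queue lengths are `q`, is MaxWeight if it always picks a schedule of maximal weight. Ties are
broken in an arbitrary way. -/
def IsMaxWeight {n : ℕ} (T : Kernel (Counts n) (Counts n)) : Prop :=
  ∀ q, ∀ᵐ s ∂(T q), s ∈ schedules n ∧ ∀ s' ∈ schedules n, weight q s' ≤ weight q s

/-- The joint law of the queue lengths `q`, the schedule `s` and the arrivals `a` of one time slot,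
as a law of `((q, s), a)`: `q` has law `π`, then `s` is drawn from `T q`, and `a` is independent
of `(q, s)` with independent coordinates `a k` of law `A k`. -/
def slotLaw {n : ℕ} (T : Kernel (Counts n) (Counts n)) (A : Pair n → Measure ℕ)
    (π : Measure (Counts n)) : Measure ((Counts n × Counts n) × Counts n) :=
  (π ⊗ₘ T).prod (Measure.pi A)

/-- The queue lengths `[q + a - s]⁺` in the next slot (subtraction in `ℕ` is truncated at `0`). -/
def nextQueue {n : ℕ} (x : (Counts n × Counts n) × Counts n) : Counts n :=
  fun k => x.1.1 k + x.2 k - x.1.2 k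

/-- The unused service `u = [q + a - s]⁺ - (q + a - s) = [s - (q + a)]⁺`. -/
def unused {n : ℕ} (x : (Counts n × Counts n) × Counts n) : Counts n :=
  fun k => x.1.2 k - (x.1.1 k + x.2 k)

/-- `π` is a steady-state distribution of the Markov chain of queue lengths. -/
structure IsSteadyState {n : ℕ} (T : Kernel (Counts n) (Counts n)) (A : Pair n → Measure ℕ)
    (π : Measure (Counts n)) : Prop where
  isProbabilityMeasure : IsProbabilityMeasure π
  map_nextQueue : (slotLaw T A π).map nextQueue = π

/-- The part `𝓕` of the boundary of the capacity region: all row and column sums are `1`. -/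
def saturatedRates (n : ℕ) : Set (Pair n → ℝ) :=
  {ν | (∀ k, 0 ≤ ν k) ∧ (∀ j, ∑ i, ν (i, j) = 1) ∧ (∀ i, ∑ j, ν (i, j) = 1)}

/-- The arrival laws `A ε`, `0 < ε < 1`, have support in `{0, …, aMax}` and means `(1 - ε) ν`, and
their variances tend to `v` as `ε → 0` (in particular they may be equal to `v`). -/
structure IsHeavyTraffic {n : ℕ} (ν : Pair n → ℝ) (aMax : ℕ) (v : Pair n → ℝ)
    (A : ℝ → Pair n → Measure ℕ) : Prop where
  bounded : ∀ ε ∈ Set.Ioo (0 : ℝ) 1, ∀ k, ∀ᵐ m ∂(A ε k), m ≤ aMax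
  mean : ∀ ε ∈ Set.Ioo (0 : ℝ) 1, ∀ k, ∫ m, (m : ℝ) ∂(A ε k) = (1 - ε) * ν k
  tendsto_variance : ∀ k,
    Tendsto (fun ε => variance (fun m : ℕ => (m : ℝ)) (A ε k)) (𝓝[>] 0) (𝓝 (v k))

/-! ### Geometry -/

/-- The incidence matrix `B` of pairs and ports. -/
def incidence (n : ℕ) : Matrix (Pair n) (Port n) ℝ :=
  Matrix.of fun k l => Sum.elim (fun i => if k.1 = i then 1 else 0)
    (fun j => if k.2 = j then 1 else 0) l

/-- The subspace `𝓢 = {B w}`. -/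
def collapseSpace (n : ℕ) : Set (Pair n → ℝ) := {y | ∃ w : Port n → ℝ, y = incidence n *ᵥ w}

/-- The cone `𝓚 = {B r : r ≥ 0}`. -/
def collapseCone (n : ℕ) : Set (Pair n → ℝ) :=
  {y | ∃ r : Port n → ℝ, (∀ l, 0 ≤ r l) ∧ y = incidence n *ᵥ r}

/-- The face of the cone on which the coordinate `k` vanishes. -/
def coneFace {n : ℕ} (k : Pair n) : Set (Pair n → ℝ) := {y ∈ collapseCone n | y k = 0}

/-- The set `Θ` of complex vectors `θ` in `𝓢` with `Re (Bᵀ θ) ≤ 0`. -/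
def transformDomain (n : ℕ) : Set (Pair n → ℂ) :=
  {θ | (fun k => (θ k).re) ∈ collapseSpace n ∧ (fun k => (θ k).im) ∈ collapseSpace n ∧
    ∀ l, ((incidence n)ᵀ *ᵥ fun k => (θ k).re) l ≤ 0}

/-- The bilinear pairing `⟨θ, y⟩ = ∑ θ_k y_k` of a complex and a real vector. -/
def pairing {n : ℕ} (θ : Pair n → ℂ) (y : Pair n → ℝ) : ℂ := ∑ k, θ k * (y k : ℂ)

/-! ### Transforms and the functional equation -/

/-- The integrand `e^{ε ⟨θ, q⟩}`. -/
def expQueue {n : ℕ} (ε : ℝ) (θ : Pair n → ℂ) (q : Counts n) : ℂ :=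
  Complex.exp ((ε : ℂ) * pairing θ fun k => (q k : ℝ))

/-- `E[e^{ε ⟨θ, q⟩}]`, where `q` has law `π`. -/
def queueTransform {n : ℕ} (π : Measure (Counts n)) (ε : ℝ) (θ : Pair n → ℂ) : ℂ :=
  ∫ q, expQueue ε θ q ∂π

/-- `(1 / ε) E[u_k e^{ε ⟨θ, q⟩}]`, where `q` has law `π`. -/
def unusedTransform {n : ℕ} (T : Kernel (Counts n) (Counts n)) (A : Pair n → Measure ℕ)
    (π : Measure (Counts n)) (ε : ℝ) (k : Pair n) (θ : Pair n → ℂ) : ℂ :=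
  (1 / (ε : ℂ)) * ∫ x, (unused x k : ℂ) * expQueue ε θ x.1.1 ∂(slotLaw T A π)

/-- The functional equation at `θ`, for arrivals with the diagonal covariance matrix `diag v`:
`(-(1/n) ⟨θ, 1⟩ + (1/2) ⟨θ, diag v θ⟩) L = - ⟨θ, M⟩`, where all brackets are bilinear. -/
def FunctionalEq {n : ℕ} (v : Pair n → ℝ) (θ : Pair n → ℂ) (L : ℂ) (M : Pair n → ℂ) : Prop :=
  (-(1 / (n : ℂ)) * ∑ k, θ k + (1 / 2) * ∑ k, (v k : ℂ) * θ k ^ 2) * L = -∑ k, θ k * M k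

/-- `F` is on `Θ` the Laplace transform of the measure `μ`. -/
def IsLaplaceTransform {n : ℕ} (μ : Measure (Pair n → ℝ)) (F : transformDomain n → ℂ) : Prop :=
  ∀ θ : transformDomain n, F θ = ∫ y, Complex.exp (pairing θ.1 y) ∂μ

/-- `(L, M)` solves the functional equation on `Θ` and consists of Laplace transforms: `L` is the
transform of a probability distribution on the cone `𝓚` and `M k` is the transform of a finite
boundary measure, on the face `{y ∈ 𝓚 : y_k = 0}`. -/
structure IsTransformSolution {n : ℕ} (v : Pair n → ℝ) (L : transformDomain n → ℂ)
    (M : Pair n → transformDomain n → ℂ) : Prop where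
  interior : ∃ μ : Measure (Pair n → ℝ), IsProbabilityMeasure μ ∧
    (∀ᵐ y ∂μ, y ∈ collapseCone n) ∧ IsLaplaceTransform μ L
  boundary : ∀ k, ∃ μ : Measure (Pair n → ℝ), IsFiniteMeasure μ ∧
    (∀ᵐ y ∂μ, y ∈ coneFace k) ∧ IsLaplaceTransform μ (M k)
  equation : ∀ θ : transformDomain n, FunctionalEq v θ.1 (L θ) (fun k => M k θ)

/-- The uniqueness conjecture for the functional equation with covariance matrix `diag v`. -/
def UniquenessConjecture (n : ℕ) (v : Pair n → ℝ) : Prop :=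
  ∃! p : (transformDomain n → ℂ) × (Pair n → transformDomain n → ℂ),
    IsTransformSolution v p.1 p.2

end InputQueuedSwitch

end

open InputQueuedSwitch

namespace InputQueuedSwitch

open scoped ENNReal NNReal

set_option linter.unusedSectionVars false

variable {n : ℕ}

/-! ### The incidence matrix, the collapse space and the collapse cone -/

/-! The proof is a transform method: apply stationarity to the exponential test function
`e^{ε⟨θ,q⟩}`, expand one slot to second order, and let `ε → 0`.

Every schedule and the rate vector `ν` are doubly stochastic, and an element of `𝓢` has the same
pairing with all doubly stochastic vectors. For `θ ∈ 𝓢` the schedule therefore drops out of `⟨θ, a -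
s⟩`, whose mean is `-ε (1/n) ∑ θ`, while its second moment tends to `∑ v θ²`. The unused service has
total mean at most `nε` and contributes `⟨θ, M⟩`. All these terms are of order `ε²`, and dividing by
`ε²` gives the functional equation with an error of order `ε` (`CollapsedState.norm_functional_le`).

What makes the expansion legitimate is state space collapse. By Birkhoff's theorem a MaxWeight
schedule beats every substochastic vector. If `z` is the deviation of `q` from the cone and `d` its
length, `ν + (δ/d) z` is substochastic, so the drift of `q` towards the cone is at least of order
`δ` (`sum_mul_rate_sub_schedule_le`). An exponential Lyapunov function of the distance then gives
exponential moments bounded uniformly in `ε` (`exists_lintegral_exp_coneDist_le`). On `Θ` the real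
part of `⟨θ, q⟩` is at most a multiple of that distance, so the transforms stay bounded.

A quadratic Lyapunov function yields the steady state (Krylov–Bogoliubov), unique because the empty
system can be reached from every state, and the bound `O(1/ε)` for the mean queue lengths. With a
bound for the unused service at large queues this makes the laws of `εq` and the laws weighted by
`u_k/ε` tight. Prokhorov's theorem gives weak limits, carried by the cone and, since unused service
at `k` forces `q_k = 0`, by its faces (`exists_subseq_limit`). Under the uniqueness conjecture all
subsequential limits agree, so the full limits exist.

For equal variances `2c` an explicit solution is available. The interior law is that of independent
exponentials of mean `c` reduced by their minimum; the boundary law at `k` has mass `1/n` and sets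
the two ports of `k` to `0`. Memorylessness gives the transforms, and the functional equation
becomes a polynomial identity (`quadratic_mul_sum_eq`). Purely imaginary `θ` already determine a
measure on the cone (`eq_of_integral_exp_pairing_eq`), so every weak limit of the laws of `εq` is
the interior law. -/

lemma incidence_mulVec (w : Port n → ℝ) (k : Pair n) :
    (incidence n *ᵥ w) k = w (Sum.inl k.1) + w (Sum.inr k.2) := by
  simp [incidence, Matrix.mulVec, dotProduct]

lemma incidence_transpose_mulVec_inl (y : Pair n → ℝ) (i : Fin n) :
    ((incidence n)ᵀ *ᵥ y) (Sum.inl i) = ∑ j, y (i, j) := by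
  simp [incidence, Matrix.mulVec, dotProduct, Fintype.sum_prod_type_right]

lemma incidence_transpose_mulVec_inr (y : Pair n → ℝ) (j : Fin n) :
    ((incidence n)ᵀ *ᵥ y) (Sum.inr j) = ∑ i, y (i, j) := by
  simp [incidence, Matrix.mulVec, dotProduct, Fintype.sum_prod_type]

lemma mem_collapseSpace_iff {y : Pair n → ℝ} :
    y ∈ collapseSpace n ↔ ∃ w : Port n → ℝ, ∀ k, y k = w (Sum.inl k.1) + w (Sum.inr k.2) := by
  simp only [collapseSpace, Set.mem_ofPred_eq, funext_iff, incidence_mulVec]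

/-- A constant may be moved between the input and output parts of a potential without changing `y`.
Moving the minimum over the inputs, attained at `i₀`, makes the input part nonnegative, and the
output part becomes the row `y (i₀, ·)`. -/
lemma mem_collapseCone_iff (hn : 0 < n) {y : Pair n → ℝ} :
    y ∈ collapseCone n ↔ y ∈ collapseSpace n ∧ ∀ k, 0 ≤ y k := by
  constructor
  · rintro ⟨r, hr, rfl⟩
    refine ⟨⟨r, rfl⟩, fun k => ?_⟩
    rw [incidence_mulVec]
    exact add_nonneg (hr _) (hr _)
  · rintro ⟨hy, h0⟩
    obtain ⟨w, hw⟩ := mem_collapseSpace_iff.1 hy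
    have : Nonempty (Fin n) := ⟨⟨0, hn⟩⟩
    obtain ⟨i₀, hi₀⟩ := Finite.exists_min fun i => w (Sum.inl i)
    refine ⟨Sum.elim (fun i => w (Sum.inl i) - w (Sum.inl i₀))
      (fun j => w (Sum.inr j) + w (Sum.inl i₀)), ?_, ?_⟩
    · rintro (i | j)
      · simpa using hi₀ i
      · have := h0 (i₀, j)
        rw [hw] at this
        simpa [add_comm] using this
    · funext k
      rw [incidence_mulVec, hw]
      simp

lemma sum_incidence_mul (z : Pair n → ℝ) (w : Port n → ℝ) :
    ∑ k, z k * (incidence n *ᵥ w) k = ∑ l, ((incidence n)ᵀ *ᵥ z) l * w l := by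
  simp only [Fintype.sum_sum_type, incidence_transpose_mulVec_inl, incidence_transpose_mulVec_inr,
    incidence_mulVec, mul_add, Finset.sum_add_distrib, Fintype.sum_prod_type, Finset.sum_mul]
  congr 1
  exact Finset.sum_comm

/-! ### Schedules -/

lemma schedules_le_one {s : Counts n} (hs : s ∈ schedules n) (k : Pair n) : s k ≤ 1 := by
  rcases hs.1 k with h | h <;> omega

lemma sum_schedule {s : Counts n} (hs : s ∈ schedules n) : ∑ k, s k = n := by
  rw [Fintype.sum_prod_type]
  simp [hs.2.2]

/-- The pairing of `w i + w' j` with a doubly stochastic vector is `∑ w + ∑ w'`. -/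
lemma sum_add_mul_of_sum_eq_one {R : Type*} [CommSemiring R] (w w' : Fin n → R) (x : Pair n → R)
    (hc : ∀ j, ∑ i, x (i, j) = 1) (hr : ∀ i, ∑ j, x (i, j) = 1) :
    ∑ k : Pair n, (w k.1 + w' k.2) * x k = ∑ i, w i + ∑ j, w' j := by
  simp only [add_mul, Finset.sum_add_distrib]
  congr 1
  · rw [Fintype.sum_prod_type]
    simp [← Finset.mul_sum, hr]
  · rw [Fintype.sum_prod_type_right]
    simp [← Finset.mul_sum, hc]

/-- The schedule of a permutation. -/
def permSchedule (σ : Equiv.Perm (Fin n)) : Counts n := fun k => if σ k.1 = k.2 then 1 else 0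

lemma permSchedule_mem (σ : Equiv.Perm (Fin n)) : permSchedule σ ∈ schedules n := by
  refine ⟨fun k => ?_, fun j => ?_, fun i => ?_⟩
  · unfold permSchedule
    split_ifs <;> simp
  · simp [permSchedule, ← Equiv.eq_symm_apply]
  · simp [permSchedule]

/-- Birkhoff's theorem: a doubly stochastic vector is a convex combination of permutation matrices,
so a linear functional is bounded on it by its bound on schedules. -/
lemma sum_mul_doublyStochastic_le {q D : Pair n → ℝ} (hD : D ∈ saturatedRates n) {m : ℝ}
    (h : ∀ s ∈ schedules n, ∑ k, q k * s k ≤ m) : ∑ k, q k * D k ≤ m := by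
  have hD' : (Matrix.of fun i j => D (i, j)) ∈ doublyStochastic ℝ (Fin n) := by
    rw [mem_doublyStochastic_iff_sum]
    exact ⟨fun i j => hD.1 _, hD.2.2, hD.2.1⟩
  obtain ⟨w, hw0, hw1, hw⟩ := exists_eq_sum_perm_of_mem_doublyStochastic hD'
  have hDk : ∀ k : Pair n, D k = ∑ σ, w σ * permSchedule σ k := by
    intro k
    have := congrFun (congrFun hw k.1) k.2
    simp only [Matrix.sum_apply, Matrix.smul_apply, smul_eq_mul, Matrix.of_apply] at this
    rw [← this]
    refine Finset.sum_congr rfl fun σ _ => ?_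
    simp [permSchedule, Equiv.Perm.permMatrix, PEquiv.toMatrix_apply, eq_comm]
  calc ∑ k, q k * D k = ∑ σ, w σ * ∑ k, q k * permSchedule σ k := by
        simp only [hDk, Finset.mul_sum]
        rw [Finset.sum_comm]
        exact Finset.sum_congr rfl fun _ _ => Finset.sum_congr rfl fun _ _ => by ring
    _ ≤ ∑ σ, w σ * m :=
        Finset.sum_le_sum fun σ _ => mul_le_mul_of_nonneg_left (h _ (permSchedule_mem σ)) (hw0 σ)
    _ = m := by rw [← Finset.sum_mul, hw1, one_mul]

/-- Row and column deficits have the same total `d`, so adding the rank-one matrix `r_i c_j / d`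
completes `D` to a doubly stochastic one. Nonnegative weights can only gain from this. -/
lemma sum_mul_substochastic_le {q D : Pair n → ℝ} (hq : ∀ k, 0 ≤ q k) (hD : ∀ k, 0 ≤ D k)
    (hc : ∀ j, ∑ i, D (i, j) ≤ 1) (hr : ∀ i, ∑ j, D (i, j) ≤ 1) {m : ℝ}
    (h : ∀ s ∈ schedules n, ∑ k, q k * s k ≤ m) : ∑ k, q k * D k ≤ m := by
  set r : Fin n → ℝ := fun i => 1 - ∑ j, D (i, j) with hr_def
  set c : Fin n → ℝ := fun j => 1 - ∑ i, D (i, j) with hc_def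
  have hr0 : ∀ i, 0 ≤ r i := fun i => sub_nonneg.2 (hr i)
  have hc0 : ∀ j, 0 ≤ c j := fun j => sub_nonneg.2 (hc j)
  set d : ℝ := ∑ i, r i with hd
  have hdc : d = ∑ j, c j := by
    simp only [hd, hr_def, hc_def, Finset.sum_sub_distrib]
    rw [Finset.sum_comm]
  have hd0 : 0 ≤ d := Finset.sum_nonneg fun i _ => hr0 i
  have key : (fun k : Pair n => D k + r k.1 * c k.2 / d) ∈ saturatedRates n := by
    refine ⟨fun k => add_nonneg (hD k) (div_nonneg (mul_nonneg (hr0 _) (hc0 _)) hd0), ?_, ?_⟩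
    · intro j
      dsimp only
      rw [Finset.sum_add_distrib, ← Finset.sum_div, ← Finset.sum_mul, ← hd]
      -- If `d = 0` all deficits vanish and the added term is `0 / 0 = 0`, so no separate
      -- construction is needed.
      rcases hd0.eq_or_lt with h0 | h0
      · have : c j = 0 := (Finset.sum_eq_zero_iff_of_nonneg fun j _ => hc0 j).1
          (by rw [← hdc, ← h0]) j (Finset.mem_univ j)
        simp only [hc_def] at this
        simp only [← h0]
        linarith [div_zero ((0 : ℝ) * c j)]
      · rw [mul_div_cancel_left₀ _ h0.ne']
        simp [hc_def]
    · intro i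
      dsimp only
      rw [Finset.sum_add_distrib, ← Finset.sum_div, ← Finset.mul_sum, ← hdc]
      rcases hd0.eq_or_lt with h0 | h0
      · have : r i = 0 := (Finset.sum_eq_zero_iff_of_nonneg fun i _ => hr0 i).1
          (by rw [← hd, ← h0]) i (Finset.mem_univ i)
        simp only [hr_def] at this
        simp only [← h0]
        linarith [div_zero (r i * (0 : ℝ))]
      · rw [mul_div_cancel_right₀ _ h0.ne']
        simp [hr_def]
  refine le_trans (Finset.sum_le_sum fun k _ => mul_le_mul_of_nonneg_left ?_ (hq k))
    (sum_mul_doublyStochastic_le key h)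
  exact le_add_of_nonneg_right (div_nonneg (mul_nonneg (hr0 _) (hc0 _)) hd0)

/-! ### The distance to the cone -/

/-- The cone `𝓚` as a subset of Euclidean space. -/
def euclideanCone (n : ℕ) : Set (EuclideanSpace ℝ (Pair n)) := {x | x.ofLp ∈ collapseCone n}

/-- The Euclidean distance of a vector to the cone `𝓚`. -/
noncomputable def coneDist (y : Pair n → ℝ) : ℝ :=
  Metric.infDist (WithLp.toLp 2 y : EuclideanSpace ℝ (Pair n)) (euclideanCone n)

lemma zero_mem_collapseCone : (0 : Pair n → ℝ) ∈ collapseCone n :=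
  ⟨0, fun _ => le_rfl, by simp⟩

lemma smul_mem_collapseCone {y : Pair n → ℝ} (hy : y ∈ collapseCone n) {c : ℝ} (hc : 0 ≤ c) :
    c • y ∈ collapseCone n := by
  obtain ⟨r, hr, rfl⟩ := hy
  exact ⟨c • r, fun l => mul_nonneg hc (hr l), by rw [Matrix.mulVec_smul]⟩

lemma add_mem_collapseCone {x y : Pair n → ℝ} (hx : x ∈ collapseCone n) (hy : y ∈ collapseCone n) :
    x + y ∈ collapseCone n := by
  obtain ⟨r, hr, rfl⟩ := hx
  obtain ⟨r', hr', rfl⟩ := hy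
  exact ⟨r + r', fun l => add_nonneg (hr l) (hr' l), by rw [Matrix.mulVec_add]⟩

lemma isClosed_collapseCone (hn : 0 < n) : IsClosed (collapseCone n) := by
  have h : collapseCone n = (LinearMap.range (Matrix.mulVecLin (incidence n)) : Set (Pair n → ℝ)) ∩
      ⋂ k, {y | 0 ≤ y k} := by
    ext y
    rw [mem_collapseCone_iff hn]
    simp [collapseSpace, eq_comm]
  rw [h]
  refine (Submodule.closed_of_finiteDimensional _).inter (isClosed_iInter fun k => ?_)
  exact isClosed_le continuous_const (continuous_apply k)

lemma isClosed_euclideanCone (hn : 0 < n) : IsClosed (euclideanCone n) :=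
  (isClosed_collapseCone hn).preimage (PiLp.continuous_ofLp 2 _)

lemma euclideanCone_nonempty : (euclideanCone n).Nonempty := ⟨0, zero_mem_collapseCone⟩

lemma convex_euclideanCone : Convex ℝ (euclideanCone n) := by
  intro x hx y hy a b ha hb _
  exact add_mem_collapseCone (smul_mem_collapseCone hx ha) (smul_mem_collapseCone hy hb)

lemma coneDist_nonneg (y : Pair n → ℝ) : 0 ≤ coneDist y := Metric.infDist_nonneg

lemma continuous_coneDist : Continuous (coneDist (n := n)) :=
  (Metric.continuous_infDist_pt _).comp (PiLp.continuous_toLp 2 _)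

lemma coneDist_eq_zero_iff (hn : 0 < n) {y : Pair n → ℝ} :
    coneDist y = 0 ↔ y ∈ collapseCone n :=
  ((isClosed_euclideanCone hn).mem_iff_infDist_zero euclideanCone_nonempty).symm

lemma coneDist_sq_le (y : Pair n → ℝ) {p : Pair n → ℝ} (hp : p ∈ collapseCone n) :
    coneDist y ^ 2 ≤ ∑ k, (y k - p k) ^ 2 := by
  have h : coneDist y ≤ dist (WithLp.toLp 2 y : EuclideanSpace ℝ (Pair n)) (WithLp.toLp 2 p) :=
    Metric.infDist_le_dist_of_mem (show WithLp.toLp 2 p ∈ euclideanCone n from hp)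
  rw [EuclideanSpace.dist_eq] at h
  have := pow_le_pow_left₀ (coneDist_nonneg y) h 2
  rw [Real.sq_sqrt (by positivity)] at this
  simpa [Real.dist_eq] using this

/-- Projection onto the cone. -/
lemma exists_coneProj (hn : 0 < n) (y : Pair n → ℝ) :
    ∃ p ∈ collapseCone n, ∑ k, (y k - p k) ^ 2 = coneDist y ^ 2 ∧
      ∑ k, (y k - p k) * p k = 0 ∧ ∀ x ∈ collapseCone n, ∑ k, (y k - p k) * x k ≤ 0 := by
  obtain ⟨p, hp, hdist⟩ := (isClosed_euclideanCone hn).exists_infDist_eq_dist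
    euclideanCone_nonempty (WithLp.toLp 2 y)
  have hmin := (norm_eq_iInf_iff_real_inner_le_zero convex_euclideanCone
    (u := WithLp.toLp 2 y) hp).1 (by
      rw [← dist_eq_norm, ← hdist, Metric.infDist_eq_iInf]
      simp only [dist_eq_norm])
  have hinner : ∀ x : Pair n → ℝ, x ∈ collapseCone n →
      ∑ k, (y k - p k) * (x k - p k) ≤ 0 := by
    intro x hx
    have := hmin (WithLp.toLp 2 x) hx
    simpa [PiLp.inner_apply, mul_comm] using this
  -- Testing the variational inequality at the cone points `0` and `2p` gives both signs of `⟨y - p,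
  -- p⟩`, hence orthogonality. With it the inequality says that `y - p` lies in the polar cone.
  have h0 := hinner 0 zero_mem_collapseCone
  have h2 := hinner ((2 : ℝ) • p.ofLp) (smul_mem_collapseCone hp (by norm_num))
  have e0 : ∑ k, (y k - p k) * ((0 : Pair n → ℝ) k - p k) = -∑ k, (y k - p k) * p k := by
    simp
  have e2 : ∑ k, (y k - p k) * (((2 : ℝ) • p.ofLp) k - p k) = ∑ k, (y k - p k) * p k :=
    Finset.sum_congr rfl fun k _ => by simp only [Pi.smul_apply, smul_eq_mul]; ring
  have horth : ∑ k, (y k - p k) * p k = 0 := by linarith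
  refine ⟨p.ofLp, hp, ?_, horth, fun x hx => ?_⟩
  · have : coneDist y = dist (WithLp.toLp 2 y) p := hdist
    rw [this, EuclideanSpace.dist_eq, Real.sq_sqrt (by positivity)]
    simp [Real.dist_eq]
  · have := hinner x hx
    have e : ∑ k, (y k - p k) * (x k - p k) =
        ∑ k, (y k - p k) * x k - ∑ k, (y k - p k) * p k := by
      rw [← Finset.sum_sub_distrib]
      exact Finset.sum_congr rfl fun _ _ => mul_sub _ _ _
    linarith

lemma coneDist_smul_le (hn : 0 < n) (y : Pair n → ℝ) {c : ℝ} (hc : 0 ≤ c) :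
    coneDist (c • y) ≤ c * coneDist y := by
  obtain ⟨p, hp, hd, -, -⟩ := exists_coneProj hn y
  have h := coneDist_sq_le (c • y) (smul_mem_collapseCone hp hc)
  refine abs_le_of_sq_le_sq' ?_ (mul_nonneg hc (coneDist_nonneg y)) |>.2
  refine h.trans (le_of_eq ?_)
  rw [mul_pow, ← hd, Finset.mul_sum]
  exact Finset.sum_congr rfl fun k _ => by simp only [Pi.smul_apply, smul_eq_mul]; ring

/-- The weight of a MaxWeight schedule exceeds that of a saturated rate vector by a multiple of the
distance to the cone. -/
lemma sum_mul_rate_sub_schedule_le {q z ν : Pair n → ℝ} (hq : ∀ k, 0 ≤ q k)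
    (hν : ν ∈ saturatedRates n) {δ : ℝ} (hδ : 0 ≤ δ) (hνδ : ∀ k, δ ≤ ν k) {s : Counts n}
    (hs : ∀ s' ∈ schedules n, ∑ k, q k * s' k ≤ ∑ k, q k * s k)
    (hz : ∀ x ∈ collapseCone n, ∑ k, z k * x k ≤ 0) {d : ℝ} (hd : 0 ≤ d)
    (hzd : ∀ k, |z k| ≤ d) (hqz : ∑ k, q k * z k = d ^ 2) :
    ∑ k, q k * (ν k - s k) ≤ -(δ * d) := by
  -- Tested on the generators of the cone, the polar condition says that the row and column sums of
  -- `z` are nonpositive.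
  have hrow : ∀ i, ∑ j, z (i, j) ≤ 0 := by
    intro i
    have := hz (incidence n *ᵥ Pi.single (Sum.inl i) 1)
      ⟨_, fun l => by by_cases h : l = Sum.inl i <;> simp [h], rfl⟩
    rw [sum_incidence_mul] at this
    simpa [ Pi.single_apply, incidence_transpose_mulVec_inl] using this
  have hcol : ∀ j, ∑ i, z (i, j) ≤ 0 := by
    intro j
    have := hz (incidence n *ᵥ Pi.single (Sum.inr j) 1)
      ⟨_, fun l => by by_cases h : l = Sum.inr j <;> simp [h], rfl⟩
    rw [sum_incidence_mul] at this
    simpa [ Pi.single_apply, incidence_transpose_mulVec_inr] using this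
  -- A step of size `δ` from `ν` along `z / d` stays substochastic: entries remain nonnegative
  -- because `|z k| ≤ d` and `δ ≤ ν k`, and sums do not grow. MaxWeight thus gains `(δ/d) ⟨q, z⟩ = δ
  -- d` over `ν`. For `d = 0` the quotient is `0`.
  have key := sum_mul_substochastic_le (D := fun k => ν k + δ / d * z k) hq ?_ ?_ ?_ hs
  · simp only [mul_add, Finset.sum_add_distrib] at key
    have h1 : ∑ k, q k * (δ / d * z k) = δ * d := by
      rw [show ∑ k, q k * (δ / d * z k) = δ / d * ∑ k, q k * z k by
        rw [Finset.mul_sum]; exact Finset.sum_congr rfl fun _ _ => by ring, hqz]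
      rcases hd.eq_or_lt with h | h
      · simp [← h]
      · field_simp
    simp only [mul_sub, Finset.sum_sub_distrib]
    linarith
  · intro k
    have h1 : -(δ / d * z k) ≤ δ := by
      calc -(δ / d * z k) ≤ |δ / d * z k| := neg_le_abs _
        _ = δ * (|z k| / d) := by
          rw [abs_mul, abs_of_nonneg (div_nonneg hδ hd)]; ring
        _ ≤ δ * 1 := mul_le_mul_of_nonneg_left (div_le_one_of_le₀ (hzd k) hd) hδ
        _ = δ := mul_one δ
    linarith [hνδ k]
  · intro j
    rw [Finset.sum_add_distrib, ← Finset.mul_sum, hν.2.1]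
    linarith [mul_nonneg (div_nonneg hδ hd) (neg_nonneg.2 (hcol j))]
  · intro i
    rw [Finset.sum_add_distrib, ← Finset.mul_sum, hν.2.2]
    linarith [mul_nonneg (div_nonneg hδ hd) (neg_nonneg.2 (hrow i))]

/-! ### Markov chains with countably many states -/

section Chain

lemma eq_of_le_of_tsum_eq {X : Type*} {a b : X → ℝ≥0∞} (hab : ∀ x, a x ≤ b x) (hs : ∑' x, a x = ∑' x, b x)
    (ht : ∑' x, a x ≠ ∞) (x : X) : a x = b x := by
  refine (hab x).antisymm (not_lt.1 fun hlt => ?_)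
  exact (ENNReal.tsum_lt_tsum ht hab hlt).ne hs

/-- Mass of an invariant vector is carried forward along every possible transition. Some transition
lowers the rank `r` as long as `x₀` is not reached, so mass anywhere produces mass at `x₀`. -/
lemma ne_zero_of_invariant {X : Type*} [MeasurableSpace X] {P : Kernel X X} {d : X → ℝ≥0∞}
    (hd : ∀ y, ∑' x, P x {y} * d x = d y) {x₀ : X} {r : X → ℕ}
    (hr : ∀ x ≠ x₀, ∃ y, P x {y} ≠ 0 ∧ r y < r x) (x : X) (hx : d x ≠ 0) : d x₀ ≠ 0 := by
  induction hN : r x using Nat.strong_induction_on generalizing x with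
  | _ N ih =>
    by_cases h : x = x₀
    · exact h ▸ hx
    · obtain ⟨y, hy, hlt⟩ := hr x h
      refine ih (r y) (hN ▸ hlt) y ?_ rfl
      rw [← hd y]
      intro h0
      exact mul_ne_zero hy hx (ENNReal.tsum_eq_zero.1 h0 x)

variable {X : Type*} [MeasurableSpace X] [Countable X] [MeasurableSingletonClass X]

/-- Foster's comparison: a drift inequality `f + P V ≤ V + g` bounds the stationary mean of `f`. -/
lemma lintegral_le_of_drift {P : Kernel X X} [IsMarkovKernel P] {π : Measure X}
    [IsProbabilityMeasure π] (hπ : π.bind P = π) {V f g : X → ℝ≥0∞} (hV : ∀ x, V x ≠ ∞)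
    (h : ∀ x, f x + ∫⁻ y, V y ∂P x ≤ V x + g x) : ∫⁻ x, f x ∂π ≤ ∫⁻ x, g x ∂π := by
  have hN : ∀ N : ℕ, ∫⁻ x, {x | V x ≤ N}.indicator f x ∂π ≤ ∫⁻ x, g x ∂π := by
    intro N
    -- `V` itself need not be integrable. The truncation is, so its integral can be cancelled by
    -- stationarity; it keeps the drift inequality where `V ≤ N`, and monotone convergence removes
    -- `N`.
    set W : X → ℝ≥0∞ := fun x => min (V x) N with hW
    have hpt : ∀ x, {x | V x ≤ N}.indicator f x + ∫⁻ y, W y ∂P x ≤ W x + g x := by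
      intro x
      by_cases hx : V x ≤ N
      · rw [Set.indicator_of_mem (by exact hx), hW]
        simp only [min_eq_left hx]
        refine le_trans ?_ (h x)
        gcongr
        exact min_le_left _ _
      · rw [Set.indicator_of_notMem (by exact hx), hW, zero_add]
        simp only [min_eq_right (not_le.1 hx).le]
        refine le_trans ?_ le_self_add
        calc ∫⁻ y, min (V y) N ∂P x ≤ ∫⁻ _, (N : ℝ≥0∞) ∂P x :=
              lintegral_mono fun y => min_le_right _ _
          _ = N := by simp
    have hWfin : ∫⁻ x, W x ∂π ≠ ∞ := by
      refine ne_top_of_le_ne_top (ENNReal.natCast_ne_top N) ?_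
      calc ∫⁻ x, W x ∂π ≤ ∫⁻ _, (N : ℝ≥0∞) ∂π := lintegral_mono fun y => min_le_right _ _
        _ = N := by simp
    have hinv : ∫⁻ x, ∫⁻ y, W y ∂P x ∂π = ∫⁻ x, W x ∂π := by
      conv_rhs => rw [← hπ]
      rw [Measure.lintegral_bind (by fun_prop) (Measurable.of_discrete).aemeasurable]
    have := lintegral_mono hpt (μ := π)
    rw [lintegral_add_left Measurable.of_discrete, lintegral_add_left Measurable.of_discrete,
      hinv, add_comm] at this
    exact (ENNReal.add_le_add_iff_left hWfin).1 this
  have hsup : ∀ x, f x = ⨆ N : ℕ, {x | V x ≤ N}.indicator f x := by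
    intro x
    obtain ⟨N, hxN⟩ := ENNReal.exists_nat_gt (hV x)
    refine le_antisymm ?_ (iSup_le fun N => Set.indicator_le_self _ _ _)
    refine le_trans (le_of_eq ?_) (le_iSup _ N)
    rw [Set.indicator_of_mem]
    exact hxN.le
  rw [lintegral_congr hsup, lintegral_iSup (fun _ => Measurable.of_discrete)]
  · exact iSup_le hN
  · intro N M hNM x
    refine Set.indicator_le_indicator_of_subset (fun y hy => ?_) (fun _ => zero_le) x
    exact le_trans (show V y ≤ N from hy) (by exact_mod_cast hNM)

lemma measure_singleton_eq_tsum_of_bind {P : Kernel X X} {π : Measure X} (hπ : π.bind P = π)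
    (y : X) : ∑' x, P x {y} * π {x} = π {y} := by
  conv_rhs => rw [← hπ]
  rw [Measure.bind_apply (measurableSet_singleton y) (by fun_prop), lintegral_countable']

lemma tsum_measure_singleton (π : Measure X) [IsProbabilityMeasure π] : ∑' x, π {x} = 1 := by
  have := lintegral_countable' (μ := π) (fun _ => 1)
  simpa using this.symm

/-- A chain that can reach a fixed state from everywhere has at most one stationary law. -/
lemma eq_of_bind_eq {P : Kernel X X} [IsMarkovKernel P] {π₁ π₂ : Measure X}
    [IsProbabilityMeasure π₁] [IsProbabilityMeasure π₂] (h₁ : π₁.bind P = π₁)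
    (h₂ : π₂.bind P = π₂) {x₀ : X} {r : X → ℕ}
    (hr : ∀ x ≠ x₀, ∃ y, P x {y} ≠ 0 ∧ r y < r x) : π₁ = π₂ := by
  -- The minimum of two invariant laws is superinvariant, and since `P` preserves total mass it is
  -- invariant. So are the excesses `π₁ - m` and `π₂ - m`. One of them vanishes at `x₀`, hence
  -- everywhere, and two comparable laws of mass `1` coincide.
  set m : X → ℝ≥0∞ := fun x => min (π₁ {x}) (π₂ {x}) with hm
  have hmle₁ : ∀ x, m x ≤ π₁ {x} := fun x => min_le_left _ _
  have hmle₂ : ∀ x, m x ≤ π₂ {x} := fun x => min_le_right _ _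
  have hmfin : ∀ x, m x ≠ ∞ := fun x => ne_top_of_le_ne_top (measure_ne_top π₁ _) (hmle₁ x)
  have hsub : ∀ y, ∑' x, P x {y} * m x ≤ m y := by
    intro y
    refine le_min ?_ ?_
    · rw [← measure_singleton_eq_tsum_of_bind h₁ y]
      exact ENNReal.tsum_le_tsum fun x => by gcongr; exact hmle₁ x
    · rw [← measure_singleton_eq_tsum_of_bind h₂ y]
      exact ENNReal.tsum_le_tsum fun x => by gcongr; exact hmle₂ x
  have hsum : ∑' y, ∑' x, P x {y} * m x = ∑' y, m y := by
    rw [ENNReal.tsum_comm]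
    simp_rw [ENNReal.tsum_mul_right, tsum_measure_singleton, one_mul]
  have hmsum : ∑' y, m y ≠ ∞ := by
    refine ne_top_of_le_ne_top ENNReal.one_ne_top ?_
    rw [← tsum_measure_singleton π₁]
    exact ENNReal.tsum_le_tsum hmle₁
  have hminv : ∀ y, ∑' x, P x {y} * m x = m y :=
    eq_of_le_of_tsum_eq hsub hsum (hsum ▸ hmsum)
  have hdinv : ∀ π : Measure X, π.bind P = π → (∀ x, m x ≤ π {x}) →
      ∀ y, ∑' x, P x {y} * (π {x} - m x) = π {y} - m y := by
    intro π hπ hle y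
    have : ∑' x, P x {y} * (π {x} - m x) + m y = π {y} := by
      rw [← hminv y, ← measure_singleton_eq_tsum_of_bind hπ y, ← ENNReal.tsum_add]
      refine tsum_congr fun x => ?_
      rw [← mul_add, tsub_add_cancel_of_le (hle x)]
    rw [← this, ENNReal.add_sub_cancel_right (hmfin y)]
  have hfinal : ∀ π : Measure X, [IsProbabilityMeasure π] → π.bind P = π →
      (∀ x, m x ≤ π {x}) → m x₀ = π {x₀} → ∀ x, π {x} = m x := by
    intro π _ hπ hle h0 x
    by_contra hne
    refine ne_zero_of_invariant (hdinv π hπ hle) hr x ?_ (by rw [h0, tsub_self])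
    exact (tsub_pos_of_lt (lt_of_le_of_ne (hle x) (Ne.symm hne))).ne'
  have hs : ∑' x, π₁ {x} = ∑' x, π₂ {x} := by simp_rw [tsum_measure_singleton]
  have h1top : ∑' x, π₁ {x} ≠ ∞ := by simp [tsum_measure_singleton]
  have h2top : ∑' x, π₂ {x} ≠ ∞ := by simp [tsum_measure_singleton]
  refine Measure.ext_of_singleton fun x => ?_
  rcases min_choice (π₁ {x₀}) (π₂ {x₀}) with h0 | h0
  · exact eq_of_le_of_tsum_eq
      (fun x => by rw [hfinal π₁ h₁ hmle₁ h0 x]; exact hmle₂ x) hs h1top x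
  · exact (eq_of_le_of_tsum_eq
      (fun x => by rw [hfinal π₂ h₂ hmle₂ h0 x]; exact hmle₁ x) hs.symm h2top x).symm

end Chain

/-- A tight sequence of probability measures has a weakly convergent subsequence. -/
lemma exists_subseq_tendsto_of_tight {E : Type*} [TopologicalSpace E]
    [TopologicalSpace.MetrizableSpace E] [TopologicalSpace.SeparableSpace E] [MeasurableSpace E]
    [BorelSpace E] (μ : ℕ → ProbabilityMeasure E)
    (h : ∀ δ : ℝ≥0∞, 0 < δ → ∃ K : Set E, IsCompact K ∧ ∀ m, (μ m : Measure E) Kᶜ ≤ δ) :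
    ∃ (φ : ℕ → ℕ) (μ' : ProbabilityMeasure E), StrictMono φ ∧
      Tendsto (fun m => μ (φ m)) atTop (𝓝 μ') := by
  have ht : IsTightMeasureSet {((ρ : ProbabilityMeasure E) : Measure E) | ρ ∈ Set.range μ} := by
    rw [isTightMeasureSet_iff_exists_isCompact_measure_compl_le]
    intro δ hδ
    obtain ⟨K, hK, hKμ⟩ := h δ hδ
    refine ⟨K, hK, ?_⟩
    rintro _ ⟨_, ⟨m, rfl⟩, rfl⟩
    exact hKμ m
  obtain ⟨μ', -, φ, hφ, hlim⟩ := (isCompact_closure_of_isTightMeasureSet ht).tendsto_subseq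
    (fun m => subset_closure (Set.mem_range_self m))
  exact ⟨φ, μ', hφ, hlim⟩

/-! ### Existence of a stationary law from a drift condition -/

section Existence

variable {X : Type*} [MeasurableSpace X] [Countable X] [TopologicalSpace X] [DiscreteTopology X]
  [BorelSpace X]

/-- The Krylov–Bogoliubov theorem for chains with countably many states and a drift condition. -/
lemma exists_bind_eq_of_drift {P : Kernel X X} [IsMarkovKernel P] {V f : X → ℝ≥0∞} {b : ℝ≥0∞}
    (hb : b ≠ ∞) {x₀ : X} (hV : V x₀ ≠ ∞) (hf : ∀ R : ℕ, {x | f x ≤ R}.Finite)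
    (h : ∀ x, f x + ∫⁻ y, V y ∂P x ≤ V x + b) :
    ∃ π : Measure X, IsProbabilityMeasure π ∧ π.bind P = π := by
  set ρ : ℕ → Measure X := fun t => (fun μ => μ.bind P)^[t] (Measure.dirac x₀) with hρ
  have hρ_succ : ∀ t, ρ (t + 1) = (ρ t).bind P := fun t => by
    simp only [hρ, Function.iterate_succ_apply']
  have hρ_prob : ∀ t, IsProbabilityMeasure (ρ t) := by
    intro t
    induction t with
    | zero => simp only [hρ, Function.iterate_zero, id]; infer_instance
    | succ t ih => rw [hρ_succ]; infer_instance
  -- The drift inequality, telescoped along the chain started at `x₀`. After division by the time it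
  -- bounds the mean of `f` under the Cesàro averages, and the finite level sets of `f` make these
  -- averages tight.
  have hbound : ∀ N, ∑ t ∈ Finset.range N, ∫⁻ x, f x ∂ρ t + ∫⁻ x, V x ∂ρ N ≤ V x₀ + N * b := by
    intro N
    induction N with
    | zero => simp [hρ]
    | succ N ih =>
      rw [Finset.sum_range_succ, add_assoc]
      have hstep : ∫⁻ x, f x ∂ρ N + ∫⁻ x, V x ∂ρ (N + 1) ≤ ∫⁻ x, V x ∂ρ N + b := by
        rw [hρ_succ, Measure.lintegral_bind (by fun_prop) (Measurable.of_discrete).aemeasurable,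
          ← lintegral_add_left Measurable.of_discrete]
        refine (lintegral_mono h).trans (le_of_eq ?_)
        rw [lintegral_add_left Measurable.of_discrete]
        simp
      calc _ ≤ ∑ t ∈ Finset.range N, ∫⁻ x, f x ∂ρ t + (∫⁻ x, V x ∂ρ N + b) := by gcongr
        _ ≤ V x₀ + N * b + b := by rw [← add_assoc]; gcongr
        _ = V x₀ + ((N + 1 : ℕ) : ℝ≥0∞) * b := by push_cast; ring
  set avg : ℕ → Measure X := fun N => ((N + 1 : ℕ) : ℝ≥0∞)⁻¹ • ∑ t ∈ Finset.range (N + 1), ρ t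
    with havg
  have hinv_mul : ∀ N : ℕ, ((N + 1 : ℕ) : ℝ≥0∞)⁻¹ * ((N + 1 : ℕ) : ℝ≥0∞) = 1 := fun N =>
    ENNReal.inv_mul_cancel (by simp) (ENNReal.natCast_ne_top _)
  have havg_prob : ∀ N, IsProbabilityMeasure (avg N) := fun N => ⟨by
    simp only [havg, Measure.smul_apply, Measure.finsetSum_apply, measure_univ, smul_eq_mul,
      Finset.sum_const, Finset.card_range, nsmul_eq_mul, mul_one]
    exact hinv_mul N⟩
  have havg_f : ∀ N, ∫⁻ x, f x ∂avg N ≤ V x₀ + b := by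
    intro N
    simp only [havg, lintegral_smul_measure, lintegral_finsetSum_measure, smul_eq_mul]
    calc _ ≤ ((N + 1 : ℕ) : ℝ≥0∞)⁻¹ * (V x₀ + (N + 1 : ℕ) * b) := by
          gcongr
          exact le_self_add.trans (hbound (N + 1))
      _ = ((N + 1 : ℕ) : ℝ≥0∞)⁻¹ * V x₀ + b := by rw [mul_add, ← mul_assoc, hinv_mul, one_mul]
      _ ≤ 1 * V x₀ + b := by
          gcongr
          rw [ENNReal.inv_le_one]
          exact_mod_cast Nat.succ_le_succ (Nat.zero_le N)
      _ = V x₀ + b := by rw [one_mul]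
  obtain ⟨φ, π, hφ, hlim⟩ := exists_subseq_tendsto_of_tight
    (fun N => (⟨avg N, havg_prob N⟩ : ProbabilityMeasure X)) (by
      intro δ hδ
      have hC : V x₀ + b ≠ ∞ := ENNReal.add_ne_top.2 ⟨hV, hb⟩
      obtain ⟨R, hR⟩ := ENNReal.exists_nat_mul_gt hδ.ne' hC
      refine ⟨{x | f x ≤ R}, (hf R).isCompact, fun N => ?_⟩
      have hR0 : (R : ℝ≥0∞) ≠ 0 := by
        rintro h0
        simp [h0] at hR
      have hmk : (R : ℝ≥0∞) * avg N {x | f x ≤ R}ᶜ ≤ V x₀ + b := by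
        refine le_trans ?_ (havg_f N)
        refine le_trans ?_ (mul_meas_ge_le_lintegral Measurable.of_discrete (R : ℝ≥0∞))
        gcongr
        intro x hx
        exact (not_le.1 (show ¬ f x ≤ R from hx)).le
      have h2 : (R : ℝ≥0∞) * avg N {x | f x ≤ R}ᶜ ≤ R * δ := hmk.trans hR.le
      exact (ENNReal.mul_le_mul_iff_right hR0 (ENNReal.natCast_ne_top R)).1 h2)
  refine ⟨π, inferInstance, Measure.ext_of_singleton fun y => ?_⟩
  have hlim := ProbabilityMeasure.tendsto_iff_forall_lintegral_tendsto.1 hlim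
  have hF : ∀ F : X → ℝ≥0, (∀ x, F x ≤ 1) →
      Tendsto (fun N => ∫⁻ x, F x ∂avg (φ N)) atTop (𝓝 (∫⁻ x, F x ∂(π : Measure X))) := by
    intro F hF1
    exact hlim (BoundedContinuousFunction.mkOfBound ⟨F, continuous_of_discreteTopology⟩ 1 (by
      intro x x'
      refine (NNReal.dist_eq _ _).trans_le (abs_sub_le_iff.2 ⟨?_, ?_⟩)
      · have := (F x').2
        have := hF1 x
        have h1 : ((F x : ℝ≥0) : ℝ) ≤ 1 := by exact_mod_cast this
        simp only [ContinuousMap.coe_mk]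
        linarith [(F x').coe_nonneg]
      · have h1 : ((F x' : ℝ≥0) : ℝ) ≤ 1 := by exact_mod_cast hF1 x'
        simp only [ContinuousMap.coe_mk]
        linarith [(F x).coe_nonneg]))
  -- On a discrete space both `x ↦ P x {y}` and the indicator of `y` are bounded continuous test
  -- functions; they give the limits of the averages after and before one step.
  have hA := hF (fun x => (P x {y}).toNNReal) fun x => by
    have : P x {y} ≤ 1 := prob_le_one
    simpa using ENNReal.toNNReal_mono ENNReal.one_ne_top this
  have hB := hF (fun x => Set.indicator {y} 1 x) fun x => by
    by_cases hx : x = y <;> simp [Set.indicator, hx]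
  have eA : ∀ ρ' : Measure X, ∫⁻ x, ((P x {y}).toNNReal : ℝ≥0∞) ∂ρ' = ρ'.bind P {y} := by
    intro ρ'
    rw [Measure.bind_apply (measurableSet_singleton y) (by fun_prop)]
    refine lintegral_congr fun x => ENNReal.coe_toNNReal (measure_ne_top _ _)
  have eB : ∀ ρ' : Measure X, ∫⁻ x, ((Set.indicator {y} 1 x : ℝ≥0) : ℝ≥0∞) ∂ρ' = ρ' {y} := by
    intro ρ'
    rw [← lintegral_indicator_one (measurableSet_singleton y)]
    refine lintegral_congr fun x => ?_
    by_cases hx : x = y <;> simp [Set.indicator, hx]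
  simp only [eA] at hA
  simp only [eB] at hB
  have hc : ∀ a : ℕ → ℝ≥0∞, (∀ N, a N ≤ 1) →
      Tendsto (fun N => ((φ N + 1 : ℕ) : ℝ≥0∞)⁻¹ * a (φ N)) atTop (𝓝 0) := by
    intro a ha
    have h0 : Tendsto (fun N : ℕ => ((N + 1 : ℕ) : ℝ≥0∞)⁻¹) atTop (𝓝 0) :=
      (tendsto_add_atTop_iff_nat 1).2 ENNReal.tendsto_inv_nat_nhds_zero
    refine tendsto_of_tendsto_of_tendsto_of_le_of_le tendsto_const_nhds
      (h0.comp hφ.tendsto_atTop) (fun _ => zero_le) fun N => ?_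
    exact mul_le_of_le_one_right' (ha _)
  -- One step changes a Cesàro average only by its two end terms, of size `1 / (N + 1)`. The
  -- relation is additive because subtraction in `ℝ≥0∞` is truncated.
  have hrel : ∀ N, (avg N).bind P {y} + ((N + 1 : ℕ) : ℝ≥0∞)⁻¹ * ρ 0 {y} =
      avg N {y} + ((N + 1 : ℕ) : ℝ≥0∞)⁻¹ * ρ (N + 1) {y} := by
    intro N
    rw [← eA]
    simp only [havg, lintegral_smul_measure, lintegral_finsetSum_measure, smul_eq_mul]
    simp only [eA, ← hρ_succ, Measure.smul_apply, Measure.finsetSum_apply, smul_eq_mul]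
    rw [← mul_add, ← mul_add, ← Finset.sum_range_succ (fun t => ρ t {y}),
      Finset.sum_range_succ' (fun t => ρ t {y})]
  have l1 := hA.add (hc (fun _ => ρ 0 {y}) fun _ => prob_le_one)
  have l2 := hB.add (hc (fun N => ρ (N + 1) {y}) fun _ => prob_le_one)
  simp only [hrel, add_zero] at l1 l2
  exact tendsto_nhds_unique l1 l2

end Existence

/-! ### The chain of queue lengths -/

lemma lintegral_slotLaw (T : Kernel (Counts n) (Counts n)) [IsMarkovKernel T]
    (A : Pair n → Measure ℕ) [∀ k, IsProbabilityMeasure (A k)] (π : Measure (Counts n))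
    [IsProbabilityMeasure π] (f : (Counts n × Counts n) × Counts n → ℝ≥0∞) :
    ∫⁻ x, f x ∂slotLaw T A π =
      ∫⁻ q, ∫⁻ s, ∫⁻ a, f ((q, s), a) ∂Measure.pi A ∂T q ∂π := by
  rw [slotLaw, lintegral_prod _ Measurable.of_discrete.aemeasurable,
    Measure.lintegral_compProd Measurable.of_discrete]

/-- The transition kernel of the queue lengths. -/
noncomputable def transition (T : Kernel (Counts n) (Counts n)) (A : Pair n → Measure ℕ) :
    Kernel (Counts n) (Counts n) where
  toFun q := ((T q).prod (Measure.pi A)).map fun p => nextQueue ((q, p.1), p.2)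
  measurable' := Measurable.of_discrete

lemma lintegral_transition (T : Kernel (Counts n) (Counts n)) (A : Pair n → Measure ℕ)
    (q : Counts n) (f : Counts n → ℝ≥0∞) :
    ∫⁻ y, f y ∂transition T A q =
      ∫⁻ s, ∫⁻ a, f (nextQueue ((q, s), a)) ∂Measure.pi A ∂T q := by
  change ∫⁻ y, f y ∂(((T q).prod (Measure.pi A)).map fun p => nextQueue ((q, p.1), p.2)) = _
  rw [lintegral_map Measurable.of_discrete Measurable.of_discrete,
    lintegral_prod _ Measurable.of_discrete.aemeasurable]

/-- A bound for all MaxWeight schedules gives a bound for the transition kernel. -/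
lemma lintegral_transition_le {T : Kernel (Counts n) (Counts n)} [IsMarkovKernel T]
    {A : Pair n → Measure ℕ} (hT : IsMaxWeight T) (q : Counts n) {V : Counts n → ℝ≥0∞}
    {b c : ℝ≥0∞} (h : ∀ s ∈ schedules n, (∀ s' ∈ schedules n, weight q s' ≤ weight q s) →
      b + ∫⁻ a, V (nextQueue ((q, s), a)) ∂Measure.pi A ≤ c) :
    b + ∫⁻ y, V y ∂transition T A q ≤ c := by
  rw [lintegral_transition]
  calc b + ∫⁻ s, ∫⁻ a, V (nextQueue ((q, s), a)) ∂Measure.pi A ∂T q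
      = ∫⁻ s, (b + ∫⁻ a, V (nextQueue ((q, s), a)) ∂Measure.pi A) ∂T q := by
        rw [lintegral_add_left measurable_const]; simp
    _ ≤ ∫⁻ _, c ∂T q := lintegral_mono_ae ((hT q).mono fun s hs => h s hs.1 hs.2)
    _ = c := by simp

section Transition

variable (T : Kernel (Counts n) (Counts n)) [IsMarkovKernel T] (A : Pair n → Measure ℕ)
  [∀ k, IsProbabilityMeasure (A k)]

instance : IsMarkovKernel (transition T A) :=
  ⟨fun _ => Measure.isProbabilityMeasure_map Measurable.of_discrete.aemeasurable⟩

lemma map_nextQueue_slotLaw (π : Measure (Counts n)) [IsProbabilityMeasure π] :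
    (slotLaw T A π).map nextQueue = π.bind (transition T A) := by
  refine Measure.ext_of_lintegral _ fun f _ => ?_
  rw [lintegral_map Measurable.of_discrete Measurable.of_discrete, lintegral_slotLaw,
    Measure.lintegral_bind (by fun_prop) Measurable.of_discrete.aemeasurable]
  simp only [lintegral_transition]

instance isProbabilityMeasure_slotLaw (π : Measure (Counts n)) [IsProbabilityMeasure π] :
    IsProbabilityMeasure (slotLaw T A π) := by
  unfold slotLaw; infer_instance

lemma isSteadyState_iff {π : Measure (Counts n)} :
    IsSteadyState T A π ↔ IsProbabilityMeasure π ∧ π.bind (transition T A) = π := by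
  constructor
  · rintro ⟨h1, h2⟩
    exact ⟨h1, by rw [← map_nextQueue_slotLaw, h2]⟩
  · rintro ⟨h1, h2⟩
    exact ⟨h1, by rw [map_nextQueue_slotLaw, h2]⟩

variable {T A}

lemma IsSteadyState.lintegral_le_of_drift {π : Measure (Counts n)} (hπ : IsSteadyState T A π)
    (hT : IsMaxWeight T) {V f g : Counts n → ℝ≥0∞} (hV : ∀ x, V x ≠ ∞)
    (h : ∀ q, ∀ s ∈ schedules n, (∀ s' ∈ schedules n, weight q s' ≤ weight q s) →
      f q + ∫⁻ a, V (nextQueue ((q, s), a)) ∂Measure.pi A ≤ V q + g q) :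
    ∫⁻ x, f x ∂π ≤ ∫⁻ x, g x ∂π := by
  obtain ⟨h1, h2⟩ := (isSteadyState_iff T A).1 hπ
  exact InputQueuedSwitch.lintegral_le_of_drift h2 hV fun q =>
    lintegral_transition_le hT q (h q)

end Transition

/-! ### Arrivals -/

section Arrivals

variable {A : Pair n → Measure ℕ} [∀ k, IsProbabilityMeasure (A k)] {aMax : ℕ}

lemma ae_pi_le (hb : ∀ k, ∀ᵐ m ∂(A k), m ≤ aMax) : ∀ᵐ a ∂Measure.pi A, ∀ k, a k ≤ aMax :=
  ae_all_iff.2 fun k => (measurePreserving_eval A k).quasiMeasurePreserving.ae (hb k)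

lemma integrable_natCast {A : Measure ℕ} [IsProbabilityMeasure A] (hb : ∀ᵐ m ∂A, m ≤ aMax) :
    Integrable (fun m : ℕ => (m : ℝ)) A :=
  Integrable.of_bound Measurable.of_discrete.aestronglyMeasurable aMax
    (hb.mono fun m hm => by simpa using hm)

lemma integrable_pi_of_bound {E : Type*} [NormedAddCommGroup E] {F : Counts n → E} (C : ℝ)
    (hb : ∀ k, ∀ᵐ m ∂(A k), m ≤ aMax) (hF : ∀ a, (∀ k, a k ≤ aMax) → ‖F a‖ ≤ C) :
    Integrable F (Measure.pi A) :=
  Integrable.of_bound StronglyMeasurable.of_discrete.aestronglyMeasurable C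
    ((ae_pi_le hb).mono fun a ha => hF a ha)

lemma integrable_eval (hb : ∀ k, ∀ᵐ m ∂(A k), m ≤ aMax) (k : Pair n) :
    Integrable (fun a : Counts n => (a k : ℝ)) (Measure.pi A) :=
  integrable_pi_of_bound aMax hb fun a ha => by simpa using ha k

lemma integral_eval (k : Pair n) :
    ∫ a : Counts n, (a k : ℝ) ∂Measure.pi A = ∫ m : ℕ, (m : ℝ) ∂A k := by
  rw [← (measurePreserving_eval A k).map_eq,
    integral_map Measurable.of_discrete.aemeasurable Measurable.of_discrete.aestronglyMeasurable]

lemma integral_affine (hb : ∀ k, ∀ᵐ m ∂(A k), m ≤ aMax) (c : ℝ) (b : Pair n → ℝ) :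
    ∫ a : Counts n, (c + ∑ k, b k * (a k : ℝ)) ∂Measure.pi A =
      c + ∑ k, b k * ∫ m : ℕ, (m : ℝ) ∂A k := by
  rw [integral_add (integrable_const _)
    (integrable_finsetSum _ fun k _ => (integrable_eval hb k).const_mul _),
    integral_finsetSum _ fun k _ => (integrable_eval hb k).const_mul _]
  simp [integral_const_mul, integral_eval]

/-- A pointwise bound that is affine in the arrivals, integrated. -/
lemma add_lintegral_ofReal_le_of_affine (hb : ∀ k, ∀ᵐ m ∂(A k), m ≤ aMax) {G : Counts n → ℝ}
    (hG0 : ∀ a, 0 ≤ G a) (c : ℝ) (b : Pair n → ℝ)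
    (hG : ∀ a, (∀ k, a k ≤ aMax) → G a ≤ c + ∑ k, b k * (a k : ℝ)) {t v : ℝ} (ht : 0 ≤ t)
    (hv : t + (c + ∑ k, b k * ∫ m : ℕ, (m : ℝ) ∂A k) ≤ v) :
    ENNReal.ofReal t + ∫⁻ a, ENNReal.ofReal (G a) ∂Measure.pi A ≤ ENNReal.ofReal v := by
  have hinteg : Integrable (fun a : Counts n => c + ∑ k, b k * (a k : ℝ)) (Measure.pi A) :=
    (integrable_const _).add
      (integrable_finsetSum _ fun k _ => (integrable_eval hb k).const_mul _)
  have h0 : 0 ≤ᵐ[Measure.pi A] fun a : Counts n => c + ∑ k, b k * (a k : ℝ) :=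
    (ae_pi_le hb).mono fun a ha => (hG0 a).trans (hG a ha)
  have hle : ∫⁻ a, ENNReal.ofReal (G a) ∂Measure.pi A ≤
      ENNReal.ofReal (c + ∑ k, b k * ∫ m : ℕ, (m : ℝ) ∂A k) := by
    rw [← integral_affine hb, ofReal_integral_eq_lintegral_ofReal hinteg h0]
    exact lintegral_mono_ae ((ae_pi_le hb).mono fun a ha => ENNReal.ofReal_le_ofReal (hG a ha))
  have hnn : 0 ≤ c + ∑ k, b k * ∫ m : ℕ, (m : ℝ) ∂A k := by
    rw [← integral_affine hb]
    exact integral_nonneg_of_ae h0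
  calc _ ≤ ENNReal.ofReal t + ENNReal.ofReal (c + ∑ k, b k * ∫ m : ℕ, (m : ℝ) ∂A k) := by gcongr
    _ = ENNReal.ofReal (t + (c + ∑ k, b k * ∫ m : ℕ, (m : ℝ) ∂A k)) :=
        (ENNReal.ofReal_add ht hnn).symm
    _ ≤ ENNReal.ofReal v := ENNReal.ofReal_le_ofReal hv

/-- A natural number that is almost surely nonzero is at least `1`, so its mean could not be below
`1`. This makes slots without arrivals possible. -/
lemma measure_singleton_zero_ne_zero {A : Measure ℕ} [IsProbabilityMeasure A]
    (hb : ∀ᵐ m ∂A, m ≤ aMax) (hm : ∫ m : ℕ, (m : ℝ) ∂A < 1) : A {0} ≠ 0 := by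
  intro h0
  have : ∀ᵐ m : ℕ ∂A, (1 : ℝ) ≤ m := by
    rw [ae_iff_of_countable]
    intro m hmA
    have : m ≠ 0 := fun h => hmA (h ▸ h0)
    exact_mod_cast Nat.one_le_iff_ne_zero.2 this
  have h1 := integral_mono_ae (integrable_const (1 : ℝ)) (integrable_natCast hb) this
  simp at h1
  linarith

end Arrivals

/-! ### One slot -/

/-- MaxWeight in terms of real vectors. -/
lemma sum_mul_schedule_le {q s s' : Counts n} (h : weight q s' ≤ weight q s) :
    ∑ k, (q k : ℝ) * s' k ≤ ∑ k, (q k : ℝ) * s k := by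
  have : ((weight q s' : ℕ) : ℝ) ≤ (weight q s : ℕ) := by exact_mod_cast h
  simpa [weight] using this

lemma nextQueue_cast (x : (Counts n × Counts n) × Counts n) (k : Pair n) :
    (nextQueue x k : ℝ) = x.1.1 k + x.2 k - x.1.2 k + unused x k := by
  simp only [nextQueue, unused]
  rcases le_total (x.1.2 k) (x.1.1 k + x.2 k) with h | h
  · rw [Nat.sub_eq_zero_of_le h, Nat.cast_sub h]
    push_cast; ring
  · rw [Nat.sub_eq_zero_of_le h, Nat.cast_sub h]
    push_cast; ring

/-- A schedule offers at most one unit per queue, so any packet present would use it up. In the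
limit this is what puts the boundary measures on the faces. -/
lemma queue_eq_zero_of_unused {q s a : Counts n} (hs : s ∈ schedules n) {k : Pair n}
    (h : unused ((q, s), a) k ≠ 0) : q k = 0 := by
  have h1 := schedules_le_one hs k
  simp only [unused] at h
  omega

lemma sum_nextQueue {q s a : Counts n} (hs : s ∈ schedules n) :
    ∑ k, nextQueue ((q, s), a) k + n = ∑ k, q k + ∑ k, a k + ∑ k, unused ((q, s), a) k := by
  have h : ∑ k, nextQueue ((q, s), a) k + ∑ k, s k =
      ∑ k, q k + ∑ k, a k + ∑ k, unused ((q, s), a) k := by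
    rw [← Finset.sum_add_distrib, ← Finset.sum_add_distrib, ← Finset.sum_add_distrib]
    refine Finset.sum_congr rfl fun k _ => ?_
    simp only [nextQueue, unused]
    omega
  rwa [sum_schedule hs] at h

lemma abs_arrival_sub_schedule_le {aMax : ℕ} {s a : Counts n} (hs : s ∈ schedules n)
    (ha : ∀ k, a k ≤ aMax) (k : Pair n) : |(a k : ℝ) - s k| ≤ aMax + 1 := by
  have h1 : (a k : ℝ) ≤ aMax := by exact_mod_cast ha k
  have h2 : (s k : ℝ) ≤ 1 := by exact_mod_cast schedules_le_one hs k
  rw [abs_le]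
  constructor <;> linarith [(Nat.cast_nonneg (a k) : (0 : ℝ) ≤ _),
    (Nat.cast_nonneg (s k) : (0 : ℝ) ≤ _)]

lemma abs_nextQueue_sub_le {aMax : ℕ} {q s a : Counts n} (hs : s ∈ schedules n)
    (ha : ∀ k, a k ≤ aMax) (k : Pair n) :
    |(nextQueue ((q, s), a) k : ℝ) - q k| ≤ aMax + 1 := by
  have h1 : (a k : ℝ) ≤ aMax := by exact_mod_cast ha k
  have h2 : (s k : ℝ) ≤ 1 := by exact_mod_cast schedules_le_one hs k
  have h3 : (nextQueue ((q, s), a) k : ℝ) ≤ q k + a k := by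
    exact_mod_cast Nat.sub_le (q k + a k) (s k)
  have h4 : (q k : ℝ) ≤ nextQueue ((q, s), a) k + 1 := by
    have := schedules_le_one hs k
    have : q k ≤ nextQueue ((q, s), a) k + 1 := by simp only [nextQueue]; omega
    exact_mod_cast this
  rw [abs_le]
  constructor <;> linarith [(Nat.cast_nonneg aMax : (0 : ℝ) ≤ _)]

lemma sum_pair_const (c : ℝ) : ∑ _k : Pair n, c = n ^ 2 * c := by
  simp [sq]

lemma rate_le_one {ν : Pair n → ℝ} (hν : ν ∈ saturatedRates n) (k : Pair n) : ν k ≤ 1 := by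
  rw [← hν.2.2 k.1]
  exact Finset.single_le_sum (f := fun j => ν (k.1, j)) (fun j _ => hν.1 _) (Finset.mem_univ k.2)

lemma exists_rate_lower_bound {ν : Pair n → ℝ} (hν_pos : ∀ k, 0 < ν k) :
    ∃ δ > 0, ∀ k, δ ≤ ν k := by
  rcases isEmpty_or_nonempty (Pair n) with h | h
  · exact ⟨1, one_pos, fun k => h.elim k⟩
  · obtain ⟨k₀, hk₀⟩ := Finite.exists_min ν
    exact ⟨ν k₀, hν_pos k₀, hk₀⟩

/-- The drift of the quadratic Lyapunov function. -/
lemma quadratic_drift {A : Pair n → Measure ℕ} [∀ k, IsProbabilityMeasure (A k)] {aMax : ℕ}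
    (hb : ∀ k, ∀ᵐ m ∂(A k), m ≤ aMax) {ν : Pair n → ℝ} (hν : ν ∈ saturatedRates n) {ε : ℝ}
    (hε : 0 ≤ ε) (hm : ∀ k, ∫ m, (m : ℝ) ∂(A k) = (1 - ε) * ν k) {δ : ℝ} (hδ : 0 ≤ δ)
    (hνδ : ∀ k, δ ≤ ν k) {q s : Counts n} (hs : s ∈ schedules n)
    (hmax : ∀ s' ∈ schedules n, weight q s' ≤ weight q s) :
    ENNReal.ofReal (2 * ε * δ * ∑ k, (q k : ℝ)) +
      ∫⁻ a, ENNReal.ofReal (∑ k, (nextQueue ((q, s), a) k : ℝ) ^ 2) ∂Measure.pi A ≤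
    ENNReal.ofReal (∑ k, (q k : ℝ) ^ 2) + ENNReal.ofReal (n ^ 2 * ((aMax : ℝ) + 1) ^ 2) := by
  have hlin : ∑ k, 2 * (q k : ℝ) * ∫ m, (m : ℝ) ∂(A k) =
      2 * ((1 - ε) * ∑ k, (q k : ℝ) * ν k) := by
    rw [Finset.mul_sum, Finset.mul_sum]
    exact Finset.sum_congr rfl fun k _ => by rw [hm]; ring
  -- The schedule outweighs the saturated rates `ν`. Since arrivals have rates `(1 - ε) ν`, a drift
  -- of at least `2 ε ⟨q, ν⟩ ≥ 2 ε δ ∑ q` is left over.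
  have hmw : ∑ k, (q k : ℝ) * ν k ≤ ∑ k, (q k : ℝ) * s k :=
    sum_mul_doublyStochastic_le hν fun s' hs' => sum_mul_schedule_le (hmax s' hs')
  have hqν : δ * ∑ k, (q k : ℝ) ≤ ∑ k, (q k : ℝ) * ν k := by
    rw [Finset.mul_sum]
    exact Finset.sum_le_sum fun k _ => by
      rw [mul_comm]; exact mul_le_mul_of_nonneg_left (hνδ k) (Nat.cast_nonneg _)
  have hQ0 : (0 : ℝ) ≤ ∑ k, (q k : ℝ) := Finset.sum_nonneg fun k _ => Nat.cast_nonneg _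
  rw [← ENNReal.ofReal_add (by positivity) (by positivity)]
  refine add_lintegral_ofReal_le_of_affine hb
    (G := fun a => ∑ k, (nextQueue ((q, s), a) k : ℝ) ^ 2)
    (fun a => Finset.sum_nonneg fun k _ => sq_nonneg _)
    (∑ k, (q k : ℝ) ^ 2 + n ^ 2 * ((aMax : ℝ) + 1) ^ 2 - 2 * ∑ k, (q k : ℝ) * s k)
    (fun k => 2 * q k) (by
      intro a ha
      have hk : ∀ k, (nextQueue ((q, s), a) k : ℝ) ^ 2 ≤
          (q k : ℝ) ^ 2 + ((aMax : ℝ) + 1) ^ 2 - 2 * (q k * s k) + 2 * q k * a k := by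
        intro k
        -- Unused service only replaces a negative value by `0`, which lowers the square.
        have e1 : (nextQueue ((q, s), a) k : ℝ) ^ 2 ≤ ((q k : ℝ) + (a k - s k)) ^ 2 := by
          rw [nextQueue_cast]
          rcases Nat.eq_zero_or_pos (unused ((q, s), a) k) with h0 | h0
          · rw [h0]; simp only [Nat.cast_zero, add_zero]; exact le_of_eq (by ring)
          · have : nextQueue ((q, s), a) k = 0 := by
              simp only [unused] at h0
              simp only [nextQueue]
              omega
            rw [← nextQueue_cast, this]
            simpa using sq_nonneg ((q k : ℝ) + (a k - s k))
        have e2 : ((a k : ℝ) - s k) ^ 2 ≤ ((aMax : ℝ) + 1) ^ 2 :=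
          sq_le_sq' (abs_le.1 (abs_arrival_sub_schedule_le hs ha k)).1
            (abs_le.1 (abs_arrival_sub_schedule_le hs ha k)).2
        nlinarith
      refine (Finset.sum_le_sum fun k _ => hk k).trans (le_of_eq ?_)
      rw [Finset.sum_add_distrib, Finset.sum_sub_distrib, Finset.sum_add_distrib, sum_pair_const,
        Finset.mul_sum]) (by positivity) ?_
  rw [hlin]
  nlinarith [mul_le_mul_of_nonneg_left hqν hε]

/-! ### Existence and uniqueness of the steady state -/

lemma mean_lt_one {A : Pair n → Measure ℕ} {ν : Pair n → ℝ} {ε : ℝ} (hν : ν ∈ saturatedRates n) (hε : ε ∈ Set.Ioo (0 : ℝ) 1)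
    (hm : ∀ k, ∫ m, (m : ℝ) ∂(A k) = (1 - ε) * ν k) (k : Pair n) : ∫ m, (m : ℝ) ∂(A k) < 1 := by
  rw [hm]
  nlinarith [rate_le_one hν k, hν.1 k, hε.1, hε.2]

lemma ae_slotLaw {T : Kernel (Counts n) (Counts n)} {A : Pair n → Measure ℕ}
    [∀ k, IsProbabilityMeasure (A k)] {aMax : ℕ} {π : Measure (Counts n)} [IsProbabilityMeasure π]
    [IsSFiniteKernel T] (hT : IsMaxWeight T) (hb : ∀ k, ∀ᵐ m ∂(A k), m ≤ aMax) :
    ∀ᵐ x ∂slotLaw T A π, x.1.2 ∈ schedules n ∧ ∀ k, x.2 k ≤ aMax := by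
  have h1 : ∀ᵐ y ∂(π ⊗ₘ T), y.2 ∈ schedules n :=
    Measure.ae_compProd_of_ae_ae MeasurableSet.of_discrete
      (.of_forall fun q => (hT q).mono fun s hs => hs.1)
  exact (Measure.quasiMeasurePreserving_fst.ae h1).and
    (Measure.quasiMeasurePreserving_snd.ae (ae_pi_le hb))

section SteadyState

variable {T : Kernel (Counts n) (Counts n)} [IsMarkovKernel T] {A : Pair n → Measure ℕ}
  [∀ k, IsProbabilityMeasure (A k)] {aMax : ℕ} {ν : Pair n → ℝ} {ε : ℝ}

/-- MaxWeight serves a nonempty system. -/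
lemma weight_pos_of_maxWeight {q s : Counts n} (hq : q ≠ 0)
    (hmax : ∀ s' ∈ schedules n, weight q s' ≤ weight q s) : 0 < weight q s := by
  obtain ⟨k, hk⟩ := Function.ne_iff.1 hq
  refine lt_of_lt_of_le ?_ (hmax _ (permSchedule_mem (Equiv.swap k.1 k.2)))
  refine lt_of_lt_of_le (Nat.pos_of_ne_zero hk) ?_
  refine le_trans (le_of_eq ?_) (Finset.single_le_sum (f := fun k => q k * permSchedule
    (Equiv.swap _ _) k) (fun _ _ => Nat.zero_le _) (Finset.mem_univ k))
  simp [permSchedule]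

/-- With positive probability no packet arrives, and a MaxWeight schedule serves some nonempty
queue. The total queue length is the rank that leads the chain to the empty system. -/
lemma exists_transition_decrease (hT : IsMaxWeight T) (hA : ∀ k, A k {0} ≠ 0) (q : Counts n)
    (hq : q ≠ 0) : ∃ y, transition T A q {y} ≠ 0 ∧ ∑ k, y k < ∑ k, q k := by
  obtain ⟨s, hs⟩ : ∃ s, T q {s} ≠ 0 := by
    by_contra! h
    have := tsum_measure_singleton (T q)
    simp [h] at this
  obtain ⟨hsched, hmax⟩ := ae_iff_of_countable.1 (hT q) s hs
  refine ⟨nextQueue ((q, s), 0), ?_, ?_⟩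
  · change (((T q).prod (Measure.pi A)).map fun p => nextQueue ((q, p.1), p.2)) _ ≠ 0
    rw [Measure.map_apply Measurable.of_discrete (measurableSet_singleton _)]
    have h1 : (T q).prod (Measure.pi A) {(s, 0)} ≠ 0 := by
      rw [← Set.singleton_prod_singleton, Measure.prod_prod]
      refine mul_ne_zero hs ?_
      rw [Measure.pi_singleton]
      exact Finset.prod_ne_zero_iff.2 fun k _ => hA k
    refine fun h0 => h1 (measure_mono_null ?_ h0)
    rintro _ rfl
    rfl
  · have hw := weight_pos_of_maxWeight hq hmax
    obtain ⟨k, -, hk⟩ := Finset.exists_ne_zero_of_sum_ne_zero hw.ne'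
    refine Finset.sum_lt_sum (fun k _ => by simp [nextQueue]) ⟨k, Finset.mem_univ k, ?_⟩
    have h1 : q k ≠ 0 := left_ne_zero_of_mul hk
    have h2 : s k ≠ 0 := right_ne_zero_of_mul hk
    simp only [nextQueue, Pi.zero_apply]
    omega

lemma finite_sum_le (R : ℕ) : {q : Counts n | ∑ k, q k ≤ R}.Finite := by
  refine (Set.Finite.pi' fun _ : Pair n => Set.finite_Iic R).subset fun q hq k => ?_
  exact (Finset.single_le_sum (fun _ _ => Nat.zero_le _) (Finset.mem_univ k)).trans hq

lemma existsUnique_isSteadyState (hT : IsMaxWeight T) (hb : ∀ k, ∀ᵐ m ∂(A k), m ≤ aMax)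
    (hν : ν ∈ saturatedRates n) (hν_pos : ∀ k, 0 < ν k) (hε : ε ∈ Set.Ioo (0 : ℝ) 1)
    (hm : ∀ k, ∫ m, (m : ℝ) ∂(A k) = (1 - ε) * ν k) : ∃! π, IsSteadyState T A π := by
  obtain ⟨δ, hδ, hνδ⟩ := exists_rate_lower_bound hν_pos
  have hc : 0 < 2 * ε * δ := mul_pos (mul_pos two_pos hε.1) hδ
  obtain ⟨π, hπ, hinv⟩ := exists_bind_eq_of_drift (P := transition T A)
    (V := fun q => ENNReal.ofReal (∑ k, (q k : ℝ) ^ 2))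
    (f := fun q => ENNReal.ofReal (2 * ε * δ * ∑ k, (q k : ℝ)))
    (b := ENNReal.ofReal (n ^ 2 * ((aMax : ℝ) + 1) ^ 2)) ENNReal.ofReal_ne_top (x₀ := 0)
    ENNReal.ofReal_ne_top (fun R => by
      refine (finite_sum_le ⌈(R : ℝ) / (2 * ε * δ)⌉₊).subset fun q hq => ?_
      have h1 : ENNReal.ofReal (2 * ε * δ * ∑ k, (q k : ℝ)) ≤ R := hq
      rw [← ENNReal.ofReal_natCast, ENNReal.ofReal_le_ofReal_iff (Nat.cast_nonneg R)] at h1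
      have h2 : ∑ k, (q k : ℝ) ≤ (R : ℝ) / (2 * ε * δ) := by
        rw [le_div_iff₀ hc]; linarith
      have h3 := h2.trans (Nat.le_ceil _)
      change ∑ k, q k ≤ _
      exact_mod_cast h3)
    (fun q => lintegral_transition_le hT q fun s hs hmax =>
      quadratic_drift hb hν hε.1.le hm hδ.le hνδ hs hmax)
  refine ⟨π, (isSteadyState_iff T A).2 ⟨hπ, hinv⟩, fun π' hπ' => ?_⟩
  obtain ⟨h1, h2⟩ := (isSteadyState_iff T A).1 hπ'
  exact eq_of_bind_eq h2 hinv (x₀ := 0) (r := fun q => ∑ k, q k)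
    fun q hq => exists_transition_decrease hT
      (fun k => measure_singleton_zero_ne_zero (hb k) (mean_lt_one hν hε hm k)) q hq

/-! ### Moments in steady state -/

variable {π : Measure (Counts n)}

/-- The mean total queue length is `O(1 / ε)`. -/
lemma IsSteadyState.lintegral_sum_le (hπ : IsSteadyState T A π) (hT : IsMaxWeight T)
    (hb : ∀ k, ∀ᵐ m ∂(A k), m ≤ aMax) (hν : ν ∈ saturatedRates n) (hε : 0 < ε)
    (hm : ∀ k, ∫ m, (m : ℝ) ∂(A k) = (1 - ε) * ν k) {δ : ℝ} (hδ : 0 < δ) (hνδ : ∀ k, δ ≤ ν k) :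
    ∫⁻ q, ENNReal.ofReal (ε * ∑ k, (q k : ℝ)) ∂π ≤
      ENNReal.ofReal (n ^ 2 * ((aMax : ℝ) + 1) ^ 2 / (2 * δ)) := by
  have := hπ.isProbabilityMeasure
  have h := hπ.lintegral_le_of_drift hT (V := fun q => ENNReal.ofReal (∑ k, (q k : ℝ) ^ 2))
    (f := fun q => ENNReal.ofReal (2 * ε * δ * ∑ k, (q k : ℝ)))
    (g := fun _ => ENNReal.ofReal (n ^ 2 * ((aMax : ℝ) + 1) ^ 2))
    (fun q => ENNReal.ofReal_ne_top) fun q s hs hmax =>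
      quadratic_drift hb hν hε.le hm hδ.le hνδ hs hmax
  simp only [lintegral_const, measure_univ, mul_one] at h
  have e : ∀ q : Counts n, ENNReal.ofReal (ε * ∑ k, (q k : ℝ)) =
      ENNReal.ofReal (2 * δ)⁻¹ * ENNReal.ofReal (2 * ε * δ * ∑ k, (q k : ℝ)) := by
    intro q
    rw [← ENNReal.ofReal_mul (by positivity)]
    congr 1
    field_simp
  simp only [e]
  rw [lintegral_const_mul _ Measurable.of_discrete, div_eq_inv_mul,
    ENNReal.ofReal_mul (by positivity)]
  gcongr

lemma lintegral_slotLaw_fst [IsProbabilityMeasure π] (f : Counts n → ℝ≥0∞) :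
    ∫⁻ x, f x.1.1 ∂slotLaw T A π = ∫⁻ q, f q ∂π := by
  rw [lintegral_slotLaw]
  simp

/-- The unused service while the total queue length is at least `R`. -/
lemma IsSteadyState.lintegral_unused_le (hπ : IsSteadyState T A π) (hT : IsMaxWeight T)
    (hb : ∀ k, ∀ᵐ m ∂(A k), m ≤ aMax) (hν : ν ∈ saturatedRates n) (hε : ε ∈ Set.Ioo (0 : ℝ) 1)
    (hm : ∀ k, ∫ m, (m : ℝ) ∂(A k) = (1 - ε) * ν k)
    (hfin : ∫⁻ q, ENNReal.ofReal (ε * ∑ k, (q k : ℝ)) ∂π ≠ ∞) (R : ℕ) :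
    ∫⁻ x, (if R ≤ ∑ k, x.1.1 k then ((∑ k, unused x k : ℕ) : ℝ≥0∞) else 0) ∂slotLaw T A π ≤
      ENNReal.ofReal (n * ε) * π {q | R ≤ ∑ k, q k} := by
  have hprob := hπ.isProbabilityMeasure
  -- Stationarity is applied to the positive part of the excess of the total over `R - 1`. When the
  -- total is at least `R`, its increase is at least arrivals plus unused service minus `n`, and the
  -- arrivals average `n (1 - ε)` independently of the queues; so the unused service averages at
  -- most `nε` there. The first moment makes `h` integrable, which allows the cancellation.
  set h : Counts n → ℝ≥0∞ := fun q => ((∑ k, q k + 1 - R : ℕ) : ℝ≥0∞) with hh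
  have hhfin : ∫⁻ q, h q ∂π ≠ ∞ := by
    have hle : ∀ q, h q ≤ ENNReal.ofReal ε⁻¹ * ENNReal.ofReal (ε * ∑ k, (q k : ℝ)) + 1 := by
      intro q
      rw [← ENNReal.ofReal_mul (inv_nonneg.2 hε.1.le), inv_mul_cancel_left₀ hε.1.ne',
        ← Nat.cast_sum, ENNReal.ofReal_natCast]
      have : ∑ k, q k + 1 - R ≤ ∑ k, q k + 1 := Nat.sub_le _ _
      simp only [hh]
      exact_mod_cast this
    refine ne_top_of_le_ne_top ?_ (lintegral_mono hle)
    rw [lintegral_add_right _ measurable_const, lintegral_const_mul _ Measurable.of_discrete]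
    simpa using ENNReal.mul_ne_top ENNReal.ofReal_ne_top hfin
  set I : Counts n → ℝ≥0∞ := fun q => if R ≤ ∑ k, q k then 1 else 0 with hI
  have hIint : ∫⁻ q, I q ∂π = π {q | R ≤ ∑ k, q k} := by
    rw [← lintegral_indicator_one MeasurableSet.of_discrete]
    refine lintegral_congr fun q => ?_
    simp [hI, Set.indicator]
  have hpt : ∀ᵐ x ∂slotLaw T A π, h x.1.1 + (I x.1.1 * ∑ k, (x.2 k : ℝ≥0∞) +
      (if R ≤ ∑ k, x.1.1 k then ((∑ k, unused x k : ℕ) : ℝ≥0∞) else 0)) ≤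
      h (nextQueue x) + n * I x.1.1 := by
    filter_upwards [ae_slotLaw hT hb] with x hx
    obtain ⟨⟨q, s⟩, a⟩ := x
    have hsum := sum_nextQueue (q := q) (s := s) (a := a) hx.1
    by_cases hR : R ≤ ∑ k, q k
    · simp only [hh, hI, hR, if_true, one_mul, mul_one]
      have : ∑ k, q k + 1 - R + (∑ k, a k + ∑ k, unused ((q, s), a) k) ≤
          ∑ k, nextQueue ((q, s), a) k + 1 - R + n := by omega
      exact_mod_cast this
    · have : ∑ k, q k + 1 - R = 0 := by omega
      simp only [hh, hI, hR, this, if_false, zero_mul, Nat.cast_zero, add_zero]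
      exact zero_le
  have hnext : ∫⁻ x, h (nextQueue x) ∂slotLaw T A π = ∫⁻ q, h q ∂π := by
    conv_rhs => rw [← hπ.map_nextQueue]
    rw [lintegral_map Measurable.of_discrete Measurable.of_discrete]
  have harr : ∫⁻ a, ∑ k, ((a k : ℕ) : ℝ≥0∞) ∂Measure.pi A = ENNReal.ofReal (n * (1 - ε)) := by
    have e : ∀ a : Counts n, ∑ k, ((a k : ℕ) : ℝ≥0∞) = ENNReal.ofReal (∑ k, (a k : ℝ)) := by
      intro a
      rw [← Nat.cast_sum, ← Nat.cast_sum, ENNReal.ofReal_natCast]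
    simp only [e]
    rw [← ofReal_integral_eq_lintegral_ofReal (integrable_finsetSum _ fun k _ =>
      integrable_eval hb k) (.of_forall fun a => Finset.sum_nonneg fun k _ => Nat.cast_nonneg _),
      integral_finsetSum _ fun k _ => integrable_eval hb k]
    simp only [integral_eval, hm]
    rw [← Finset.mul_sum, Fintype.sum_prod_type]
    simp [hν.2.2, mul_comm]
  have hprod : ∫⁻ x, I x.1.1 * ∑ k, (x.2 k : ℝ≥0∞) ∂slotLaw T A π =
      ENNReal.ofReal (n * (1 - ε)) * π {q | R ≤ ∑ k, q k} := by
    rw [lintegral_slotLaw]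
    simp only [lintegral_const_mul _ (Measurable.of_discrete (f := fun a : Counts n =>
      ∑ k, (a k : ℝ≥0∞))), harr, lintegral_const, measure_univ, mul_one]
    rw [lintegral_mul_const _ Measurable.of_discrete, hIint, mul_comm]
  have hinteg := lintegral_mono_ae hpt
  rw [lintegral_add_left Measurable.of_discrete, lintegral_add_left Measurable.of_discrete,
    lintegral_add_left Measurable.of_discrete, hnext, lintegral_slotLaw_fst, hprod,
    lintegral_const_mul _ Measurable.of_discrete, lintegral_slotLaw_fst, hIint] at hinteg
  have h2 := (ENNReal.add_le_add_iff_left hhfin).1 hinteg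
  have hn : (n : ℝ≥0∞) = ENNReal.ofReal (n * (1 - ε)) + ENNReal.ofReal (n * ε) := by
    rw [← ENNReal.ofReal_add (mul_nonneg (Nat.cast_nonneg n) (by linarith [hε.2]))
      (mul_nonneg (Nat.cast_nonneg n) hε.1.le), ← ENNReal.ofReal_natCast]
    congr 1
    ring
  rw [show (n : ℝ≥0∞) * π {q | R ≤ ∑ k, q k} = _ from congrArg (· * _) hn] at h2
  simp only [add_mul] at h2
  exact (ENNReal.add_le_add_iff_left
    (ENNReal.mul_ne_top ENNReal.ofReal_ne_top (measure_ne_top _ _))).1 h2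

end SteadyState

/-! ### State space collapse -/

/-- The queue lengths as a real vector. -/
def realQueue (q : Counts n) : Pair n → ℝ := fun k => (q k : ℝ)

lemma abs_le_of_sum_sq_eq {z : Pair n → ℝ} {d : ℝ} (hd : 0 ≤ d) (h : ∑ k, z k ^ 2 = d ^ 2)
    (k : Pair n) : |z k| ≤ d := by
  refine abs_le_of_sq_le_sq ?_ hd
  rw [← h]
  exact Finset.single_le_sum (f := fun k => z k ^ 2) (fun _ _ => sq_nonneg _) (Finset.mem_univ k)

lemma abs_sum_mul_le {z x : Pair n → ℝ} {d c : ℝ} (hz : ∀ k, |z k| ≤ d) (hx : ∀ k, |x k| ≤ c)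
    (hd : 0 ≤ d) : |∑ k, z k * x k| ≤ n ^ 2 * (d * c) := by
  rw [← sum_pair_const]
  refine (Finset.abs_sum_le_sum_abs _ _).trans (Finset.sum_le_sum fun k _ => ?_)
  rw [abs_mul]
  exact mul_le_mul (hz k) (hx k) (abs_nonneg _) hd

/-- One step of the squared distance to the cone. -/
lemma coneDist_nextQueue_sq_le {aMax : ℕ} {q s a : Counts n} (hs : s ∈ schedules n)
    (ha : ∀ k, a k ≤ aMax) {p : Pair n → ℝ} (hp : p ∈ collapseCone n) (hp0 : ∀ k, 0 ≤ p k) :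
    coneDist (realQueue (nextQueue ((q, s), a))) ^ 2 ≤ ∑ k, ((q k : ℝ) - p k) ^ 2 +
      2 * ∑ k, ((q k : ℝ) - p k) * ((a k : ℝ) - s k) + n ^ 2 * ((aMax : ℝ) + 1) ^ 2 := by
  refine (coneDist_sq_le _ hp).trans ?_
  rw [Finset.mul_sum, ← sum_pair_const, ← Finset.sum_add_distrib, ← Finset.sum_add_distrib]
  refine Finset.sum_le_sum fun k _ => ?_
  have h1 := abs_le.1 (abs_nextQueue_sub_le (q := q) hs ha k)
  have h2 := nextQueue_cast ((q, s), a) k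
  -- Unused service occurs only where `q k = 0`, and there `q k - p k ≤ 0` because the projection
  -- has nonnegative entries.
  have h3 : ((q k : ℝ) - p k) * unused ((q, s), a) k ≤ 0 := by
    by_cases h0 : unused ((q, s), a) k = 0
    · simp [h0]
    · rw [queue_eq_zero_of_unused hs h0]
      have := mul_nonneg (hp0 k) (Nat.cast_nonneg (α := ℝ) (unused ((q, s), a) k))
      simp only [Nat.cast_zero, zero_sub]
      linarith
  have h4 : ((nextQueue ((q, s), a) k : ℝ) - q k) ^ 2 ≤ ((aMax : ℝ) + 1) ^ 2 :=
    sq_le_sq' h1.1 h1.2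
  simp only [realQueue]
  simp only at h2
  have e : ((nextQueue ((q, s), a) k : ℝ) - p k) ^ 2 = ((q k : ℝ) - p k) ^ 2 +
      2 * (((q k : ℝ) - p k) * ((nextQueue ((q, s), a) k : ℝ) - q k)) +
      ((nextQueue ((q, s), a) k : ℝ) - q k) ^ 2 := by ring
  have e2 : ((q k : ℝ) - p k) * ((nextQueue ((q, s), a) k : ℝ) - q k) =
      ((q k : ℝ) - p k) * ((a k : ℝ) - s k) + ((q k : ℝ) - p k) * unused ((q, s), a) k := by
    rw [h2]; ring
  rw [e, e2]
  linarith

/-- A smooth version of the distance to the cone. -/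
noncomputable def smoothDist (q : Counts n) : ℝ := Real.sqrt (1 + coneDist (realQueue q) ^ 2)

lemma one_le_smoothDist (q : Counts n) : 1 ≤ smoothDist q := by
  rw [smoothDist, Real.one_le_sqrt]
  linarith [sq_nonneg (coneDist (realQueue q))]

lemma smoothDist_sq (q : Counts n) : smoothDist q ^ 2 = 1 + coneDist (realQueue q) ^ 2 :=
  Real.sq_sqrt (by positivity)

lemma coneDist_le_smoothDist (q : Counts n) : coneDist (realQueue q) ≤ smoothDist q :=
  Real.le_sqrt_of_sq_le (by linarith)

lemma smoothDist_le (q : Counts n) : smoothDist q ≤ 1 + coneDist (realQueue q) := by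
  have := coneDist_nonneg (realQueue q)
  rw [smoothDist, Real.sqrt_le_left (by linarith)]
  nlinarith

/-- The drift of `e ^ (η Y)`, where `Y` is the smooth distance to the cone. -/
lemma exponential_drift (hn : 0 < n) {A : Pair n → Measure ℕ} [∀ k, IsProbabilityMeasure (A k)]
    {aMax : ℕ} (hb : ∀ k, ∀ᵐ m ∂(A k), m ≤ aMax) {ν : Pair n → ℝ} (hν : ν ∈ saturatedRates n)
    {ε : ℝ} (hε : 0 ≤ ε) (hm : ∀ k, ∫ m, (m : ℝ) ∂(A k) = (1 - ε) * ν k) {κ : ℝ} (hκ : 0 < κ)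
    (hνκ : ∀ k, 2 * κ ≤ ν k) (hεκ : ε * n ^ 2 ≤ κ) {η C G : ℝ} (hη : 0 < η)
    (hC : C = n ^ 2 * ((aMax : ℝ) + 1) + n ^ 2 * ((aMax : ℝ) + 1) ^ 2 / 2)
    (hG : G = κ + n ^ 2 * ((aMax : ℝ) + 1) ^ 2 / 2) (hηC : η * C ≤ 1) (hηκ : η * C ^ 2 ≤ κ / 4)
    {q s : Counts n} (hs : s ∈ schedules n)
    (hmax : ∀ s' ∈ schedules n, weight q s' ≤ weight q s) :
    ENNReal.ofReal (η * κ / 2 * Real.exp (η * smoothDist q)) +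
      ∫⁻ a, ENNReal.ofReal (Real.exp (η * smoothDist (nextQueue ((q, s), a)))) ∂Measure.pi A ≤
    ENNReal.ofReal (Real.exp (η * smoothDist q)) +
      ENNReal.ofReal (η * G * Real.exp (η * (4 * G / κ))) := by
  obtain ⟨p, hp, hd, horth, hpol⟩ := exists_coneProj hn (realQueue q)
  have hp0 := ((mem_collapseCone_iff hn).1 hp).2
  set X := coneDist (realQueue q) with hX
  have hX0 : 0 ≤ X := coneDist_nonneg _
  set Y := smoothDist q with hY
  have hY1 : 1 ≤ Y := one_le_smoothDist q
  have hY0 : 0 < Y := by linarith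
  have hXY : X ≤ Y := coneDist_le_smoothDist q
  have hYX : Y ≤ 1 + X := smoothDist_le q
  set D : ℝ := n ^ 2 * ((aMax : ℝ) + 1) ^ 2 with hD
  have hD0 : 0 ≤ D := by positivity
  have hG0 : 0 < G := by rw [hG]; positivity
  set z : Pair n → ℝ := fun k => (q k : ℝ) - p k with hz
  have hzX : ∀ k, |z k| ≤ X := abs_le_of_sum_sq_eq hX0 hd
  -- The projection lies in `𝓢`, where all doubly stochastic vectors have the same pairing. Only the
  -- deviation `z` therefore enters the drift.
  have hp_sched : ∑ k, p k * ν k = ∑ k, p k * s k := by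
    obtain ⟨w, hw⟩ := mem_collapseSpace_iff.1 ((mem_collapseCone_iff hn).1 hp).1
    simp only [hw]
    rw [sum_add_mul_of_sum_eq_one (fun i => w (Sum.inl i)) (fun j => w (Sum.inr j)) ν hν.2.1
      hν.2.2, sum_add_mul_of_sum_eq_one (fun i => w (Sum.inl i)) (fun j => w (Sum.inr j))
      (fun k => (s k : ℝ)) (fun j => by exact_mod_cast hs.2.1 j)
      (fun i => by exact_mod_cast hs.2.2 i)]
  have hdrift : ∑ k, z k * ν k - ∑ k, z k * s k ≤ -(2 * κ * X) := by
    have h1 := sum_mul_rate_sub_schedule_le (q := realQueue q) (z := z) (fun k => Nat.cast_nonneg _)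
      hν (by positivity : (0 : ℝ) ≤ 2 * κ) hνκ (s := s)
      (fun s' hs' => sum_mul_schedule_le (hmax s' hs')) hpol hX0 hzX (by
        rw [← hd, ← add_zero (∑ k, (realQueue q k - p k) ^ 2), ← horth, ← Finset.sum_add_distrib]
        exact Finset.sum_congr rfl fun k _ => by simp only [hz, realQueue]; ring)
    have h2 : ∑ k, realQueue q k * (ν k - s k) =
        ∑ k, z k * ν k - ∑ k, z k * s k + (∑ k, p k * ν k - ∑ k, p k * s k) := by
      rw [← Finset.sum_sub_distrib, ← Finset.sum_sub_distrib, ← Finset.sum_add_distrib]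
      exact Finset.sum_congr rfl fun k _ => by simp only [hz, realQueue]; ring
    rw [h2, hp_sched] at h1
    linarith
  have hzν : |∑ k, z k * ν k| ≤ n ^ 2 * (X * 1) :=
    abs_sum_mul_le hzX (fun k => by rw [abs_of_nonneg (hν.1 k)]; exact rate_le_one hν k) hX0
  rw [← ENNReal.ofReal_add (by positivity) (by positivity)]
  refine add_lintegral_ofReal_le_of_affine hb
    (G := fun a => Real.exp (η * smoothDist (nextQueue ((q, s), a))))
    (fun a => (Real.exp_pos _).le)
    -- This constant and the coefficients after it are `e^{ηY} (1 + η t + η κ/4)` written as an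
    -- affine function of the arrivals, where `t` is the bound for the increment of `Y` used below.
    (Real.exp (η * Y) * (1 + η * ((D / 2 - ∑ k, z k * s k) / Y) + η * (κ / 4)))
    (fun k => Real.exp (η * Y) * (η * (z k / Y))) ?_ (by positivity) ?_
  · intro a ha
    set t : ℝ := (∑ k, z k * ((a k : ℝ) - s k) + D / 2) / Y with ht
    have hY' : smoothDist (nextQueue ((q, s), a)) ≤ Y + t := by
      have h1 := coneDist_nextQueue_sq_le (q := q) hs ha hp hp0
      have h2 := smoothDist_sq (nextQueue ((q, s), a))
      have h3 : Y ^ 2 = 1 + X ^ 2 := smoothDist_sq q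
      have h4 : ∑ k, ((q k : ℝ) - p k) ^ 2 = X ^ 2 := hd
      rw [h4] at h1
      have h5 : Y * (Y + t) = Y ^ 2 + (∑ k, z k * ((a k : ℝ) - s k) + D / 2) := by
        rw [ht]; field_simp
      have h6 := sq_nonneg (smoothDist (nextQueue ((q, s), a)) - Y)
      -- The new squared distance gives `Y'² ≤ Y² + 2Yt`, and `2YY' ≤ Y² + Y'²` linearises it.
      -- Division by `Y` is safe since `Y ≥ 1`.
      have h7 : Y * smoothDist (nextQueue ((q, s), a)) ≤ Y * (Y + t) := by
        rw [h5]
        simp only [hz]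
        nlinarith
      exact le_of_mul_le_mul_left h7 hY0
    have htC : |t| ≤ C := by
      have h1 : |∑ k, z k * ((a k : ℝ) - s k)| ≤ n ^ 2 * (X * ((aMax : ℝ) + 1)) :=
        abs_sum_mul_le hzX (abs_arrival_sub_schedule_le hs ha) hX0
      rw [ht, abs_div, abs_of_pos hY0, div_le_iff₀ hY0]
      refine (abs_add_le _ _).trans ?_
      rw [abs_of_nonneg (by positivity : 0 ≤ D / 2), hC, add_mul]
      have h2 : (n : ℝ) ^ 2 * (X * ((aMax : ℝ) + 1)) ≤ n ^ 2 * ((aMax : ℝ) + 1) * Y := by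
        have : (0 : ℝ) ≤ n ^ 2 * ((aMax : ℝ) + 1) := by positivity
        nlinarith [mul_le_mul_of_nonneg_left hXY this]
      have h3 : D / 2 ≤ D / 2 * Y := le_mul_of_one_le_right (by positivity) hY1
      linarith
    -- For `|x| ≤ 1` one has `e^x ≤ 1 + x + x²`, and `η` is so small that the quadratic term costs
    -- at most a quarter of the drift `κ`.
    have hexp : Real.exp (η * t) ≤ 1 + η * t + η * (κ / 4) := by
      have h1 : |η * t| ≤ 1 := by
        rw [abs_mul, abs_of_pos hη]
        exact (mul_le_mul_of_nonneg_left htC hη.le).trans hηC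
      have h2 := (abs_le.1 (Real.abs_exp_sub_one_sub_id_le h1)).2
      have h3 : t ^ 2 ≤ C ^ 2 := sq_le_sq' (abs_le.1 htC).1 (abs_le.1 htC).2
      have h4 : (η * t) ^ 2 ≤ η * (κ / 4) := by
        calc (η * t) ^ 2 = η * (η * t ^ 2) := by ring
          _ ≤ η * (η * C ^ 2) := by gcongr
          _ ≤ η * (κ / 4) := by gcongr
      linarith
    calc Real.exp (η * smoothDist (nextQueue ((q, s), a)))
        ≤ Real.exp (η * (Y + t)) := Real.exp_le_exp.2 (by gcongr)
      _ = Real.exp (η * Y) * Real.exp (η * t) := by rw [mul_add, Real.exp_add]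
      _ ≤ Real.exp (η * Y) * (1 + η * t + η * (κ / 4)) := by gcongr
      _ = _ := by
        have e1 : ∑ k, Real.exp (η * Y) * (η * (z k / Y)) * (a k : ℝ) =
            Real.exp (η * Y) * η / Y * ∑ k, z k * (a k : ℝ) := by
          rw [Finset.mul_sum]
          exact Finset.sum_congr rfl fun k _ => by ring
        have e2 : ∑ k, z k * ((a k : ℝ) - s k) = ∑ k, z k * (a k : ℝ) - ∑ k, z k * s k := by
          rw [← Finset.sum_sub_distrib]
          exact Finset.sum_congr rfl fun k _ => by ring
        rw [e1, ht, e2]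
        ring
  · have e1 : ∑ k, Real.exp (η * Y) * (η * (z k / Y)) * ∫ m, (m : ℝ) ∂(A k) =
        Real.exp (η * Y) * η / Y * ((1 - ε) * ∑ k, z k * ν k) := by
      rw [Finset.mul_sum, Finset.mul_sum]
      exact Finset.sum_congr rfl fun k _ => by rw [hm]; ring
    -- The available drift is `2κX`; half of it absorbs the loss `ε ⟨z, ν⟩`, which is at most `ε n²
    -- X ≤ κX`.
    have h1 : (1 - ε) * ∑ k, z k * ν k - ∑ k, z k * s k ≤ -(κ * X) := by
      have h2 : -(ε * ∑ k, z k * ν k) ≤ κ * X := by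
        have h3 : -∑ k, z k * ν k ≤ n ^ 2 * X := by
          have := (abs_le.1 hzν).1
          linarith
        calc -(ε * ∑ k, z k * ν k) = ε * -∑ k, z k * ν k := by ring
          _ ≤ ε * (n ^ 2 * X) := by gcongr
          _ = ε * n ^ 2 * X := by ring
          _ ≤ κ * X := by gcongr
      linarith
    have h2 : ((1 - ε) * ∑ k, z k * ν k - ∑ k, z k * s k + D / 2) / Y ≤ -κ + G / Y := by
      rw [div_le_iff₀ hY0, add_mul, div_mul_cancel₀ _ hY0.ne']
      have : κ * Y ≤ κ * (1 + X) := by gcongr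
      rw [hG]
      linarith
    -- The remainder `G / Y` is at most `κ/4` once `Y ≥ 4G/κ`, and below that level the exponential
    -- is bounded by a constant. After the two losses of `κ/4` a drift of `κ/2` remains.
    have h3 : Real.exp (η * Y) * (G / Y) ≤
        Real.exp (η * Y) * (κ / 4) + G * Real.exp (η * (4 * G / κ)) := by
      rcases le_total (4 * G / κ) Y with h | h
      · have : G / Y ≤ κ / 4 := by
          rw [div_le_iff₀ hκ] at h
          rw [div_le_iff₀ hY0]
          linarith
        have h5 : Real.exp (η * Y) * (G / Y) ≤ Real.exp (η * Y) * (κ / 4) := by gcongr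
        have : 0 ≤ G * Real.exp (η * (4 * G / κ)) := by positivity
        linarith
      · have h5 : G / Y ≤ G := div_le_self hG0.le hY1
        have h6 : Real.exp (η * Y) * (G / Y) ≤ Real.exp (η * (4 * G / κ)) * G := by gcongr
        have : 0 ≤ Real.exp (η * Y) * (κ / 4) := by positivity
        linarith
    rw [e1]
    have e2 : Real.exp (η * Y) * (1 + η * ((D / 2 - ∑ k, z k * s k) / Y) + η * (κ / 4)) +
        Real.exp (η * Y) * η / Y * ((1 - ε) * ∑ k, z k * ν k) =
        Real.exp (η * Y) * (1 + η * (κ / 4)) + η * (Real.exp (η * Y) *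
          (((1 - ε) * ∑ k, z k * ν k - ∑ k, z k * s k + D / 2) / Y)) := by
      ring
    rw [e2]
    have h4 : Real.exp (η * Y) * (((1 - ε) * ∑ k, z k * ν k - ∑ k, z k * s k + D / 2) / Y) ≤
        Real.exp (η * Y) * (-κ + G / Y) := by gcongr
    have h5 : η * (Real.exp (η * Y) *
        (((1 - ε) * ∑ k, z k * ν k - ∑ k, z k * s k + D / 2) / Y)) ≤
        η * (-(Real.exp (η * Y) * κ) + (Real.exp (η * Y) * (κ / 4) +
          G * Real.exp (η * (4 * G / κ)))) := by
      gcongr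
      linarith
    nlinarith

/-- State space collapse: the distance of the queue lengths to the cone has exponential moments
that are bounded in heavy traffic. -/
lemma exists_lintegral_exp_coneDist_le (hn : 0 < n) {ν : Pair n → ℝ} (hν : ν ∈ saturatedRates n)
    (hν_pos : ∀ k, 0 < ν k) (aMax : ℕ) :
    ∃ η > 0, ∃ C : ℝ, ∃ ε₀ > 0, ∀ (T : Kernel (Counts n) (Counts n)) [IsMarkovKernel T]
      (A : Pair n → Measure ℕ) [∀ k, IsProbabilityMeasure (A k)] (π : Measure (Counts n)) (ε : ℝ),
      IsMaxWeight T → (∀ k, ∀ᵐ m ∂(A k), m ≤ aMax) → 0 ≤ ε → ε ≤ ε₀ →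
      (∀ k, ∫ m, (m : ℝ) ∂(A k) = (1 - ε) * ν k) → IsSteadyState T A π →
      ∫⁻ q, ENNReal.ofReal (Real.exp (η * coneDist (realQueue q))) ∂π ≤ ENNReal.ofReal C := by
  obtain ⟨δ, hδ, hνδ⟩ := exists_rate_lower_bound hν_pos
  set κ := δ / 2 with hκ
  have hκ0 : 0 < κ := by positivity
  set C : ℝ := n ^ 2 * ((aMax : ℝ) + 1) + n ^ 2 * ((aMax : ℝ) + 1) ^ 2 / 2 with hC
  have hC0 : 0 < C := by positivity
  set G : ℝ := κ + n ^ 2 * ((aMax : ℝ) + 1) ^ 2 / 2 with hG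
  -- The two terms secure `η C ≤ 1` and `η C² ≤ κ/4`. Neither depends on `ε`, which is what makes
  -- the resulting moment bound uniform.
  set η : ℝ := min (1 / C) (κ / 4 / C ^ 2) with hη
  have hη0 : 0 < η := by positivity
  refine ⟨η, hη0, 2 / (η * κ) * (η * G * Real.exp (η * (4 * G / κ))), κ / n ^ 2, by positivity, ?_⟩
  intro T _ A _ π ε hT hb hε hεκ hm hπ
  have := hπ.isProbabilityMeasure
  have h := hπ.lintegral_le_of_drift hT
    (V := fun q => ENNReal.ofReal (Real.exp (η * smoothDist q)))
    (f := fun q => ENNReal.ofReal (η * κ / 2 * Real.exp (η * smoothDist q)))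
    (g := fun _ => ENNReal.ofReal (η * G * Real.exp (η * (4 * G / κ))))
    (fun q => ENNReal.ofReal_ne_top) fun q s hs hmax =>
      exponential_drift hn hb hν hε hm hκ0 (fun k => by rw [hκ]; linarith [hνδ k])
        (by rwa [← le_div_iff₀ (by positivity)]) hη0 hC hG
        (by rw [← le_div_iff₀ hC0]; exact min_le_left _ _)
        (by rw [← le_div_iff₀ (by positivity)]; exact min_le_right _ _) hs hmax
  simp only [lintegral_const, measure_univ, mul_one] at h
  rw [ENNReal.ofReal_mul (by positivity)]
  refine le_trans ?_ (mul_le_mul_right h _)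
  rw [← lintegral_const_mul _ Measurable.of_discrete]
  refine lintegral_mono fun q => ?_
  rw [← ENNReal.ofReal_mul (by positivity)]
  refine ENNReal.ofReal_le_ofReal ?_
  rw [← mul_assoc, show 2 / (η * κ) * (η * κ / 2) = 1 by field_simp, one_mul]
  exact Real.exp_le_exp.2 (mul_le_mul_of_nonneg_left (coneDist_le_smoothDist q) hη0.le)

/-! ### Exponentials on the transform domain -/

lemma exists_complex_potential {θ : Pair n → ℂ} (hθ : θ ∈ transformDomain n) :
    ∃ w : Port n → ℂ, ∀ k, θ k = w (Sum.inl k.1) + w (Sum.inr k.2) := by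
  obtain ⟨w₁, h₁⟩ := mem_collapseSpace_iff.1 hθ.1
  obtain ⟨w₂, h₂⟩ := mem_collapseSpace_iff.1 hθ.2.1
  refine ⟨fun l => (w₁ l : ℂ) + w₂ l * Complex.I, fun k => ?_⟩
  rw [← Complex.re_add_im (θ k), h₁, h₂]
  push_cast
  ring

/-- On `𝓢`, the pairing with a doubly stochastic vector is the sum of the entries over `n`. -/
lemma sum_mul_eq_of_sum_eq_one (hn : 0 < n) {θ : Pair n → ℂ} (hθ : θ ∈ transformDomain n)
    {x : Pair n → ℂ} (hc : ∀ j, ∑ i, x (i, j) = 1) (hr : ∀ i, ∑ j, x (i, j) = 1) :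
    ∑ k, θ k * x k = 1 / (n : ℂ) * ∑ k, θ k := by
  obtain ⟨w, hw⟩ := exists_complex_potential hθ
  have hn' : (n : ℂ) ≠ 0 := Nat.cast_ne_zero.2 hn.ne'
  have h1 := sum_add_mul_of_sum_eq_one (fun i => w (Sum.inl i)) (fun j => w (Sum.inr j)) x hc hr
  have h2 := sum_add_mul_of_sum_eq_one (fun i => w (Sum.inl i)) (fun j => w (Sum.inr j))
    (fun _ => 1 / (n : ℂ)) (fun j => by simp [hn']) (fun i => by simp [hn'])
  simp only [← hw] at h1 h2
  rw [h1, ← h2, ← Finset.sum_mul, mul_comm]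

lemma pairing_re (θ : Pair n → ℂ) (y : Pair n → ℝ) : (pairing θ y).re = ∑ k, (θ k).re * y k := by
  simp [pairing, Complex.re_sum]

lemma re_pairing_nonpos {θ : Pair n → ℂ} (hθ : θ ∈ transformDomain n) {y : Pair n → ℝ}
    (hy : y ∈ collapseCone n) : (pairing θ y).re ≤ 0 := by
  obtain ⟨r, hr, rfl⟩ := hy
  rw [pairing_re, sum_incidence_mul]
  exact Finset.sum_nonpos fun l _ => mul_nonpos_of_nonpos_of_nonneg (hθ.2.2 l) (hr l)

/-- The projection of `y` to the cone contributes a nonpositive real part, so only the deviation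
from the cone can make it positive. This turns collapse into a bound on the transforms. -/
lemma re_pairing_le (hn : 0 < n) {θ : Pair n → ℂ} (hθ : θ ∈ transformDomain n) (y : Pair n → ℝ) :
    (pairing θ y).re ≤ (∑ k, ‖θ k‖) * coneDist y := by
  obtain ⟨p, hp, hd, -, -⟩ := exists_coneProj hn y
  have h1 : (pairing θ y).re = ∑ k, (θ k).re * (y k - p k) + (pairing θ p).re := by
    rw [pairing_re, pairing_re, ← Finset.sum_add_distrib]
    exact Finset.sum_congr rfl fun k _ => by ring
  rw [h1, Finset.sum_mul]
  have h2 : ∑ k, (θ k).re * (y k - p k) ≤ ∑ k, ‖θ k‖ * coneDist y := by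
    refine Finset.sum_le_sum fun k _ => (le_abs_self _).trans ?_
    rw [abs_mul]
    exact mul_le_mul (Complex.abs_re_le_norm _)
      (abs_le_of_sum_sq_eq (z := fun k => y k - p k) (coneDist_nonneg y) hd k) (abs_nonneg _)
      (norm_nonneg _)
  linarith [re_pairing_nonpos hθ hp]

lemma norm_expQueue (ε : ℝ) (θ : Pair n → ℂ) (q : Counts n) :
    ‖expQueue ε θ q‖ = Real.exp (ε * (pairing θ (realQueue q)).re) := by
  rw [expQueue, Complex.norm_exp, Complex.re_ofReal_mul]
  rfl

lemma norm_expQueue_le (hn : 0 < n) {θ : Pair n → ℂ} (hθ : θ ∈ transformDomain n) {ε : ℝ}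
    (hε : 0 ≤ ε) (q : Counts n) :
    ‖expQueue ε θ q‖ ≤ Real.exp (ε * (∑ k, ‖θ k‖) * coneDist (realQueue q)) := by
  rw [norm_expQueue, mul_assoc]
  exact Real.exp_le_exp.2 (mul_le_mul_of_nonneg_left (re_pairing_le hn hθ _) hε)

/-- From `e^x - 1 ≤ x e^x`, with the factor `X` absorbed into an exponential. The excess over `1`
carries a factor `ε`, while the exponent `η/2` leaves room for a square within the available moment.
-/
lemma exp_mul_le_one_add {ε t η X : ℝ} (hε : 0 ≤ ε) (ht : 0 ≤ t) (hη : 0 < η)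
    (hεt : ε * t ≤ η / 4) (hX : 0 ≤ X) :
    Real.exp (ε * t * X) ≤ 1 + ε * (4 * t / η * Real.exp (η / 2 * X)) := by
  have hx0 : 0 ≤ ε * t * X := by positivity
  have h1 : Real.exp (ε * t * X) - 1 ≤ ε * t * X * Real.exp (ε * t * X) := by
    have h := Real.add_one_le_exp (-(ε * t * X))
    have h' := mul_le_mul_of_nonneg_left h (Real.exp_pos (ε * t * X)).le
    rw [← Real.exp_add, add_neg_cancel, Real.exp_zero] at h'
    linarith
  have h2 : X ≤ 4 / η * Real.exp (η / 4 * X) := by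
    have := (Real.add_one_le_exp (η / 4 * X))
    calc X = 4 / η * (η / 4 * X) := by field_simp
      _ ≤ 4 / η * Real.exp (η / 4 * X) := by gcongr; linarith
  have h3 : Real.exp (ε * t * X) ≤ Real.exp (η / 4 * X) := Real.exp_le_exp.2 (by gcongr)
  have h4 : ε * t * X * Real.exp (ε * t * X) ≤
      ε * t * (4 / η * Real.exp (η / 4 * X)) * Real.exp (η / 4 * X) := by gcongr
  have h5 : Real.exp (η / 2 * X) = Real.exp (η / 4 * X) * Real.exp (η / 4 * X) := by
    rw [← Real.exp_add]; ring_nf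
  rw [h5]
  calc Real.exp (ε * t * X) ≤ 1 + ε * t * (4 / η * Real.exp (η / 4 * X)) * Real.exp (η / 4 * X) :=
        by linarith
    _ = _ := by ring

/-! ### Integrals over one slot -/

lemma measurePreserving_nextQueue {T : Kernel (Counts n) (Counts n)}
    {A : Pair n → Measure ℕ} {π : Measure (Counts n)} (hπ : IsSteadyState T A π) :
    MeasurePreserving nextQueue (slotLaw T A π) π :=
  ⟨Measurable.of_discrete, hπ.map_nextQueue⟩

lemma integral_slotLaw_nextQueue {T : Kernel (Counts n) (Counts n)}
    {A : Pair n → Measure ℕ} {π : Measure (Counts n)} (hπ : IsSteadyState T A π)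
    {E : Type*} [NormedAddCommGroup E] [NormedSpace ℝ E] (f : Counts n → E) :
    ∫ x, f (nextQueue x) ∂slotLaw T A π = ∫ q, f q ∂π := by
  conv_rhs => rw [← (measurePreserving_nextQueue hπ).map_eq]
  rw [integral_map Measurable.of_discrete.aemeasurable
    StronglyMeasurable.of_discrete.aestronglyMeasurable]

section Slot

variable {T : Kernel (Counts n) (Counts n)} [IsMarkovKernel T] {A : Pair n → Measure ℕ}
  [∀ k, IsProbabilityMeasure (A k)] {π : Measure (Counts n)}

lemma measurePreserving_slotLaw [IsProbabilityMeasure π] :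
    MeasurePreserving (fun x : (Counts n × Counts n) × Counts n => x.1.1) (slotLaw T A π) π := by
  refine ⟨Measurable.of_discrete, Measure.ext_of_lintegral _ fun f _ => ?_⟩
  rw [lintegral_map Measurable.of_discrete Measurable.of_discrete, lintegral_slotLaw_fst]

lemma integral_slotLaw_fst [IsProbabilityMeasure π] {E : Type*} [NormedAddCommGroup E]
    [NormedSpace ℝ E] (f : Counts n → E) :
    ∫ x, f x.1.1 ∂slotLaw T A π = ∫ q, f q ∂π := by
  conv_rhs => rw [← (measurePreserving_slotLaw (T := T) (A := A) (π := π)).map_eq]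
  rw [integral_map Measurable.of_discrete.aemeasurable
    StronglyMeasurable.of_discrete.aestronglyMeasurable]

lemma integral_slotLaw_mul [IsProbabilityMeasure π] (f g : Counts n → ℂ) :
    ∫ x, f x.1.1 * g x.2 ∂slotLaw T A π = (∫ q, f q ∂π) * ∫ a, g a ∂Measure.pi A := by
  rw [slotLaw, integral_prod_mul (fun y : Counts n × Counts n => f y.1) g]
  congr 1
  have := integral_slotLaw_fst (T := T) (A := A) (π := π) f
  rw [slotLaw] at this
  rw [← this, integral_fun_fst (fun y : Counts n × Counts n => f y.1)]
  simp

lemma integrable_of_slotLaw_bound {E F : Type*} [NormedAddCommGroup E] [NormedAddCommGroup F]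
    [IsProbabilityMeasure π]
    {f : Counts n → E} (hf : Integrable f π) {g : (Counts n × Counts n) × Counts n → F} {C : ℝ}
    (h : ∀ᵐ x ∂slotLaw T A π, ‖g x‖ ≤ C * ‖f x.1.1‖) : Integrable g (slotLaw T A π) := by
  have h1 : Integrable (fun x : (Counts n × Counts n) × Counts n => f x.1.1) (slotLaw T A π) :=
    (measurePreserving_slotLaw (T := T) (A := A) (π := π)).integrable_comp_of_integrable hf
  exact (h1.norm.const_mul C).mono' StronglyMeasurable.of_discrete.aestronglyMeasurable h

end Slot

/-! ### Second moments of the arrivals -/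

section Variance

variable {A : Pair n → Measure ℕ} [∀ k, IsProbabilityMeasure (A k)] {aMax : ℕ}

/-- Independent coordinates are uncorrelated, which is why only the diagonal `v` survives in the
functional equation. -/
lemma integral_centered_mul (hb : ∀ k, ∀ᵐ m ∂(A k), m ≤ aMax) (k l : Pair n) :
    ∫ a : Counts n, ((a k : ℝ) - ∫ m, (m : ℝ) ∂A k) * ((a l : ℝ) - ∫ m, (m : ℝ) ∂A l)
      ∂Measure.pi A = if k = l then variance (fun m : ℕ => (m : ℝ)) (A k) else 0 := by
  split_ifs with h
  · subst h
    rw [variance_eq_integral Measurable.of_discrete.aemeasurable]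
    conv_rhs => rw [← (measurePreserving_eval A k).map_eq]
    rw [integral_map Measurable.of_discrete.aemeasurable
      Measurable.of_discrete.aestronglyMeasurable]
    simp only [(measurePreserving_eval A k).map_eq, sq, Function.eval]
  · have hind := (iIndepFun_pi (μ := A) (X := fun k (m : ℕ) => (m : ℝ) - ∫ m, (m : ℝ) ∂A k)
      fun k => Measurable.of_discrete.aemeasurable).indepFun h
    rw [hind.integral_fun_mul_eq_mul_integral Measurable.of_discrete.aestronglyMeasurable
      Measurable.of_discrete.aestronglyMeasurable,
      integral_sub (integrable_eval hb k) (integrable_const _), integral_eval]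
    simp

lemma integral_linear_sub (hb : ∀ k, ∀ᵐ m ∂(A k), m ≤ aMax) (θ : Pair n → ℂ) :
    ∫ a : Counts n, ∑ k, θ k * (((a k : ℝ) - ∫ m, (m : ℝ) ∂A k : ℝ) : ℂ) ∂Measure.pi A = 0 := by
  have hi : ∀ k, Integrable (fun a : Counts n => (a k : ℝ) - ∫ m, (m : ℝ) ∂A k) (Measure.pi A) :=
    fun k => (integrable_eval hb k).sub (integrable_const _)
  rw [integral_finsetSum _ fun k _ => ((hi k).ofReal).const_mul _]
  refine Finset.sum_eq_zero fun k _ => ?_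
  rw [integral_const_mul, integral_complex_ofReal,
    integral_sub (integrable_eval hb k) (integrable_const _), integral_eval]
  simp

lemma integral_linear_sub_sq (hb : ∀ k, ∀ᵐ m ∂(A k), m ≤ aMax) (θ : Pair n → ℂ) (c : ℂ) :
    ∫ a : Counts n, (∑ k, θ k * (((a k : ℝ) - ∫ m, (m : ℝ) ∂A k : ℝ) : ℂ) + c) ^ 2 ∂Measure.pi A =
      ∑ k, (variance (fun m : ℕ => (m : ℝ)) (A k) : ℂ) * θ k ^ 2 + c ^ 2 := by
  set b : Pair n → Counts n → ℝ := fun k a => (a k : ℝ) - ∫ m, (m : ℝ) ∂A k with hb_def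
  have hb0 : ∀ k a, (a k ≤ aMax) → |b k a| ≤ aMax + |∫ m, (m : ℝ) ∂A k| := by
    intro k a ha
    refine (abs_sub _ _).trans ?_
    gcongr
    simpa using ha
  have hi2 : ∀ k l, Integrable (fun a => b k a * b l a) (Measure.pi A) := fun k l =>
    integrable_pi_of_bound ((aMax + |∫ m, (m : ℝ) ∂A k|) * (aMax + |∫ m, (m : ℝ) ∂A l|)) hb
      fun a ha => by
        rw [norm_mul]
        exact mul_le_mul (hb0 k a (ha k)) (hb0 l a (ha l)) (abs_nonneg _) (by positivity)
  have hi1 : ∀ k, Integrable (fun a => b k a) (Measure.pi A) := fun k =>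
    (integrable_eval hb k).sub (integrable_const _)
  have e : ∀ a : Counts n, (∑ k, θ k * ((b k a : ℝ) : ℂ) + c) ^ 2 =
      ∑ k, ∑ l, θ k * θ l * ((b k a * b l a : ℝ) : ℂ) +
        (2 * c * ∑ k, θ k * ((b k a : ℝ) : ℂ) + c ^ 2) := by
    intro a
    rw [add_sq, sq (∑ k, θ k * ((b k a : ℝ) : ℂ)), Finset.sum_mul_sum]
    have : ∀ k l, θ k * ((b k a : ℝ) : ℂ) * (θ l * ((b l a : ℝ) : ℂ)) =
        θ k * θ l * ((b k a * b l a : ℝ) : ℂ) := fun k l => by push_cast; ring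
    simp only [this]
    ring
  have hd : ∀ k l, Integrable (fun a => θ k * θ l * ((b k a * b l a : ℝ) : ℂ)) (Measure.pi A) :=
    fun k l => ((hi2 k l).ofReal).const_mul _
  have hl : Integrable (fun a => 2 * c * ∑ k, θ k * ((b k a : ℝ) : ℂ)) (Measure.pi A) :=
    (integrable_finsetSum _ fun k _ => ((hi1 k).ofReal).const_mul _).const_mul _
  have hlc : Integrable (fun a => 2 * c * ∑ k, θ k * ((b k a : ℝ) : ℂ) + c ^ 2) (Measure.pi A) :=
    hl.add (integrable_const _)
  have hlin := integral_linear_sub hb θ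
  change ∫ a, (∑ k, θ k * ((b k a : ℝ) : ℂ) + c) ^ 2 ∂Measure.pi A = _
  change ∫ a, ∑ k, θ k * ((b k a : ℝ) : ℂ) ∂Measure.pi A = 0 at hlin
  simp only [e]
  rw [integral_add (integrable_finsetSum _ fun k _ => integrable_finsetSum _ fun l _ => hd k l)
    hlc, integral_add hl (integrable_const _), integral_const_mul, hlin,
    integral_finsetSum _ fun k _ => integrable_finsetSum _ fun l _ => hd k l]
  simp only [mul_zero, integral_const, probReal_univ, one_smul, zero_add]
  congr 1
  refine Finset.sum_congr rfl fun k _ => ?_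
  rw [integral_finsetSum _ fun l _ => hd k l]
  have : ∀ l, ∫ a, θ k * θ l * ((b k a * b l a : ℝ) : ℂ) ∂Measure.pi A =
      θ k * θ l * ((if k = l then variance (fun m : ℕ => (m : ℝ)) (A k) else 0 : ℝ) : ℂ) := by
    intro l
    rw [integral_const_mul, integral_complex_ofReal, ← integral_centered_mul hb k l]
  simp only [this]
  rw [Finset.sum_eq_single k]
  · simp; ring
  · intro l _ hl
    simp [hl.symm]
  · simp

end Variance

/-! ### The functional equation before the limit -/

/-- A steady state of the switch with parameter `ε`, together with a bound on the exponential
moments of the distance to the cone. -/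
structure CollapsedState (ν : Pair n → ℝ) (aMax : ℕ) (T : Kernel (Counts n) (Counts n))
    (A : Pair n → Measure ℕ) (π : Measure (Counts n)) (ε η C : ℝ) : Prop where
  steady : IsSteadyState T A π
  eps_mem : ε ∈ Set.Ioo (0 : ℝ) 1
  bounded : ∀ k, ∀ᵐ m ∂(A k), m ≤ aMax
  mean : ∀ k, ∫ m, (m : ℝ) ∂(A k) = (1 - ε) * ν k
  integrable_exp : Integrable (fun q => Real.exp (η * coneDist (realQueue q))) π
  integral_exp_le : ∫ q, Real.exp (η * coneDist (realQueue q)) ∂π ≤ C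
  integral_unused_le : ∫ x, ((∑ k, unused x k : ℕ) : ℝ) ∂slotLaw T A π ≤ n * ε
  lintegral_sum_le : ∫⁻ q, ENNReal.ofReal (ε * ∑ k, (q k : ℝ)) ∂π ≤ ENNReal.ofReal C
  lintegral_unused_tail_le : ∀ R : ℕ,
    ∫⁻ x, (if R ≤ ∑ k, x.1.1 k then ((∑ k, unused x k : ℕ) : ℝ≥0∞) else 0) ∂slotLaw T A π ≤
      ENNReal.ofReal (n * ε) * π {q | R ≤ ∑ k, q k}

namespace CollapsedState

variable {ν : Pair n → ℝ} {aMax : ℕ} {T : Kernel (Counts n) (Counts n)} [IsMarkovKernel T]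
  {A : Pair n → Measure ℕ} [∀ k, IsProbabilityMeasure (A k)] {π : Measure (Counts n)} {ε η C : ℝ}

lemma exp_half_le (hη : 0 < η) (q : Counts n) : Real.exp (η / 2 * coneDist (realQueue q)) ≤
    Real.exp (η * coneDist (realQueue q)) :=
  Real.exp_le_exp.2 (mul_le_mul_of_nonneg_right (by linarith) (coneDist_nonneg _))

lemma integrable_exp_half (h : CollapsedState ν aMax T A π ε η C) (hη : 0 < η) :
    Integrable (fun q => Real.exp (η / 2 * coneDist (realQueue q))) π :=
  h.integrable_exp.mono' Measurable.of_discrete.aestronglyMeasurable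
    (.of_forall fun q => by
      rw [Real.norm_eq_abs, abs_of_pos (Real.exp_pos _)]
      exact exp_half_le hη q)

lemma integral_exp_half_le (h : CollapsedState ν aMax T A π ε η C) (hη : 0 < η) :
    ∫ q, Real.exp (η / 2 * coneDist (realQueue q)) ∂π ≤ C :=
  (integral_mono (h.integrable_exp_half hη) h.integrable_exp (exp_half_le hη)).trans
    h.integral_exp_le

lemma bound_nonneg (h : CollapsedState ν aMax T A π ε η C) : 0 ≤ C :=
  (integral_nonneg fun _ => (Real.exp_pos _).le).trans h.integral_exp_le

lemma unused_le (h : CollapsedState ν aMax T A π ε η C) (hT : IsMaxWeight T) :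
    ∀ᵐ x ∂slotLaw T A π, ∑ k, unused x k ≤ n := by
  have := h.steady.isProbabilityMeasure
  filter_upwards [ae_slotLaw hT h.bounded] with x hx
  exact (Finset.sum_le_sum fun k _ => Nat.sub_le _ _).trans (sum_schedule hx.1).le

lemma integrable_unused (h : CollapsedState ν aMax T A π ε η C) (hT : IsMaxWeight T) :
    Integrable (fun x => ((∑ k, unused x k : ℕ) : ℝ)) (slotLaw T A π) := by
  have := h.steady.isProbabilityMeasure
  refine Integrable.of_bound Measurable.of_discrete.aestronglyMeasurable n ?_
  filter_upwards [h.unused_le hT] with x hx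
  simp only [Real.norm_natCast]
  exact_mod_cast hx

lemma integrable_unused_mul (h : CollapsedState ν aMax T A π ε η C) (hT : IsMaxWeight T)
    {f : Counts n → ℝ} (hf : Integrable f π) :
    Integrable (fun x => ((∑ k, unused x k : ℕ) : ℝ) * f x.1.1) (slotLaw T A π) := by
  have := h.steady.isProbabilityMeasure
  refine integrable_of_slotLaw_bound hf (C := n) ?_
  filter_upwards [h.unused_le hT] with x hx
  rw [norm_mul, Real.norm_natCast]
  gcongr

/-- Unused service is asymptotically independent of the deviation from the cone. -/
lemma integral_unused_mul_exp_half_le (h : CollapsedState ν aMax T A π ε η C) (hT : IsMaxWeight T)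
    (hη : 0 < η) :
    ∫ x, ((∑ k, unused x k : ℕ) : ℝ) * Real.exp (η / 2 * coneDist (realQueue x.1.1))
      ∂slotLaw T A π ≤ n * (n + C) * Real.sqrt ε := by
  have := h.steady.isProbabilityMeasure
  have hε := h.eps_mem.1
  set r := Real.sqrt ε with hr
  have hr0 : 0 < r := Real.sqrt_pos.2 hε
  have hr2 : r * r = ε := Real.mul_self_sqrt hε.le
  have hpt : ∀ᵐ x ∂slotLaw T A π,
      ((∑ k, unused x k : ℕ) : ℝ) * Real.exp (η / 2 * coneDist (realQueue x.1.1)) ≤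
        n * (((∑ k, unused x k : ℕ) : ℝ) * r⁻¹ +
          r * Real.exp (η * coneDist (realQueue x.1.1))) := by
    filter_upwards [h.unused_le hT] with x hx
    set u : ℕ := ∑ k, unused x k with hu
    set w := Real.exp (η / 2 * coneDist (realQueue x.1.1)) with hw
    have hw2 : Real.exp (η * coneDist (realQueue x.1.1)) = w ^ 2 := by
      rw [hw, ← Real.exp_nat_mul]; ring_nf
    rw [hw2]
    rcases Nat.eq_zero_or_pos u with h0 | h0
    · rw [h0]
      simp only [Nat.cast_zero, zero_mul, zero_add]
      positivity
    · have h1 : (1 : ℝ) ≤ u := by exact_mod_cast h0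
      have h2 : (u : ℝ) ≤ n := by exact_mod_cast hx
      -- Either `w ≤ 1/r`, or `rw ≥ 1` and then `w ≤ rw²`. With `r = √ε`, the mean `nε` of the
      -- unused service and the bound `C` for the mean of `w²` both give order `√ε`. Since `u` is an
      -- integer, `r⁻¹` may be weighted by `u` whenever `u ≠ 0`.
      have h3 : w ≤ r⁻¹ + r * w ^ 2 := by
        have e : r * r⁻¹ = 1 := mul_inv_cancel₀ hr0.ne'
        by_cases hc : w ≤ r⁻¹
        · have : 0 ≤ r * w ^ 2 := by positivity
          linarith
        · have hc' : 1 ≤ r * w := by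
            rw [← e]
            exact mul_le_mul_of_nonneg_left (not_le.1 hc).le hr0.le
          have hw0 : 0 ≤ w := (Real.exp_pos _).le
          have : 0 ≤ r⁻¹ := inv_nonneg.2 hr0.le
          nlinarith
      have hrinv : 0 ≤ r⁻¹ := inv_nonneg.2 hr0.le
      calc (u : ℝ) * w ≤ n * (r⁻¹ + r * w ^ 2) := by gcongr
        _ ≤ n * ((u : ℝ) * r⁻¹ + r * w ^ 2) := by
          gcongr
          exact le_mul_of_one_le_left hrinv h1
  have hinteg : Integrable (fun x : (Counts n × Counts n) × Counts n =>
      Real.exp (η * coneDist (realQueue x.1.1))) (slotLaw T A π) :=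
    (measurePreserving_slotLaw (T := T) (A := A)).integrable_comp_of_integrable h.integrable_exp
  calc _ ≤ ∫ x, (n : ℝ) * (((∑ k, unused x k : ℕ) : ℝ) * r⁻¹ +
          r * Real.exp (η * coneDist (realQueue x.1.1))) ∂slotLaw T A π :=
        integral_mono_ae (h.integrable_unused_mul hT (h.integrable_exp_half hη))
          ((((h.integrable_unused hT).mul_const _).add (hinteg.const_mul _)).const_mul _) hpt
    _ = n * ((∫ x, ((∑ k, unused x k : ℕ) : ℝ) ∂slotLaw T A π) * r⁻¹ +
          r * ∫ q, Real.exp (η * coneDist (realQueue q)) ∂π) := by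
        rw [integral_const_mul, integral_add ((h.integrable_unused hT).mul_const _)
          (hinteg.const_mul _), integral_mul_const, integral_const_mul,
          integral_slotLaw_fst (fun q => Real.exp (η * coneDist (realQueue q)))]
    _ ≤ n * (n * ε * r⁻¹ + r * C) := by
        have := h.integral_unused_le
        have := h.integral_exp_le
        have : 0 ≤ r⁻¹ := inv_nonneg.2 hr0.le
        gcongr
    _ = n * (n + C) * r := by
        rw [← hr2]
        field_simp

section Transform

variable {θ : Pair n → ℂ}

lemma norm_expQueue_le_one_add (h : CollapsedState ν aMax T A π ε η C) (hn : 0 < n) (hη : 0 < η)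
    (hθ : θ ∈ transformDomain n) (hεθ : ε * ∑ k, ‖θ k‖ ≤ η / 4) (q : Counts n) :
    ‖expQueue ε θ q‖ ≤
      1 + ε * (4 * (∑ k, ‖θ k‖) / η * Real.exp (η / 2 * coneDist (realQueue q))) :=
  (norm_expQueue_le hn hθ h.eps_mem.1.le q).trans
    (exp_mul_le_one_add h.eps_mem.1.le (Finset.sum_nonneg fun _ _ => norm_nonneg _) hη hεθ
      (coneDist_nonneg _))

lemma integrable_bound (h : CollapsedState ν aMax T A π ε η C) (hη : 0 < η) (K : ℝ) :
    Integrable (fun q => 1 + ε * (K * Real.exp (η / 2 * coneDist (realQueue q)))) π := by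
  have := h.steady.isProbabilityMeasure
  exact (integrable_const _).add (((h.integrable_exp_half hη).const_mul _).const_mul _)

lemma integral_bound_le (h : CollapsedState ν aMax T A π ε η C) (hη : 0 < η) {K : ℝ}
    (hK : 0 ≤ K) :
    ∫ q, (1 + ε * (K * Real.exp (η / 2 * coneDist (realQueue q)))) ∂π ≤ 1 + K * C := by
  have := h.steady.isProbabilityMeasure
  rw [integral_add (integrable_const _) (((h.integrable_exp_half hη).const_mul _).const_mul _),
    integral_const_mul, integral_const_mul]
  simp only [integral_const, probReal_univ, one_smul]
  have h1 := h.integral_exp_half_le hη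
  have h2 : 0 ≤ K * C := mul_nonneg hK h.bound_nonneg
  have h3 : ε * (K * ∫ q, Real.exp (η / 2 * coneDist (realQueue q)) ∂π) ≤ ε * (K * C) :=
    mul_le_mul_of_nonneg_left (mul_le_mul_of_nonneg_left h1 hK) h.eps_mem.1.le
  nlinarith [h.eps_mem.2, h.eps_mem.1]

lemma integrable_expQueue (h : CollapsedState ν aMax T A π ε η C) (hn : 0 < n) (hη : 0 < η)
    (hθ : θ ∈ transformDomain n) (hεθ : ε * ∑ k, ‖θ k‖ ≤ η / 4) :
    Integrable (expQueue ε θ) π :=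
  (h.integrable_bound hη (4 * (∑ k, ‖θ k‖) / η)).mono'
    Measurable.of_discrete.aestronglyMeasurable
    (.of_forall fun q => h.norm_expQueue_le_one_add hn hη hθ hεθ q)

lemma integral_norm_expQueue_le (h : CollapsedState ν aMax T A π ε η C) (hn : 0 < n) (hη : 0 < η)
    (hθ : θ ∈ transformDomain n) (hεθ : ε * ∑ k, ‖θ k‖ ≤ η / 4) :
    ∫ q, ‖expQueue ε θ q‖ ∂π ≤ 1 + 4 * (∑ k, ‖θ k‖) / η * C :=
  (integral_mono (h.integrable_expQueue hn hη hθ hεθ).norm (h.integrable_bound hη _)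
    fun q => h.norm_expQueue_le_one_add hn hη hθ hεθ q).trans
    (h.integral_bound_le hη (by positivity))

/-- The part `1` of the bound on the exponential meets the mean `nε` of the unused service, and the
excess over `1` brings its own factor `ε`. Hence the transforms of the unused service stay bounded
after division by `ε`. -/
lemma integral_unused_mul_norm_expQueue_le (h : CollapsedState ν aMax T A π ε η C) (hn : 0 < n)
    (hT : IsMaxWeight T) (hη : 0 < η) (hθ : θ ∈ transformDomain n)
    (hεθ : ε * ∑ k, ‖θ k‖ ≤ η / 4) :
    ∫ x, ((∑ k, unused x k : ℕ) : ℝ) * ‖expQueue ε θ x.1.1‖ ∂slotLaw T A π ≤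
      ε * (n + 4 * (∑ k, ‖θ k‖) / η * (n * (n + C))) := by
  have := h.steady.isProbabilityMeasure
  set K := 4 * (∑ k, ‖θ k‖) / η with hK
  have hK0 : 0 ≤ K := by positivity
  have hi1 := h.integrable_unused hT
  have hi2 := (h.integrable_unused_mul hT (h.integrable_exp_half hη))
  calc _ ≤ ∫ x, (((∑ k, unused x k : ℕ) : ℝ) + ε * K * (((∑ k, unused x k : ℕ) : ℝ) *
          Real.exp (η / 2 * coneDist (realQueue x.1.1)))) ∂slotLaw T A π := by
        refine integral_mono (h.integrable_unused_mul hT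
          (h.integrable_expQueue hn hη hθ hεθ).norm) (hi1.add (hi2.const_mul _)) fun x => ?_
        have := mul_le_mul_of_nonneg_left (h.norm_expQueue_le_one_add hn hη hθ hεθ x.1.1)
          (Nat.cast_nonneg (α := ℝ) (∑ k, unused x k))
        refine this.trans (le_of_eq ?_)
        simp only [← hK]
        ring
    _ = ∫ x, ((∑ k, unused x k : ℕ) : ℝ) ∂slotLaw T A π +
          ε * K * ∫ x, ((∑ k, unused x k : ℕ) : ℝ) *
          Real.exp (η / 2 * coneDist (realQueue x.1.1)) ∂slotLaw T A π := by
        rw [integral_add hi1 (hi2.const_mul _), integral_const_mul]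
    _ ≤ n * ε + ε * K * (n * (n + C) * 1) := by
        have h1 := h.integral_unused_le
        have h2 := h.integral_unused_mul_exp_half_le hT hη
        have h3 : Real.sqrt ε ≤ 1 := Real.sqrt_le_one.2 h.eps_mem.2.le
        have h4 := h.eps_mem.1.le
        have h5 := h.bound_nonneg
        have h6 : (n : ℝ) * (n + C) * Real.sqrt ε ≤ n * (n + C) * 1 := by gcongr
        gcongr
        exact h2.trans h6
    _ = _ := by ring

end Transform

end CollapsedState

/-! ### Second-order expansion over one slot and the approximate functional equation -/

namespace CollapsedState

variable {ν : Pair n → ℝ} {aMax : ℕ} {T : Kernel (Counts n) (Counts n)} [IsMarkovKernel T]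
  {A : Pair n → Measure ℕ} [∀ k, IsProbabilityMeasure (A k)] {π : Measure (Counts n)} {ε η C : ℝ}
  {θ : Pair n → ℂ}

lemma norm_sum_mul_le {x : Pair n → ℂ} {c : ℝ} (hx : ∀ k, ‖x k‖ ≤ c) :
    ‖∑ k, θ k * x k‖ ≤ c * ∑ k, ‖θ k‖ := by
  rw [Finset.mul_sum]
  refine (norm_sum_le _ _).trans (Finset.sum_le_sum fun k _ => ?_)
  rw [norm_mul, mul_comm]
  exact mul_le_mul_of_nonneg_right (hx k) (norm_nonneg _)

/-- Second-order expansion of the exponential, with a first-order perturbation. -/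
lemma norm_exp_expansion_le {ε B V : ℝ} (hε : 0 ≤ ε) (hε1 : ε ≤ 1) {ξ υ : ℂ} (hξ : ‖ξ‖ ≤ B)
    (hζ : ‖ξ + υ‖ ≤ B) (hυ : ‖υ‖ ≤ V) :
    ‖Complex.exp (ε * (ξ + υ)) - (1 + ε * ξ + ε * υ + ε ^ 2 / 2 * ξ ^ 2)‖ ≤
      ε ^ 3 * (B ^ 3 * Real.exp B) + ε ^ 2 * (B * V) := by
  have hB : 0 ≤ B := (norm_nonneg _).trans hξ
  have h1 := Complex.norm_exp_sub_sum_le_norm_mul_exp (ε * (ξ + υ)) 3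
  have hn : ‖(ε : ℂ) * (ξ + υ)‖ ≤ ε * B := by
    rw [norm_mul, Complex.norm_real, Real.norm_of_nonneg hε]
    gcongr
  have hn' : ε * B ≤ B := mul_le_of_le_one_left hB hε1
  have h2 : ‖(ε : ℂ) * (ξ + υ)‖ ^ 3 * Real.exp ‖(ε : ℂ) * (ξ + υ)‖ ≤
      ε ^ 3 * (B ^ 3 * Real.exp B) := by
    rw [← mul_assoc, ← mul_pow]
    gcongr
    exact hn.trans hn'
  -- This is the part `(ξ + υ)² - ξ²` of the quadratic term. It is kept linear in the bound `V` for
  -- `υ`, because the mean of the unused service will supply one more factor `ε`.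
  have h3 : ‖(ε : ℂ) ^ 2 / 2 * (υ * ((ξ + υ) + ξ))‖ ≤ ε ^ 2 * (B * V) := by
    have hV : 0 ≤ V := (norm_nonneg _).trans hυ
    rw [norm_mul, norm_div, norm_pow, Complex.norm_real, Real.norm_of_nonneg hε, norm_mul,
      Complex.norm_ofNat]
    have h4 : ‖ξ + υ + ξ‖ ≤ B + B := (norm_add_le _ _).trans (add_le_add hζ hξ)
    calc ε ^ 2 / 2 * (‖υ‖ * ‖ξ + υ + ξ‖) ≤ ε ^ 2 / 2 * (V * (B + B)) := by gcongr
      _ = ε ^ 2 * (B * V) := by ring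
  have e : Complex.exp (ε * (ξ + υ)) - (1 + ε * ξ + ε * υ + ε ^ 2 / 2 * ξ ^ 2) =
      (Complex.exp (ε * (ξ + υ)) -
        ∑ m ∈ Finset.range 3, ((ε : ℂ) * (ξ + υ)) ^ m / (m.factorial : ℂ)) +
      (ε : ℂ) ^ 2 / 2 * (υ * ((ξ + υ) + ξ)) := by
    simp [Finset.sum_range_succ, Nat.factorial]
    ring
  rw [e]
  exact (norm_add_le _ _).trans (add_le_add (h1.trans h2) h3)

lemma expQueue_eq (ε : ℝ) (θ : Pair n → ℂ) (q : Counts n) :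
    expQueue ε θ q = Complex.exp (ε * ∑ k, θ k * (q k : ℂ)) := by
  simp [expQueue, pairing]

/-- The functional equation holds up to an error of order `ε`. -/
lemma norm_functional_le (h : CollapsedState ν aMax T A π ε η C) (hn : 0 < n) (hT : IsMaxWeight T)
    (hν : ν ∈ saturatedRates n) (hη : 0 < η) (hθ : θ ∈ transformDomain n)
    (hεθ : ε * ∑ k, ‖θ k‖ ≤ η / 4) {B : ℝ} (hB : B = (aMax + 1) * ∑ k, ‖θ k‖) :
    ‖(-(1 / (n : ℂ)) * ∑ k, θ k + 1 / 2 *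
        (∑ k, (variance (fun m : ℕ => (m : ℝ)) (A k) : ℂ) * θ k ^ 2 +
          (-(ε : ℂ) * (1 / (n : ℂ) * ∑ k, θ k)) ^ 2)) * queueTransform π ε θ +
      ∑ k, θ k * unusedTransform T A π ε k θ‖ ≤
    ε * (B ^ 3 * Real.exp B * (1 + 4 * (∑ k, ‖θ k‖) / η * C) +
      B * (∑ k, ‖θ k‖) * (n + 4 * (∑ k, ‖θ k‖) / η * (n * (n + C)))) := by
  have hprob := h.steady.isProbabilityMeasure
  have hε := h.eps_mem.1
  have hεC : (ε : ℂ) ≠ 0 := Complex.ofReal_ne_zero.2 hε.ne'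
  set S := ∑ k, ‖θ k‖ with hS
  have hS0 : 0 ≤ S := Finset.sum_nonneg fun _ _ => norm_nonneg _
  have hB0 : 0 ≤ B := by rw [hB]; positivity
  set c : ℂ := 1 / (n : ℂ) * ∑ k, θ k with hc
  set f := expQueue ε θ with hf
  have hfi : Integrable f π := h.integrable_expQueue hn hη hθ hεθ
  set w : ℂ := ∑ k, (variance (fun m : ℕ => (m : ℝ)) (A k) : ℂ) * θ k ^ 2 + (-(ε : ℂ) * c) ^ 2
    with hw
  have hθν : ∑ k, θ k * (ν k : ℂ) = c :=
    sum_mul_eq_of_sum_eq_one hn hθ (fun j => by exact_mod_cast hν.2.1 j)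
      (fun i => by exact_mod_cast hν.2.2 i)
  -- For every schedule this equals `⟨θ, a - s⟩`, since `⟨θ, s⟩ = ⟨θ, ν⟩ = c` on `𝓢`. It is thus a
  -- function of the arrivals alone, hence independent of the queues, with mean `-εc`.
  set ξ : Counts n → ℂ := fun a => ∑ k, θ k * (((a k : ℝ) - ∫ m, (m : ℝ) ∂A k : ℝ) : ℂ) +
    -(ε : ℂ) * c with hξ
  have hξ_eq : ∀ a, ξ a = ∑ k, θ k * (a k : ℂ) - c := by
    intro a
    have e1 : ∑ k, θ k * (((a k : ℝ) - ∫ m, (m : ℝ) ∂A k : ℝ) : ℂ) =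
        ∑ k, θ k * (a k : ℂ) - (1 - ε) * ∑ k, θ k * (ν k : ℂ) := by
      rw [Finset.mul_sum, ← Finset.sum_sub_distrib]
      refine Finset.sum_congr rfl fun k _ => ?_
      rw [h.mean]
      push_cast
      ring
    simp only [hξ, e1, hθν]
    ring
  set υ : (Counts n × Counts n) × Counts n → ℂ := fun x => ∑ k, θ k * (unused x k : ℂ) with hυ
  have hae := ae_slotLaw (π := π) hT h.bounded
  have hξ_s : ∀ {x : (Counts n × Counts n) × Counts n}, x.1.2 ∈ schedules n →
      ξ x.2 = ∑ k, θ k * ((x.2 k : ℂ) - x.1.2 k) := by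
    intro x hx
    have hs : ∑ k, θ k * (x.1.2 k : ℂ) = c :=
      sum_mul_eq_of_sum_eq_one hn hθ (fun j => by exact_mod_cast hx.2.1 j)
        (fun i => by exact_mod_cast hx.2.2 i)
    rw [hξ_eq, ← hs, ← Finset.sum_sub_distrib]
    exact Finset.sum_congr rfl fun k _ => by ring
  have hξB : ∀ᵐ x ∂slotLaw T A π, ‖ξ x.2‖ ≤ B := by
    filter_upwards [hae] with x hx
    rw [hξ_s hx.1, hB]
    refine norm_sum_mul_le fun k => ?_
    have := abs_arrival_sub_schedule_le hx.1 hx.2 k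
    rw [← Real.norm_eq_abs, ← Complex.norm_real] at this
    simpa using this
  have hstep : ∀ {x : (Counts n × Counts n) × Counts n}, x.1.2 ∈ schedules n →
      ξ x.2 + υ x = ∑ k, θ k * ((nextQueue x k : ℂ) - x.1.1 k) := by
    intro x hx
    rw [hξ_s hx, hυ, ← Finset.sum_add_distrib]
    refine Finset.sum_congr rfl fun k _ => ?_
    have := congrArg (fun r : ℝ => (r : ℂ)) (nextQueue_cast x k)
    push_cast at this
    rw [this]
    ring
  have hζB : ∀ᵐ x ∂slotLaw T A π, ‖ξ x.2 + υ x‖ ≤ B := by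
    filter_upwards [hae] with x hx
    rw [hstep hx.1, hB]
    refine norm_sum_mul_le fun k => ?_
    have := abs_nextQueue_sub_le (q := x.1.1) hx.1 hx.2 k
    rw [← Real.norm_eq_abs, ← Complex.norm_real] at this
    simpa using this
  have hυU : ∀ x, ‖υ x‖ ≤ S * ((∑ k, unused x k : ℕ) : ℝ) := by
    intro x
    rw [mul_comm]
    refine norm_sum_mul_le fun k => ?_
    rw [Complex.norm_natCast]
    exact_mod_cast Finset.single_le_sum (f := fun k => unused x k) (fun _ _ => Nat.zero_le _)
      (Finset.mem_univ k)
  have hυB : ∀ᵐ x ∂slotLaw T A π, ‖υ x‖ ≤ S * n := by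
    filter_upwards [h.unused_le hT] with x hx
    refine (hυU x).trans ?_
    gcongr
  have hnext : ∀ᵐ x ∂slotLaw T A π,
      f (nextQueue x) = f x.1.1 * Complex.exp (ε * (ξ x.2 + υ x)) := by
    filter_upwards [hae] with x hx
    rw [hf, expQueue_eq, expQueue_eq, ← Complex.exp_add, hstep hx.1, ← mul_add,
      ← Finset.sum_add_distrib]
    congr 2
    exact Finset.sum_congr rfl fun k _ => by ring
  -- integrability of all terms of the expansion
  have i0 : Integrable (fun x => f (nextQueue x)) (slotLaw T A π) :=
    (measurePreserving_nextQueue h.steady).integrable_comp_of_integrable hfi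
  have i1 : Integrable (fun x : (Counts n × Counts n) × Counts n => f x.1.1) (slotLaw T A π) :=
    (measurePreserving_slotLaw (T := T) (A := A)).integrable_comp_of_integrable hfi
  have i2 : Integrable (fun x => f x.1.1 * ξ x.2) (slotLaw T A π) :=
    integrable_of_slotLaw_bound hfi (C := B) (by
      filter_upwards [hξB] with x hx
      rw [norm_mul, mul_comm]
      gcongr)
  have i3 : ∀ k, Integrable (fun x => (unused x k : ℂ) * f x.1.1) (slotLaw T A π) := fun k =>
    integrable_of_slotLaw_bound hfi (C := n) (by
      filter_upwards [h.unused_le hT] with x hx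
      rw [norm_mul, Complex.norm_natCast]
      gcongr
      exact (Finset.single_le_sum (f := fun k => unused x k) (fun _ _ => Nat.zero_le _)
        (Finset.mem_univ k)).trans hx)
  have i4 : Integrable (fun x => f x.1.1 * ξ x.2 ^ 2) (slotLaw T A π) :=
    integrable_of_slotLaw_bound hfi (C := B ^ 2) (by
      filter_upwards [hξB] with x hx
      rw [norm_mul, mul_comm, norm_pow]
      gcongr)
  have i5 : Integrable (fun x => f x.1.1 * υ x) (slotLaw T A π) :=
    integrable_of_slotLaw_bound hfi (C := S * n) (by
      filter_upwards [hυB] with x hx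
      rw [norm_mul, mul_comm]
      gcongr)
  -- the integrals of the terms
  have v2 : ∫ x, f x.1.1 * ξ x.2 ∂slotLaw T A π = queueTransform π ε θ * (-(ε : ℂ) * c) := by
    rw [integral_slotLaw_mul f ξ]
    congr 1
    simp only [hξ]
    rw [integral_add _ (integrable_const _), integral_linear_sub h.bounded]
    · simp
    · exact integrable_finsetSum _ fun k _ =>
        (((integrable_eval h.bounded k).sub (integrable_const _)).ofReal).const_mul _
  have v4 : ∫ x, f x.1.1 * ξ x.2 ^ 2 ∂slotLaw T A π = queueTransform π ε θ * w := by
    rw [integral_slotLaw_mul f fun a => ξ a ^ 2]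
    congr 1
    exact integral_linear_sub_sq h.bounded θ _
  have v5 : ∫ x, f x.1.1 * υ x ∂slotLaw T A π =
      ε * ∑ k, θ k * unusedTransform T A π ε k θ := by
    have e : ∀ x, f x.1.1 * υ x = ∑ k, θ k * ((unused x k : ℂ) * f x.1.1) := by
      intro x
      simp only [hυ, Finset.mul_sum]
      exact Finset.sum_congr rfl fun k _ => by ring
    simp only [e]
    rw [integral_finsetSum _ fun k _ => (i3 k).const_mul _, Finset.mul_sum]
    refine Finset.sum_congr rfl fun k _ => ?_
    rw [integral_const_mul, unusedTransform]
    field_simp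
    rfl
  -- Stationarity cancels the terms of order zero. The first-order terms in `ξ` and `υ` have means
  -- of order `ε`, so they join the quadratic term and a common factor `ε²` comes out.
  have v0 : ∫ x, (f (nextQueue x) - f x.1.1 *
      (1 + ε * ξ x.2 + ε * υ x + ε ^ 2 / 2 * ξ x.2 ^ 2)) ∂slotLaw T A π =
      -((ε : ℂ) ^ 2 * ((-c + 1 / 2 * w) * queueTransform π ε θ +
        ∑ k, θ k * unusedTransform T A π ε k θ)) := by
    have e : ∀ x : (Counts n × Counts n) × Counts n, f (nextQueue x) - f x.1.1 *
        (1 + ε * ξ x.2 + ε * υ x + ε ^ 2 / 2 * ξ x.2 ^ 2) =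
        (f (nextQueue x) - f x.1.1) - (ε * (f x.1.1 * ξ x.2) + (ε * (f x.1.1 * υ x) +
          (ε : ℂ) ^ 2 / 2 * (f x.1.1 * ξ x.2 ^ 2))) := fun x => by ring
    have j1 : Integrable (fun x => (ε : ℂ) * (f x.1.1 * υ x) +
        (ε : ℂ) ^ 2 / 2 * (f x.1.1 * ξ x.2 ^ 2)) (slotLaw T A π) :=
      (i5.const_mul _).add (i4.const_mul _)
    have j2 : Integrable (fun x => (ε : ℂ) * (f x.1.1 * ξ x.2) + ((ε : ℂ) * (f x.1.1 * υ x) +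
        (ε : ℂ) ^ 2 / 2 * (f x.1.1 * ξ x.2 ^ 2))) (slotLaw T A π) :=
      (i2.const_mul _).add j1
    have j3 : Integrable (fun x => f (nextQueue x) - f x.1.1) (slotLaw T A π) := i0.sub i1
    simp only [e]
    rw [integral_sub j3 j2, integral_sub i0 i1, integral_slotLaw_nextQueue h.steady,
      integral_slotLaw_fst, sub_self, integral_add (i2.const_mul _) j1,
      integral_add (i5.const_mul _) (i4.const_mul _), integral_const_mul, integral_const_mul,
      integral_const_mul, v2, v4, v5]
    ring
  -- the error
  have herr : ∀ᵐ x ∂slotLaw T A π, ‖f (nextQueue x) - f x.1.1 *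
      (1 + ε * ξ x.2 + ε * υ x + ε ^ 2 / 2 * ξ x.2 ^ 2)‖ ≤
      ε ^ 3 * (B ^ 3 * Real.exp B) * ‖f x.1.1‖ +
        ε ^ 2 * (B * S) * (((∑ k, unused x k : ℕ) : ℝ) * ‖f x.1.1‖) := by
    filter_upwards [hnext, hξB, hζB] with x h1 h2 h3
    rw [h1, ← mul_sub, norm_mul]
    refine (mul_le_mul_of_nonneg_left (norm_exp_expansion_le hε.le h.eps_mem.2.le h2 h3 (hυU x))
      (norm_nonneg _)).trans (le_of_eq ?_)
    ring
  have k1 : Integrable (fun x : (Counts n × Counts n) × Counts n =>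
      ε ^ 3 * (B ^ 3 * Real.exp B) * ‖f x.1.1‖) (slotLaw T A π) := i1.norm.const_mul _
  have k2 : Integrable (fun x => ε ^ 2 * (B * S) * (((∑ k, unused x k : ℕ) : ℝ) * ‖f x.1.1‖))
      (slotLaw T A π) := (h.integrable_unused_mul hT hfi.norm).const_mul _
  have hfinal := norm_integral_le_of_norm_le (k1.add k2) herr
  rw [v0, norm_neg, norm_mul, norm_pow, Complex.norm_real, Real.norm_of_nonneg hε.le] at hfinal
  have hsum : ∫ x, ((fun x : (Counts n × Counts n) × Counts n =>
      ε ^ 3 * (B ^ 3 * Real.exp B) * ‖f x.1.1‖) + fun x => ε ^ 2 * (B * S) *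
        (((∑ k, unused x k : ℕ) : ℝ) * ‖f x.1.1‖)) x ∂slotLaw T A π ≤
      ε ^ 2 * (ε * (B ^ 3 * Real.exp B * (1 + 4 * S / η * C) +
        B * S * (n + 4 * S / η * (n * (n + C))))) := by
    simp only [Pi.add_apply]
    rw [integral_add k1 k2, integral_const_mul, integral_const_mul,
      integral_slotLaw_fst (fun q => ‖f q‖)]
    have m1 := h.integral_norm_expQueue_le hn hη hθ hεθ
    have m2 := h.integral_unused_mul_norm_expQueue_le hn hT hη hθ hεθ
    -- The cubic remainder is already of order `ε³`; the remainder with the unused service reaches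
    -- this order through its mean.
    calc _ ≤ ε ^ 3 * (B ^ 3 * Real.exp B) * (1 + 4 * S / η * C) +
          ε ^ 2 * (B * S) * (ε * (n + 4 * S / η * (n * (n + C)))) := by gcongr
      _ = _ := by ring
  have hdiv := le_of_mul_le_mul_left (hfinal.trans hsum) (by positivity)
  rwa [hc, ← neg_mul] at hdiv

end CollapsedState

/-! ### Weak limits of finite measures -/

/-- Weak convergence of a sequence of measures, tested on complex functions. -/
def TendstoWeakly {E : Type*} [TopologicalSpace E] [MeasurableSpace E] (μ : ℕ → Measure E)
    (μ' : Measure E) : Prop :=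
  ∀ F : BoundedContinuousFunction E ℂ,
    Tendsto (fun m => ∫ y, F y ∂μ m) atTop (𝓝 (∫ y, F y ∂μ'))

lemma TendstoWeakly.comp {E : Type*} [TopologicalSpace E] [MeasurableSpace E] {μ : ℕ → Measure E}
    {μ' : Measure E} (h : TendstoWeakly μ μ') {φ : ℕ → ℕ} (hφ : StrictMono φ) :
    TendstoWeakly (μ ∘ φ) μ' :=
  fun F => (h F).comp hφ.tendsto_atTop

lemma TendstoWeakly.tendsto_integral {E : Type*} [TopologicalSpace E] [MeasurableSpace E]
    {μ : ℕ → Measure E} {μ' : Measure E} (h : TendstoWeakly μ μ') {F : E → ℂ} (hF : Continuous F)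
    {C : ℝ} (hC : ∀ y, ‖F y‖ ≤ C) :
    Tendsto (fun m => ∫ y, F y ∂μ m) atTop (𝓝 (∫ y, F y ∂μ')) :=
  h (BoundedContinuousFunction.ofNormedAddCommGroup F hF C hC)

lemma TendstoWeakly.tendsto_integral_real {E : Type*} [TopologicalSpace E] [MeasurableSpace E]
    {μ : ℕ → Measure E} {μ' : Measure E} (h : TendstoWeakly μ μ') {F : E → ℝ} (hF : Continuous F)
    {C : ℝ} (hC : ∀ y, |F y| ≤ C) :
    Tendsto (fun m => ∫ y, F y ∂μ m) atTop (𝓝 (∫ y, F y ∂μ')) := by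
  have := h.tendsto_integral (F := fun y => (F y : ℂ)) (Complex.continuous_ofReal.comp hF)
    (C := C) (fun y => by simpa using hC y)
  simp only [integral_complex_ofReal] at this
  exact (Complex.continuous_re.tendsto _).comp this

/-- If the integrals of a nonnegative bounded continuous function tend to `0`, then it vanishes
almost everywhere for the weak limit. -/
lemma TendstoWeakly.ae_eq_zero {E : Type*} [TopologicalSpace E] [MeasurableSpace E]
    [OpensMeasurableSpace E] {μ : ℕ → Measure E} {μ' : Measure E} [IsFiniteMeasure μ']
    (h : TendstoWeakly μ μ') {F : E → ℝ} (hF : Continuous F) (hF0 : ∀ y, 0 ≤ F y)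
    (hlim : Tendsto (fun m => ∫ y, min (F y) 1 ∂μ m) atTop (𝓝 0)) : ∀ᵐ y ∂μ', F y = 0 := by
  have hc : Continuous fun y => min (F y) 1 := hF.min continuous_const
  have h0 : ∀ y, 0 ≤ min (F y) 1 := fun y => le_min (hF0 y) zero_le_one
  have hb : ∀ y, |min (F y) 1| ≤ 1 := fun y => by
    rw [abs_of_nonneg (h0 y)]; exact min_le_right _ _
  have hinteg := tendsto_nhds_unique (h.tendsto_integral_real hc hb) hlim
  rw [integral_eq_zero_iff_of_nonneg h0 (Integrable.of_bound hc.measurable.aestronglyMeasurable 1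
    (.of_forall hb))] at hinteg
  filter_upwards [hinteg] with y hy
  rcases min_choice (F y) 1 with h1 | h1
  · rw [← h1]; exact hy
  · have : (1 : ℝ) = 0 := h1.symm.trans hy
    exact absurd this one_ne_zero

/-- Prokhorov's theorem for sequences of finite measures. -/
lemma exists_subseq_tendstoWeakly {E : Type*} [TopologicalSpace E]
    [TopologicalSpace.MetrizableSpace E] [TopologicalSpace.SeparableSpace E] [MeasurableSpace E]
    [BorelSpace E] (μ : ℕ → Measure E) {C : ℝ} (hC : ∀ m, μ m Set.univ ≤ ENNReal.ofReal C)
    (h : ∀ δ : ℝ≥0∞, 0 < δ → ∃ K : Set E, IsCompact K ∧ ∀ m, μ m Kᶜ ≤ δ) :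
    ∃ (φ : ℕ → ℕ) (μ' : Measure E), StrictMono φ ∧ IsFiniteMeasure μ' ∧
      TendstoWeakly (μ ∘ φ) μ' := by
  have hfin : ∀ m, IsFiniteMeasure (μ m) := fun m =>
    ⟨(hC m).trans_lt ENNReal.ofReal_lt_top⟩
  set c : ℕ → ℝ := fun m => (μ m).real Set.univ with hc
  have hcmem : ∀ m, c m ∈ Set.Icc 0 (max C 0) := fun m => ⟨measureReal_nonneg, by
    rw [← ENNReal.toReal_ofReal']
    exact ENNReal.toReal_mono ENNReal.ofReal_ne_top (hC m)⟩
  obtain ⟨c', hc', ψ, hψ, hlim⟩ := isCompact_Icc.tendsto_subseq hcmem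
  -- The total masses converge along a subsequence. If they tend to `0`, the zero measure is the
  -- weak limit; otherwise the measures can be normalised and Prokhorov's theorem for probability
  -- measures applies.
  rcases hc'.1.eq_or_lt with h0 | h0
  · refine ⟨ψ, 0, hψ, inferInstance, fun F => ?_⟩
    rw [integral_zero_measure]
    refine squeeze_zero_norm (a := fun m => ‖F‖ * c (ψ m)) (fun m => ?_) ?_
    · exact norm_integral_le_of_norm_le_const (μ := μ (ψ m)) (.of_forall fun y => F.norm_coe_le_norm y)
    · have := hlim.const_mul ‖F‖
      rwa [← h0, mul_zero] at this
  -- Dropping the first `N` terms keeps the masses above `c'/2`, so that normalising preserves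
  -- tightness uniformly.
  · obtain ⟨N, hN⟩ := eventually_atTop.1 (hlim.eventually (lt_mem_nhds (half_lt_self h0)))
    set χ : ℕ → ℕ := fun m => ψ (m + N) with hχ
    have hχm : StrictMono χ := fun a b hab => hψ (by omega)
    have hcχ : ∀ m, c' / 2 < c (χ m) := fun m => hN (m + N) (by omega)
    have hcpos : ∀ m, 0 < c (χ m) := fun m => (half_pos h0).trans (hcχ m)
    have hcE : ∀ m, μ (χ m) Set.univ = ENNReal.ofReal (c (χ m)) := fun m =>
      (ENNReal.ofReal_toReal (measure_ne_top _ _)).symm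
    have hprob : ∀ m, IsProbabilityMeasure (ENNReal.ofReal (c (χ m))⁻¹ • μ (χ m)) := fun m => ⟨by
      rw [Measure.smul_apply, hcE, smul_eq_mul, ← ENNReal.ofReal_mul (inv_nonneg.2 (hcpos m).le),
        inv_mul_cancel₀ (hcpos m).ne', ENNReal.ofReal_one]⟩
    obtain ⟨φ, ρ, hφ, hρ⟩ := exists_subseq_tendsto_of_tight
      (fun m => (⟨_, hprob m⟩ : ProbabilityMeasure E)) (by
        intro δ hδ
        obtain ⟨K, hK, hKμ⟩ := h (ENNReal.ofReal (c' / 2) * δ)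
          (ENNReal.mul_pos (by simpa using h0) hδ.ne')
        refine ⟨K, hK, fun m => ?_⟩
        change (ENNReal.ofReal (c (χ m))⁻¹ • μ (χ m)) Kᶜ ≤ δ
        rw [Measure.smul_apply, smul_eq_mul]
        calc ENNReal.ofReal (c (χ m))⁻¹ * μ (χ m) Kᶜ
            ≤ ENNReal.ofReal (c' / 2)⁻¹ * (ENNReal.ofReal (c' / 2) * δ) := by
              gcongr
              · exact (hcχ m).le
              · exact hKμ _
          _ = δ := by
              rw [← mul_assoc, ← ENNReal.ofReal_mul (by positivity),
                inv_mul_cancel₀ (by positivity), ENNReal.ofReal_one, one_mul])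
    have hρ' := (ProbabilityMeasure.tendsto_iff_forall_integral_rclike_tendsto ℂ).1 hρ
    refine ⟨χ ∘ φ, ENNReal.ofReal c' • (ρ : Measure E), hχm.comp hφ,
      Measure.smul_finite _ ENNReal.ofReal_ne_top, fun F => ?_⟩
    have hlimc : Tendsto (fun m => ((c (χ (φ m)) : ℝ) : ℂ)) atTop (𝓝 (c' : ℂ)) := by
      have h1 : Tendsto (fun m => c (χ (φ m))) atTop (𝓝 c') :=
        hlim.comp ((tendsto_add_atTop_nat N).comp hφ.tendsto_atTop)
      exact (Complex.continuous_ofReal.tendsto _).comp h1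
    have hmul := hlimc.mul (hρ' F)
    rw [integral_smul_measure, ENNReal.toReal_ofReal h0.le, Complex.real_smul]
    refine hmul.congr fun m => ?_
    have hpos := hcpos (φ m)
    change ((c (χ (φ m)) : ℝ) : ℂ) * ∫ y, F y ∂(ENNReal.ofReal (c (χ (φ m)))⁻¹ • μ (χ (φ m))) = _
    rw [integral_smul_measure, ENNReal.toReal_ofReal (inv_nonneg.2 hpos.le), Complex.real_smul,
      ← mul_assoc, ← Complex.ofReal_mul, mul_inv_cancel₀ hpos.ne']
    simp

/-- A common subsequence for finitely many properties. -/
lemma exists_common_subseq {ι : Type*} [Finite ι] {p : ι → (ℕ → ℕ) → Prop}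
    (hsub : ∀ i φ ψ, StrictMono ψ → p i φ → p i (φ ∘ ψ))
    (hex : ∀ i φ, StrictMono φ → ∃ ψ : ℕ → ℕ, StrictMono ψ ∧ p i (φ ∘ ψ)) :
    ∃ φ, StrictMono φ ∧ ∀ i, p i φ := by
  classical
  have := Fintype.ofFinite ι
  suffices h : ∀ s : Finset ι, ∃ φ, StrictMono φ ∧ ∀ i ∈ s, p i φ by
    obtain ⟨φ, hφ, h⟩ := h Finset.univ
    exact ⟨φ, hφ, fun i => h i (Finset.mem_univ i)⟩
  intro s
  induction s using Finset.induction_on with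
  | empty => exact ⟨id, strictMono_id, by simp⟩
  | insert i s _ ih =>
    obtain ⟨φ, hφ, h⟩ := ih
    obtain ⟨ψ, hψ, hi⟩ := hex i φ hφ
    refine ⟨φ ∘ ψ, hφ.comp hψ, fun j hj => ?_⟩
    rcases Finset.mem_insert.1 hj with rfl | hj
    · exact hi
    · exact hsub j φ ψ hψ (h j hj)

/-! ### Scaled laws -/

/-- The law of `ε q`. -/
noncomputable def scaledLaw (π : Measure (Counts n)) (ε : ℝ) : Measure (Pair n → ℝ) :=
  π.map fun q k => ε * (q k : ℝ)

/-- The law of `ε q` weighted by the unused service `u_k / ε`. -/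
noncomputable def unusedLaw (T : Kernel (Counts n) (Counts n)) (A : Pair n → Measure ℕ)
    (π : Measure (Counts n)) (ε : ℝ) (k : Pair n) : Measure (Pair n → ℝ) :=
  ((slotLaw T A π).withDensity fun x => ENNReal.ofReal (ε⁻¹ * unused x k)).map
    fun x k' => ε * (x.1.1 k' : ℝ)

lemma integral_scaledLaw (π : Measure (Counts n)) (ε : ℝ) {E : Type*} [NormedAddCommGroup E]
    [NormedSpace ℝ E] [SecondCountableTopology E] {F : (Pair n → ℝ) → E} (hF : Continuous F) :
    ∫ y, F y ∂scaledLaw π ε = ∫ q, F (ε • realQueue q) ∂π := by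
  rw [scaledLaw, integral_map Measurable.of_discrete.aemeasurable hF.aestronglyMeasurable]
  rfl

lemma integral_unusedLaw (T : Kernel (Counts n) (Counts n)) (A : Pair n → Measure ℕ)
    (π : Measure (Counts n)) {ε : ℝ} (hε : 0 < ε) (k : Pair n) {E : Type*} [NormedAddCommGroup E]
    [NormedSpace ℝ E] [SecondCountableTopology E] {F : (Pair n → ℝ) → E} (hF : Continuous F) :
    ∫ y, F y ∂unusedLaw T A π ε k =
      ε⁻¹ • ∫ x, (unused x k : ℝ) • F (ε • realQueue x.1.1) ∂slotLaw T A π := by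
  rw [unusedLaw, integral_map Measurable.of_discrete.aemeasurable hF.aestronglyMeasurable,
    integral_withDensity_eq_integral_toReal_smul Measurable.of_discrete
      (.of_forall fun _ => ENNReal.ofReal_lt_top), ← integral_smul]
  refine integral_congr_ae (.of_forall fun x => ?_)
  change (ENNReal.ofReal (ε⁻¹ * unused x k)).toReal • F (ε • realQueue x.1.1) = _
  rw [ENNReal.toReal_ofReal (by positivity), mul_smul]

lemma coneDist_smul_le_exp (hn : 0 < n) {ε η : ℝ} (hε : 0 ≤ ε) (hη : 0 < η) (q : Counts n) :
    coneDist (ε • realQueue q) ≤ ε * (2 / η * Real.exp (η / 2 * coneDist (realQueue q))) := by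
  refine (coneDist_smul_le hn _ hε).trans (mul_le_mul_of_nonneg_left ?_ hε)
  have := Real.add_one_le_exp (η / 2 * coneDist (realQueue q))
  calc coneDist (realQueue q) = 2 / η * (η / 2 * coneDist (realQueue q)) := by field_simp
    _ ≤ _ := by gcongr; linarith

/-! ### Truncated exponentials -/

/-- The exponential `e ^ ⟨θ, y⟩` with its modulus truncated at `1`. -/
noncomputable def truncExp (θ : Pair n → ℂ) (y : Pair n → ℝ) : ℂ :=
  Complex.exp (pairing θ y) * ((min 1 (Real.exp (-(pairing θ y).re)) : ℝ) : ℂ)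

lemma continuous_pairing (θ : Pair n → ℂ) : Continuous (pairing θ) := by
  unfold pairing
  fun_prop

lemma continuous_truncExp (θ : Pair n → ℂ) : Continuous (truncExp θ) := by
  have h := continuous_pairing θ
  have h' : Continuous fun y => (pairing θ y).re := Complex.continuous_re.comp h
  unfold truncExp
  fun_prop

lemma norm_truncExp_le (θ : Pair n → ℂ) (y : Pair n → ℝ) : ‖truncExp θ y‖ ≤ 1 := by
  have h0 : 0 ≤ min 1 (Real.exp (-(pairing θ y).re)) := le_min zero_le_one (Real.exp_pos _).le
  rw [truncExp, norm_mul, Complex.norm_exp, Complex.norm_real, Real.norm_of_nonneg h0]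
  calc _ ≤ Real.exp (pairing θ y).re * Real.exp (-(pairing θ y).re) := by
        gcongr; exact min_le_right _ _
    _ = 1 := by rw [← Real.exp_add, add_neg_cancel, Real.exp_zero]

lemma truncExp_eq {θ : Pair n → ℂ} {y : Pair n → ℝ} (h : (pairing θ y).re ≤ 0) :
    truncExp θ y = Complex.exp (pairing θ y) := by
  rw [truncExp, min_eq_left (Real.one_le_exp (by linarith))]
  simp

/-- The truncation acts only where the modulus exceeds `1`, and removes exactly the excess. It is
needed because the exponential is not a bounded test function off the cone; collapse shows that the
excess is negligible. -/
lemma norm_exp_sub_truncExp_le {θ : Pair n → ℂ} {y : Pair n → ℝ} {b : ℝ} (hb : 1 ≤ b)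
    (h : ‖Complex.exp (pairing θ y)‖ ≤ b) :
    ‖Complex.exp (pairing θ y) - truncExp θ y‖ ≤ b - 1 := by
  rcases le_total (pairing θ y).re 0 with h0 | h0
  · rw [truncExp_eq h0, sub_self, norm_zero]
    linarith
  · have h1 : Real.exp (-(pairing θ y).re) ≤ 1 := Real.exp_le_one_iff.2 (by linarith)
    rw [truncExp, min_eq_right h1]
    have e : Complex.exp (pairing θ y) -
        Complex.exp (pairing θ y) * ((Real.exp (-(pairing θ y).re) : ℝ) : ℂ) =
        Complex.exp (pairing θ y) * ((1 - Real.exp (-(pairing θ y).re) : ℝ) : ℂ) := by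
      push_cast; ring
    rw [e, norm_mul, Complex.norm_real, Real.norm_of_nonneg (by linarith), mul_sub, mul_one]
    rw [Complex.norm_exp] at h ⊢
    rw [← Real.exp_add, add_neg_cancel, Real.exp_zero]
    linarith

lemma expQueue_eq_exp_pairing (ε : ℝ) (θ : Pair n → ℂ) (q : Counts n) :
    expQueue ε θ q = Complex.exp (pairing θ (ε • realQueue q)) := by
  rw [expQueue]
  congr 1
  simp only [pairing, realQueue, Finset.mul_sum, Pi.smul_apply, smul_eq_mul]
  exact Finset.sum_congr rfl fun k _ => by push_cast; ring

/-! ### Truncation errors and concentration near the cone and its faces -/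

namespace CollapsedState

variable {ν : Pair n → ℝ} {aMax : ℕ} {T : Kernel (Counts n) (Counts n)} [IsMarkovKernel T]
  {A : Pair n → Measure ℕ} [∀ k, IsProbabilityMeasure (A k)] {π : Measure (Counts n)} {ε η C : ℝ}
  {θ : Pair n → ℂ}

lemma norm_expQueue_sub_truncExp_le (h : CollapsedState ν aMax T A π ε η C) (hn : 0 < n)
    (hη : 0 < η) (hθ : θ ∈ transformDomain n) (hεθ : ε * ∑ k, ‖θ k‖ ≤ η / 4) (q : Counts n) :
    ‖expQueue ε θ q - truncExp θ (ε • realQueue q)‖ ≤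
      ε * (4 * (∑ k, ‖θ k‖) / η * Real.exp (η / 2 * coneDist (realQueue q))) := by
  have h1 := h.norm_expQueue_le_one_add hn hη hθ hεθ q
  have hε := h.eps_mem.1
  rw [expQueue_eq_exp_pairing] at h1 ⊢
  refine (norm_exp_sub_truncExp_le (le_add_of_nonneg_right ?_) h1).trans (by linarith)
  positivity

lemma norm_queueTransform_sub_le (h : CollapsedState ν aMax T A π ε η C) (hn : 0 < n)
    (hη : 0 < η) (hθ : θ ∈ transformDomain n) (hεθ : ε * ∑ k, ‖θ k‖ ≤ η / 4) :
    ‖queueTransform π ε θ - ∫ y, truncExp θ y ∂scaledLaw π ε‖ ≤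
      4 * (∑ k, ‖θ k‖) / η * C * ε := by
  have hprob := h.steady.isProbabilityMeasure
  have hε := h.eps_mem.1
  rw [integral_scaledLaw π ε (continuous_truncExp θ), queueTransform,
    ← integral_sub (h.integrable_expQueue hn hη hθ hεθ)
      (Integrable.of_bound Measurable.of_discrete.aestronglyMeasurable 1
        (.of_forall fun q => norm_truncExp_le _ _))]
  refine (norm_integral_le_of_norm_le (((h.integrable_exp_half hη).const_mul _).const_mul _)
    (.of_forall fun q => h.norm_expQueue_sub_truncExp_le hn hη hθ hεθ q)).trans ?_
  rw [integral_const_mul, integral_const_mul, mul_comm]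
  have := h.integral_exp_half_le hη
  gcongr

lemma unused_le_sum (x : (Counts n × Counts n) × Counts n) (k : Pair n) :
    (unused x k : ℝ) ≤ ((∑ k, unused x k : ℕ) : ℝ) := by
  exact_mod_cast Finset.single_le_sum (f := fun k => unused x k) (fun _ _ => Nat.zero_le _)
    (Finset.mem_univ k)

/-- The factor `ε` in the truncation error offsets the weight `1/ε`. Smallness then comes only from
the decoupling of unused service and deviation, which explains the order `√ε`. -/
lemma norm_unusedTransform_sub_le (h : CollapsedState ν aMax T A π ε η C) (hn : 0 < n)
    (hT : IsMaxWeight T) (hη : 0 < η) (hθ : θ ∈ transformDomain n)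
    (hεθ : ε * ∑ k, ‖θ k‖ ≤ η / 4) (k : Pair n) :
    ‖unusedTransform T A π ε k θ - ∫ y, truncExp θ y ∂unusedLaw T A π ε k‖ ≤
      4 * (∑ k, ‖θ k‖) / η * (n * (n + C)) * Real.sqrt ε := by
  have hprob := h.steady.isProbabilityMeasure
  have hε := h.eps_mem.1
  have hle : ∀ᵐ x ∂slotLaw T A π, (unused x k : ℝ) ≤ n := by
    filter_upwards [h.unused_le hT] with x hx
    exact (unused_le_sum x k).trans (by exact_mod_cast hx)
  have i1 : Integrable (fun x => (unused x k : ℂ) * expQueue ε θ x.1.1) (slotLaw T A π) :=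
    integrable_of_slotLaw_bound (h.integrable_expQueue hn hη hθ hεθ) (C := n) (by
      filter_upwards [hle] with x hx
      rw [norm_mul, Complex.norm_natCast]
      gcongr)
  have i2 : Integrable (fun x => (unused x k : ℂ) * truncExp θ (ε • realQueue x.1.1))
      (slotLaw T A π) :=
    Integrable.of_bound Measurable.of_discrete.aestronglyMeasurable (n * 1) (by
      filter_upwards [hle] with x hx
      rw [norm_mul, Complex.norm_natCast]
      exact mul_le_mul hx (norm_truncExp_le _ _) (norm_nonneg _) (Nat.cast_nonneg _))
  have e : unusedTransform T A π ε k θ - ∫ y, truncExp θ y ∂unusedLaw T A π ε k =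
      ((ε⁻¹ : ℝ) : ℂ) * ∫ x, (unused x k : ℂ) *
        (expQueue ε θ x.1.1 - truncExp θ (ε • realQueue x.1.1)) ∂slotLaw T A π := by
    rw [integral_unusedLaw T A π hε k (continuous_truncExp θ), unusedTransform]
    simp only [Complex.real_smul, Complex.ofReal_natCast, mul_sub]
    rw [integral_sub i1 i2]
    push_cast
    ring
  rw [e, norm_mul, Complex.norm_real, Real.norm_of_nonneg (inv_nonneg.2 hε.le)]
  have h1 := norm_integral_le_of_norm_le
    ((h.integrable_unused_mul hT (h.integrable_exp_half hη)).const_mul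
      (ε * (4 * (∑ k, ‖θ k‖) / η)))
    (f := fun x => (unused x k : ℂ) * (expQueue ε θ x.1.1 - truncExp θ (ε • realQueue x.1.1)))
    (.of_forall fun x => by
      rw [norm_mul, Complex.norm_natCast]
      refine (mul_le_mul (unused_le_sum x k)
        (h.norm_expQueue_sub_truncExp_le hn hη hθ hεθ x.1.1) (norm_nonneg _)
        (Nat.cast_nonneg _)).trans (le_of_eq ?_)
      ring)
  rw [integral_const_mul] at h1
  have h2 := h.integral_unused_mul_exp_half_le hT hη
  calc _ ≤ ε⁻¹ * (ε * (4 * (∑ k, ‖θ k‖) / η) * (n * (n + C) * Real.sqrt ε)) := by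
        refine mul_le_mul_of_nonneg_left (h1.trans ?_) (inv_nonneg.2 hε.le)
        gcongr
    _ = _ := by field_simp

lemma integral_coneDist_scaledLaw_le (h : CollapsedState ν aMax T A π ε η C) (hn : 0 < n)
    (hη : 0 < η) : ∫ y, min (coneDist y) 1 ∂scaledLaw π ε ≤ 2 / η * C * ε := by
  have hprob := h.steady.isProbabilityMeasure
  have hε := h.eps_mem.1
  rw [integral_scaledLaw π ε (continuous_coneDist.min continuous_const)]
  calc _ ≤ ∫ q, ε * (2 / η * Real.exp (η / 2 * coneDist (realQueue q))) ∂π := by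
        refine integral_mono_of_nonneg (.of_forall fun q => le_min (coneDist_nonneg _) zero_le_one)
          (((h.integrable_exp_half hη).const_mul _).const_mul _) (.of_forall fun q => ?_)
        exact (min_le_left _ _).trans (coneDist_smul_le_exp hn hε.le hη q)
    _ ≤ ε * (2 / η * C) := by
        rw [integral_const_mul, integral_const_mul]
        have := h.integral_exp_half_le hη
        gcongr
    _ = _ := by ring

lemma integral_coneDist_unusedLaw_le (h : CollapsedState ν aMax T A π ε η C) (hn : 0 < n)
    (hT : IsMaxWeight T) (hη : 0 < η) (k : Pair n) :
    ∫ y, min (coneDist y) 1 ∂unusedLaw T A π ε k ≤ 2 / η * (n * (n + C)) * Real.sqrt ε := by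
  have hprob := h.steady.isProbabilityMeasure
  have hε := h.eps_mem.1
  rw [integral_unusedLaw T A π hε k (continuous_coneDist.min continuous_const), smul_eq_mul]
  have h2 := h.integral_unused_mul_exp_half_le hT hη
  calc _ ≤ ε⁻¹ * ∫ x, ε * (2 / η) * (((∑ k, unused x k : ℕ) : ℝ) *
          Real.exp (η / 2 * coneDist (realQueue x.1.1))) ∂slotLaw T A π := by
        refine mul_le_mul_of_nonneg_left (integral_mono_of_nonneg
          (.of_forall fun x => mul_nonneg (Nat.cast_nonneg _)
            (le_min (coneDist_nonneg _) zero_le_one))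
          ((h.integrable_unused_mul hT (h.integrable_exp_half hη)).const_mul _)
          (.of_forall fun x => ?_)) (inv_nonneg.2 hε.le)
        simp only [smul_eq_mul]
        refine (mul_le_mul (unused_le_sum x k) ((min_le_left _ _).trans
          (coneDist_smul_le_exp hn hε.le hη x.1.1)) (le_min (coneDist_nonneg _) zero_le_one)
          (Nat.cast_nonneg _)).trans (le_of_eq ?_)
        ring
    _ ≤ ε⁻¹ * (ε * (2 / η) * (n * (n + C) * Real.sqrt ε)) := by
        rw [integral_const_mul]
        gcongr
    _ = _ := by field_simp

lemma integral_abs_unusedLaw (h : CollapsedState ν aMax T A π ε η C) (hT : IsMaxWeight T)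
    (k : Pair n) : ∫ y, min |y k| 1 ∂unusedLaw T A π ε k = 0 := by
  have hprob := h.steady.isProbabilityMeasure
  rw [integral_unusedLaw T A π h.eps_mem.1 k
    (((continuous_apply k).abs).min continuous_const), smul_eq_mul, integral_eq_zero_of_ae,
    mul_zero]
  filter_upwards [ae_slotLaw hT h.bounded] with x hx
  by_cases h0 : unused x k = 0
  · simp [h0]
  · have : x.1.1 k = 0 := queue_eq_zero_of_unused (q := x.1.1) (a := x.2) hx.1 h0
    simp [realQueue, this]

/-! ### Tightness -/

lemma measure_sum_gt_le (h : CollapsedState ν aMax T A π ε η C) {R : ℝ} (hR : 0 < R) :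
    π {q | R < ε * ∑ k, (q k : ℝ)} ≤ ENNReal.ofReal (C / R) := by
  have h1 := (mul_meas_ge_le_lintegral (μ := π)
    (f := fun q : Counts n => ENNReal.ofReal (ε * ∑ k, (q k : ℝ))) Measurable.of_discrete
    (ENNReal.ofReal R)).trans h.lintegral_sum_le
  have hR' : ENNReal.ofReal R ≠ 0 := by simpa using hR
  rw [ENNReal.ofReal_div_of_pos hR, ENNReal.le_div_iff_mul_le (.inl hR')
    (.inl ENNReal.ofReal_ne_top), mul_comm]
  refine le_trans ?_ h1
  exact mul_le_mul_right (measure_mono fun q hq => ENNReal.ofReal_le_ofReal (le_of_lt hq)) _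

lemma norm_smul_realQueue_le (hε : 0 ≤ ε) (q : Counts n) :
    ‖ε • realQueue q‖ ≤ ε * ∑ k, (q k : ℝ) := by
  rw [norm_smul, Real.norm_of_nonneg hε]
  refine mul_le_mul_of_nonneg_left ?_ hε
  rw [pi_norm_le_iff_of_nonneg (Finset.sum_nonneg fun _ _ => Nat.cast_nonneg _)]
  intro k
  simp only [realQueue, Real.norm_natCast]
  exact Finset.single_le_sum (f := fun k => (q k : ℝ)) (fun _ _ => Nat.cast_nonneg _)
    (Finset.mem_univ k)

lemma scaledLaw_compl_closedBall_le (h : CollapsedState ν aMax T A π ε η C) {R : ℝ} (hR : 0 < R) :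
    scaledLaw π ε (Metric.closedBall 0 R)ᶜ ≤ ENNReal.ofReal (C / R) := by
  rw [scaledLaw, Measure.map_apply Measurable.of_discrete
    Metric.isClosed_closedBall.measurableSet.compl]
  refine (measure_mono fun q hq => ?_).trans (h.measure_sum_gt_le hR)
  have h1 : R < ‖ε • realQueue q‖ := by
    have : ¬ (ε • realQueue q) ∈ Metric.closedBall 0 R := hq
    rwa [mem_closedBall_zero_iff, not_le] at this
  exact h1.trans_le (norm_smul_realQueue_le h.eps_mem.1.le q)

lemma unusedLaw_compl_closedBall_le (h : CollapsedState ν aMax T A π ε η C) {R : ℝ} (hR : 0 < R)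
    (k : Pair n) :
    unusedLaw T A π ε k (Metric.closedBall 0 R)ᶜ ≤ n * ENNReal.ofReal (C / R) := by
  have hε := h.eps_mem.1
  -- The least integer exceeding `R/ε`, so that the integer tail bound for the unused service covers
  -- exactly the event `εq` has total above `R`. Its factor `nε` cancels the weight `1/ε`.
  set N : ℕ := ⌊R / ε⌋₊ + 1 with hN
  have hNiff : ∀ q : Counts n, N ≤ ∑ k, q k ↔ R < ε * ∑ k, (q k : ℝ) := by
    intro q
    rw [hN, Nat.succ_le_iff, Nat.floor_lt (by positivity), div_lt_iff₀ hε, mul_comm]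
    push_cast
    rfl
  rw [unusedLaw, Measure.map_apply Measurable.of_discrete
    Metric.isClosed_closedBall.measurableSet.compl, withDensity_apply _ MeasurableSet.of_discrete,
    ← lintegral_indicator MeasurableSet.of_discrete]
  have hpt : ∀ x : (Counts n × Counts n) × Counts n,
      ((fun (x : (Counts n × Counts n) × Counts n) k' => ε * (x.1.1 k' : ℝ)) ⁻¹'
        (Metric.closedBall 0 R)ᶜ).indicator
        (fun x => ENNReal.ofReal (ε⁻¹ * unused x k)) x ≤
      ENNReal.ofReal ε⁻¹ *
        (if N ≤ ∑ k, x.1.1 k then ((∑ k, unused x k : ℕ) : ℝ≥0∞) else 0) := by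
    intro x
    by_cases hx : x ∈ (fun (x : (Counts n × Counts n) × Counts n) k' => ε * (x.1.1 k' : ℝ)) ⁻¹'
      (Metric.closedBall 0 R)ᶜ
    swap
    · rw [Set.indicator_of_notMem hx]
      exact zero_le
    rw [Set.indicator_of_mem hx]
    have h1 : R < ‖ε • realQueue x.1.1‖ := by
      have : ¬ (ε • realQueue x.1.1) ∈ Metric.closedBall 0 R := hx
      rwa [mem_closedBall_zero_iff, not_le] at this
    rw [if_pos ((hNiff _).2 (h1.trans_le (norm_smul_realQueue_le hε.le _))),
      ENNReal.ofReal_mul (inv_nonneg.2 hε.le), ENNReal.ofReal_natCast]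
    gcongr
    exact_mod_cast unused_le_sum x k
  refine (lintegral_mono hpt).trans ?_
  rw [lintegral_const_mul _ Measurable.of_discrete]
  have hset : {q : Counts n | N ≤ ∑ k, q k} = {q | R < ε * ∑ k, (q k : ℝ)} := by
    ext q
    exact hNiff q
  calc _ ≤ ENNReal.ofReal ε⁻¹ * (ENNReal.ofReal (n * ε) * ENNReal.ofReal (C / R)) := by
        gcongr
        refine (h.lintegral_unused_tail_le N).trans ?_
        rw [hset]
        gcongr
        exact h.measure_sum_gt_le hR
    _ = n * ENNReal.ofReal (C / R) := by
        rw [← mul_assoc, ← ENNReal.ofReal_mul (inv_nonneg.2 hε.le),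
          show ε⁻¹ * (n * ε) = n by field_simp, ENNReal.ofReal_natCast]

lemma unusedLaw_univ_le (h : CollapsedState ν aMax T A π ε η C) (k : Pair n) :
    unusedLaw T A π ε k Set.univ ≤ ENNReal.ofReal n := by
  have hprob := h.steady.isProbabilityMeasure
  have hε := h.eps_mem.1
  rw [unusedLaw, Measure.map_apply Measurable.of_discrete MeasurableSet.univ, Set.preimage_univ,
    withDensity_apply _ MeasurableSet.univ, Measure.restrict_univ]
  calc _ ≤ ∫⁻ x, ENNReal.ofReal ε⁻¹ * (if 0 ≤ ∑ k, x.1.1 k then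
          ((∑ k, unused x k : ℕ) : ℝ≥0∞) else 0) ∂slotLaw T A π := by
        refine lintegral_mono fun x => ?_
        simp only [Nat.zero_le, if_true]
        rw [ENNReal.ofReal_mul (inv_nonneg.2 hε.le), ENNReal.ofReal_natCast]
        gcongr
        exact_mod_cast unused_le_sum x k
    _ ≤ ENNReal.ofReal ε⁻¹ * (ENNReal.ofReal (n * ε) * 1) := by
        rw [lintegral_const_mul _ Measurable.of_discrete]
        gcongr
        refine (h.lintegral_unused_tail_le 0).trans ?_
        gcongr
        exact prob_le_one
    _ = ENNReal.ofReal n := by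
        rw [mul_one, ← ENNReal.ofReal_mul (inv_nonneg.2 hε.le),
          show ε⁻¹ * (n * ε) = n by field_simp]

end CollapsedState

/-! ### Heavy traffic -/

section HeavyTraffic

variable {ν : Pair n → ℝ} {aMax : ℕ} {v : Pair n → ℝ} {T : Kernel (Counts n) (Counts n)}
  [IsMarkovKernel T] {A : ℝ → Pair n → Measure ℕ} [∀ ε k, IsProbabilityMeasure (A ε k)]
  {π : ℝ → Measure (Counts n)}

/-- All bounds hold with the same `η` and `C` for every small `ε`, because the constants depend only
on `n`, `ν` and `aMax`. -/
lemma exists_eventually_collapsedState (hn : 0 < n) (hν : ν ∈ saturatedRates n)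
    (hν_pos : ∀ k, 0 < ν k) (hA : IsHeavyTraffic ν aMax v A) (hT : IsMaxWeight T)
    (hπ : ∀ ε ∈ Set.Ioo (0 : ℝ) 1, IsSteadyState T (A ε) (π ε)) :
    ∃ η > 0, ∃ C, 0 ≤ C ∧
      ∀ᶠ ε in 𝓝[>] (0 : ℝ), CollapsedState ν aMax T (A ε) (π ε) ε η C := by
  obtain ⟨δ, hδ, hνδ⟩ := exists_rate_lower_bound hν_pos
  obtain ⟨η, hη, C, ε₀, hε₀, h⟩ := exists_lintegral_exp_coneDist_le hn hν hν_pos aMax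
  set D : ℝ := n ^ 2 * ((aMax : ℝ) + 1) ^ 2 / (2 * δ) with hD
  have hD0 : 0 ≤ D := by positivity
  refine ⟨η, hη, max C D, hD0.trans (le_max_right _ _), ?_⟩
  filter_upwards [Ioo_mem_nhdsGT (lt_min hε₀ one_pos)] with ε hε
  have hε1 : ε ∈ Set.Ioo (0 : ℝ) 1 := ⟨hε.1, hε.2.trans_le (min_le_right _ _)⟩
  have hs := hπ ε hε1
  have hprob := hs.isProbabilityMeasure
  have hb := hA.bounded ε hε1
  have hm := hA.mean ε hε1
  have hexp := h T (A ε) (π ε) ε hT hb hε.1.le (hε.2.trans_le (min_le_left _ _)).le hm hs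
  have hsum := hs.lintegral_sum_le hT hb hν hε.1 hm hδ hνδ
  have htail := hs.lintegral_unused_le hT hb hν hε1 hm (hsum.trans_lt ENNReal.ofReal_lt_top).ne
  have hpos : ∀ q : Counts n, 0 ≤ Real.exp (η * coneDist (realQueue q)) :=
    fun q => (Real.exp_pos _).le
  refine ⟨hs, hε1, hb, hm, ⟨Measurable.of_discrete.aestronglyMeasurable, ?_⟩, ?_, ?_,
    hsum.trans (ENNReal.ofReal_le_ofReal (le_max_right _ _)), htail⟩
  · rw [hasFiniteIntegral_iff_ofReal (.of_forall hpos)]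
    exact hexp.trans_lt ENNReal.ofReal_lt_top
  · rw [integral_eq_lintegral_of_nonneg_ae (.of_forall hpos)
      Measurable.of_discrete.aestronglyMeasurable]
    refine (ENNReal.toReal_mono ENNReal.ofReal_ne_top hexp).trans ?_
    rw [ENNReal.toReal_ofReal', max_le_iff]
    exact ⟨le_max_left _ _, hD0.trans (le_max_right _ _)⟩
  · rw [integral_eq_lintegral_of_nonneg_ae (.of_forall fun _ => Nat.cast_nonneg _)
      Measurable.of_discrete.aestronglyMeasurable]
    -- At level `0` the tail bound is the bound `nε` for the mean total unused service.
    have h0 := htail 0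
    simp only [zero_le, if_true] at h0
    simp only [ENNReal.ofReal_natCast]
    refine (ENNReal.toReal_mono ?_ (h0.trans (mul_le_mul_right prob_le_one _))).trans ?_
    · exact (ENNReal.mul_lt_top ENNReal.ofReal_lt_top ENNReal.one_lt_top).ne
    · rw [mul_one, ENNReal.toReal_ofReal (by have := hε.1.le; positivity)]

lemma eventually_mul_le {S η : ℝ} (hη : 0 < η) : ∀ᶠ ε in 𝓝[>] (0 : ℝ), ε * S ≤ η / 4 := by
  have h : Tendsto (fun ε : ℝ => ε * S) (𝓝[>] 0) (𝓝 (0 * S)) :=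
    (tendsto_id.mono_left nhdsWithin_le_nhds).mul_const S
  rw [zero_mul] at h
  exact (h.eventually (gt_mem_nhds (by positivity : 0 < η / 4))).mono fun ε h => le_of_lt h

lemma CollapsedState.norm_queueTransform_le {A : Pair n → Measure ℕ}
    [∀ k, IsProbabilityMeasure (A k)] {π : Measure (Counts n)} {ε η C : ℝ} {θ : Pair n → ℂ}
    (h : CollapsedState ν aMax T A π ε η C) (hn : 0 < n) (hη : 0 < η)
    (hθ : θ ∈ transformDomain n) (hεθ : ε * ∑ k, ‖θ k‖ ≤ η / 4) :
    ‖queueTransform π ε θ‖ ≤ 1 + 4 * (∑ k, ‖θ k‖) / η * C :=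
  (norm_integral_le_integral_norm _).trans (h.integral_norm_expQueue_le hn hη hθ hεθ)

lemma CollapsedState.norm_unusedTransform_le {A : Pair n → Measure ℕ}
    [∀ k, IsProbabilityMeasure (A k)] {π : Measure (Counts n)} {ε η C : ℝ} {θ : Pair n → ℂ}
    (h : CollapsedState ν aMax T A π ε η C) (hn : 0 < n) (hT : IsMaxWeight T) (hη : 0 < η)
    (hθ : θ ∈ transformDomain n) (hεθ : ε * ∑ k, ‖θ k‖ ≤ η / 4) (k : Pair n) :
    ‖unusedTransform T A π ε k θ‖ ≤ n + 4 * (∑ k, ‖θ k‖) / η * (n * (n + C)) := by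
  have hprob := h.steady.isProbabilityMeasure
  have hε := h.eps_mem.1
  have h1 := norm_integral_le_of_norm_le
    (h.integrable_unused_mul hT (h.integrable_expQueue hn hη hθ hεθ).norm)
    (f := fun x => (unused x k : ℂ) * expQueue ε θ x.1.1) (.of_forall fun x => by
      rw [norm_mul, Complex.norm_natCast]
      exact mul_le_mul_of_nonneg_right (unused_le_sum x k) (norm_nonneg _))
  rw [unusedTransform, norm_mul, norm_div, norm_one, Complex.norm_real, Real.norm_of_nonneg hε.le]
  calc _ ≤ 1 / ε * (ε * (n + 4 * (∑ k, ‖θ k‖) / η * (n * (n + C)))) := by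
        have := h1.trans (h.integral_unused_mul_norm_expQueue_le hn hT hη hθ hεθ)
        gcongr
    _ = _ := by field_simp

lemma exists_eventually_transform_le (hn : 0 < n) (hν : ν ∈ saturatedRates n)
    (hν_pos : ∀ k, 0 < ν k) (hA : IsHeavyTraffic ν aMax v A) (hT : IsMaxWeight T)
    (hπ : ∀ ε ∈ Set.Ioo (0 : ℝ) 1, IsSteadyState T (A ε) (π ε)) {θ : Pair n → ℂ}
    (hθ : θ ∈ transformDomain n) :
    ∃ C : ℝ, ∀ᶠ ε in 𝓝[>] (0 : ℝ),
      Integrable (expQueue ε θ) (π ε) ∧ ‖queueTransform (π ε) ε θ‖ ≤ C ∧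
      ∀ k, ‖unusedTransform T (A ε) (π ε) ε k θ‖ ≤ C := by
  obtain ⟨η, hη, C, -, h⟩ := exists_eventually_collapsedState hn hν hν_pos hA hT hπ
  refine ⟨max (1 + 4 * (∑ k, ‖θ k‖) / η * C) (n + 4 * (∑ k, ‖θ k‖) / η * (n * (n + C))), ?_⟩
  filter_upwards [h, eventually_mul_le (S := ∑ k, ‖θ k‖) hη] with ε h hεθ
  exact ⟨h.integrable_expQueue hn hη hθ hεθ,
    (h.norm_queueTransform_le hn hη hθ hεθ).trans (le_max_left _ _),
    fun k => (h.norm_unusedTransform_le hn hT hη hθ hεθ k).trans (le_max_right _ _)⟩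

/-- In the limit the error of order `ε` and the square of the mean drift `-εc` vanish. A general
filter `l` covers both the limit `ε → 0` and limits along sequences. -/
lemma functionalEq_of_tendsto (hn : 0 < n) (hν : ν ∈ saturatedRates n)
    (hν_pos : ∀ k, 0 < ν k) (hA : IsHeavyTraffic ν aMax v A) (hT : IsMaxWeight T)
    (hπ : ∀ ε ∈ Set.Ioo (0 : ℝ) 1, IsSteadyState T (A ε) (π ε)) {θ : Pair n → ℂ}
    (hθ : θ ∈ transformDomain n) {l : Filter ℝ} [l.NeBot] (hl : l ≤ 𝓝[>] (0 : ℝ)) {L : ℂ}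
    {M : Pair n → ℂ} (hL : Tendsto (fun ε => queueTransform (π ε) ε θ) l (𝓝 L))
    (hM : ∀ k, Tendsto (fun ε => unusedTransform T (A ε) (π ε) ε k θ) l (𝓝 (M k))) :
    FunctionalEq v θ L M := by
  obtain ⟨η, hη, C, -, h⟩ := exists_eventually_collapsedState hn hν hν_pos hA hT hπ
  have hid : Tendsto (fun ε : ℝ => ε) l (𝓝 0) := hl.trans nhdsWithin_le_nhds
  have hidC : Tendsto (fun ε : ℝ => (ε : ℂ)) l (𝓝 0) := by
    rw [← Complex.ofReal_zero]
    exact (Complex.continuous_ofReal.tendsto 0).comp hid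
  have hv : Tendsto (fun ε => ∑ k, (variance (fun m : ℕ => (m : ℝ)) (A ε k) : ℂ) * θ k ^ 2) l
      (𝓝 (∑ k, (v k : ℂ) * θ k ^ 2)) :=
    tendsto_finsetSum _ fun k _ => ((Complex.continuous_ofReal.tendsto _).comp
      ((hA.tendsto_variance k).mono_left hl)).mul_const _
  have hlim := ((((hv.add ((hidC.neg.mul_const (1 / (n : ℂ) * ∑ k, θ k)).pow 2)).const_mul
    (1 / 2)).const_add (-(1 / (n : ℂ)) * ∑ k, θ k)).mul hL).add
    (tendsto_finsetSum Finset.univ fun k _ => (hM k).const_mul (θ k))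
  set B : ℝ := (aMax + 1) * ∑ k, ‖θ k‖ with hB
  set K : ℝ := B ^ 3 * Real.exp B * (1 + 4 * (∑ k, ‖θ k‖) / η * C) +
      B * (∑ k, ‖θ k‖) * (n + 4 * (∑ k, ‖θ k‖) / η * (n * (n + C))) with hK
  have hz : Tendsto (fun ε : ℝ => ε * K) l (𝓝 0) := by simpa using hid.mul_const K
  have h0 := squeeze_zero_norm' (((h.filter_mono hl).and ((eventually_mul_le hη).filter_mono hl)).mono fun ε hε =>
    hε.1.norm_functional_le hn hT hν hη hθ hε.2 hB) hz
  have e := tendsto_nhds_unique hlim h0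
  rw [FunctionalEq]
  simp only [neg_zero, zero_mul, ne_eq, OfNat.ofNat_ne_zero, not_false_eq_true, zero_pow,
    add_zero] at e
  exact eq_neg_of_add_eq_zero_left e

end HeavyTraffic

/-! ### Subsequential limits -/

section Subsequence

variable {ν : Pair n → ℝ} {aMax : ℕ} {v : Pair n → ℝ} {T : Kernel (Counts n) (Counts n)}
  [IsMarkovKernel T] {A : ℝ → Pair n → Measure ℕ} [∀ ε k, IsProbabilityMeasure (A ε k)]
  {π : ℝ → Measure (Counts n)}

lemma integral_truncExp_eq {θ : Pair n → ℂ} (hθ : θ ∈ transformDomain n)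
    {μ : Measure (Pair n → ℝ)} (hμ : ∀ᵐ y ∂μ, y ∈ collapseCone n) :
    ∫ y, truncExp θ y ∂μ = ∫ y, Complex.exp (pairing θ y) ∂μ :=
  integral_congr_ae (hμ.mono fun _ hy => truncExp_eq (re_pairing_nonpos hθ hy))

lemma exists_closedBall_bound {C : ℝ} (hC : 0 ≤ C) {δ : ℝ≥0∞} (hδ : 0 < δ) :
    ∃ R : ℝ, 0 < R ∧ ENNReal.ofReal (C / R) ≤ δ := by
  rcases eq_or_ne δ ∞ with rfl | hδ'
  · exact ⟨1, one_pos, le_top⟩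
  have h0 : 0 < δ.toReal := ENNReal.toReal_pos hδ.ne' hδ'
  refine ⟨C / δ.toReal + 1, by positivity, ENNReal.ofReal_le_of_le_toReal ?_⟩
  rw [div_le_iff₀ (by positivity)]
  have : δ.toReal * (C / δ.toReal + 1) = C + δ.toReal := by field_simp
  linarith

/-- Along a subsequence the laws of `ε q` and the weighted laws converge weakly. -/
lemma exists_subseq_tendstoWeakly_laws {e : ℕ → ℝ} {η C : ℝ} (hC : 0 ≤ C)
    (h : ∀ m, CollapsedState ν aMax T (A (e m)) (π (e m)) (e m) η C) :
    ∃ (φ : ℕ → ℕ) (μ : Measure (Pair n → ℝ)) (μ' : Pair n → Measure (Pair n → ℝ)),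
      StrictMono φ ∧ IsFiniteMeasure μ ∧ (∀ k, IsFiniteMeasure (μ' k)) ∧
      TendstoWeakly (fun m => scaledLaw (π (e (φ m))) (e (φ m))) μ ∧
      ∀ k, TendstoWeakly
        (fun m => unusedLaw T (A (e (φ m))) (π (e (φ m))) (e (φ m)) k) (μ' k) := by
  -- `none` stands for the law of `εq` and `some k` for the weighted law at `k`, so that one
  -- extraction yields a subsequence common to all of them.
  set ρ : Option (Pair n) → ℕ → Measure (Pair n → ℝ) := fun i m =>
    i.elim (scaledLaw (π (e m)) (e m)) (unusedLaw T (A (e m)) (π (e m)) (e m)) with hρ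
  have hmass : ∀ i m, ρ i m Set.univ ≤ ENNReal.ofReal (n + 1) := by
    intro i m
    have hprob := (h m).steady.isProbabilityMeasure
    cases i with
    | none =>
      change scaledLaw (π (e m)) (e m) Set.univ ≤ _
      rw [scaledLaw, Measure.map_apply Measurable.of_discrete MeasurableSet.univ, Set.preimage_univ,
        measure_univ, ← ENNReal.ofReal_one]
      exact ENNReal.ofReal_le_ofReal (by simp)
    | some k => exact ((h m).unusedLaw_univ_le k).trans (ENNReal.ofReal_le_ofReal (by simp))
  have htight : ∀ i, ∀ δ : ℝ≥0∞, 0 < δ → ∃ K : Set (Pair n → ℝ), IsCompact K ∧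
      ∀ m, ρ i m Kᶜ ≤ δ := by
    intro i δ hδ
    obtain ⟨R, hR, hle⟩ := exists_closedBall_bound (C := (n + 1) * C) (by positivity) hδ
    refine ⟨Metric.closedBall 0 R, isCompact_closedBall _ _, fun m => le_trans ?_ hle⟩
    have hCR : 0 ≤ C / R := by positivity
    cases i with
    | none =>
      refine ((h m).scaledLaw_compl_closedBall_le hR).trans (ENNReal.ofReal_le_ofReal ?_)
      rw [mul_div_assoc]
      exact le_mul_of_one_le_left hCR (by simp)
    | some k =>
      refine ((h m).unusedLaw_compl_closedBall_le hR k).trans ?_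
      rw [← ENNReal.ofReal_natCast, ← ENNReal.ofReal_mul (Nat.cast_nonneg _), mul_div_assoc]
      exact ENNReal.ofReal_le_ofReal (mul_le_mul_of_nonneg_right (by simp) hCR)
  obtain ⟨φ, hφ, hlim⟩ := exists_common_subseq
    (p := fun i φ => ∃ μ, IsFiniteMeasure μ ∧ TendstoWeakly (ρ i ∘ φ) μ)
    (fun i φ ψ hψ ⟨μ, hμ, hlim⟩ => ⟨μ, hμ, hlim.comp hψ⟩)
    (fun i φ _ => by
      obtain ⟨ψ, μ, hψ, hμ, hlim⟩ := exists_subseq_tendstoWeakly (ρ i ∘ φ)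
        (fun m => hmass i (φ m)) (fun δ hδ => by
          obtain ⟨K, hK, hle⟩ := htight i δ hδ
          exact ⟨K, hK, fun m => hle (φ m)⟩)
      exact ⟨ψ, hψ, μ, hμ, hlim⟩)
  choose μ hμ hlim using hlim
  exact ⟨φ, μ none, fun k => μ (some k), hφ, hμ none, fun k => hμ _, hlim none, fun k => hlim _⟩

/-- Weak limits of the laws are tested on truncated exponentials, which differ negligibly from the
true ones before the limit and agree with them on the cone. One subsequence therefore serves all `θ`
simultaneously. -/
lemma exists_subseq_limit (hn : 0 < n) (hν : ν ∈ saturatedRates n)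
    (hν_pos : ∀ k, 0 < ν k) (hA : IsHeavyTraffic ν aMax v A) (hT : IsMaxWeight T)
    (hπ : ∀ ε ∈ Set.Ioo (0 : ℝ) 1, IsSteadyState T (A ε) (π ε)) {e : ℕ → ℝ}
    (he : Tendsto e atTop (𝓝[>] (0 : ℝ))) :
    ∃ (φ : ℕ → ℕ) (μ : Measure (Pair n → ℝ)) (L : transformDomain n → ℂ)
      (M : Pair n → transformDomain n → ℂ), StrictMono φ ∧ IsProbabilityMeasure μ ∧
      (∀ᵐ y ∂μ, y ∈ collapseCone n) ∧ IsLaplaceTransform μ L ∧ IsTransformSolution v L M ∧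
      TendstoWeakly (fun m => scaledLaw (π (e (φ m))) (e (φ m))) μ ∧ ∀ θ : transformDomain n,
        Tendsto (fun m => queueTransform (π (e (φ m))) (e (φ m)) θ) atTop (𝓝 (L θ)) ∧
        ∀ k, Tendsto (fun m => unusedTransform T (A (e (φ m))) (π (e (φ m))) (e (φ m)) k θ) atTop
          (𝓝 (M k θ)) := by
  obtain ⟨η, hη, C, hC, hcs⟩ := exists_eventually_collapsedState hn hν hν_pos hA hT hπ
  obtain ⟨N, hN⟩ := eventually_atTop.1 (he.eventually hcs)
  obtain ⟨ψ, μ, μ', hψ, hμ, hμ', hlim, hlim'⟩ := exists_subseq_tendstoWeakly_laws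
    (e := fun m => e (m + N)) hC fun m => hN (m + N) (Nat.le_add_left _ _)
  set φ : ℕ → ℕ := fun m => ψ m + N with hφdef
  have hφ : StrictMono φ := hψ.add_const N
  have hst : ∀ m, CollapsedState ν aMax T (A (e (φ m))) (π (e (φ m))) (e (φ m)) η C :=
    fun m => hN _ (Nat.le_add_left _ _)
  have heφ : Tendsto (fun m => e (φ m)) atTop (𝓝[>] (0 : ℝ)) := he.comp hφ.tendsto_atTop
  have he0 : Tendsto (fun m => e (φ m)) atTop (𝓝 0) := heφ.mono_right nhdsWithin_le_nhds
  have hsqrt : Tendsto (fun m => Real.sqrt (e (φ m))) atTop (𝓝 0) := by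
    rw [← Real.sqrt_zero]
    exact (Real.continuous_sqrt.tendsto 0).comp he0
  have hprob : ∀ m, IsProbabilityMeasure (π (e (φ m))) :=
    fun m => (hst m).steady.isProbabilityMeasure
  have hμ1 : IsProbabilityMeasure μ := by
    have h1 := hlim.tendsto_integral_real (F := fun _ => (1 : ℝ)) continuous_const (C := 1)
      (fun _ => by simp)
    have h2 : ∀ m, ∫ _, (1 : ℝ) ∂scaledLaw (π (e (φ m))) (e (φ m)) = 1 := fun m => by
      rw [integral_scaledLaw _ _ continuous_const]
      simp
    have h3 := tendsto_nhds_unique (h1.congr h2) tendsto_const_nhds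
    simp only [integral_const, smul_eq_mul, mul_one] at h3
    exact ⟨by rw [← ENNReal.toReal_eq_one_iff]; exact h3⟩
  have hcone : ∀ᵐ y ∂μ, y ∈ collapseCone n := by
    refine (hlim.ae_eq_zero continuous_coneDist coneDist_nonneg (squeeze_zero (fun m =>
      integral_nonneg fun y => le_min (coneDist_nonneg y) zero_le_one)
      (fun m => (hst m).integral_coneDist_scaledLaw_le hn hη) ?_)).mono
      fun y hy => (coneDist_eq_zero_iff hn).1 hy
    simpa using he0.const_mul (2 / η * C)
  have hface : ∀ k, ∀ᵐ y ∂μ' k, y ∈ coneFace k := by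
    intro k
    have h1 := (hlim' k).ae_eq_zero continuous_coneDist coneDist_nonneg (squeeze_zero (fun m =>
      integral_nonneg fun y => le_min (coneDist_nonneg y) zero_le_one)
      (fun m => (hst m).integral_coneDist_unusedLaw_le hn hT hη k)
      (by simpa using hsqrt.const_mul (2 / η * (n * (n + C)))))
    have h2 := (hlim' k).ae_eq_zero (F := fun y => |y k|) (continuous_apply k).abs
      (fun y => abs_nonneg _)
      (tendsto_const_nhds.congr fun m => ((hst m).integral_abs_unusedLaw hT k).symm)
    filter_upwards [h1, h2] with y hy1 hy2
    exact ⟨(coneDist_eq_zero_iff hn).1 hy1, abs_eq_zero.1 hy2⟩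
  have hsmall : ∀ θ : Pair n → ℂ, ∀ᶠ m in atTop, e (φ m) * ∑ k, ‖θ k‖ ≤ η / 4 :=
    fun θ => heφ.eventually (eventually_mul_le hη)
  have hLlim : ∀ θ ∈ transformDomain n, Tendsto
      (fun m => queueTransform (π (e (φ m))) (e (φ m)) θ) atTop
      (𝓝 (∫ y, Complex.exp (pairing θ y) ∂μ)) := by
    intro θ hθ
    rw [← integral_truncExp_eq hθ hcone]
    have h1 := hlim.tendsto_integral (continuous_truncExp θ) (norm_truncExp_le θ)
    have h2 := squeeze_zero_norm' ((hsmall θ).mono fun m hm =>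
      (hst m).norm_queueTransform_sub_le hn hη hθ hm)
      (by simpa using he0.const_mul (4 * (∑ k, ‖θ k‖) / η * C))
    have h3 := h2.add h1
    rw [zero_add] at h3
    exact h3.congr fun m => sub_add_cancel _ _
  have hMlim : ∀ θ ∈ transformDomain n, ∀ k, Tendsto
      (fun m => unusedTransform T (A (e (φ m))) (π (e (φ m))) (e (φ m)) k θ) atTop
      (𝓝 (∫ y, Complex.exp (pairing θ y) ∂μ' k)) := by
    intro θ hθ k
    rw [← integral_truncExp_eq hθ ((hface k).mono fun y hy => hy.1)]
    have h1 := (hlim' k).tendsto_integral (continuous_truncExp θ) (norm_truncExp_le θ)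
    have h2 := squeeze_zero_norm' ((hsmall θ).mono fun m hm =>
      (hst m).norm_unusedTransform_sub_le hn hT hη hθ hm k)
      (by simpa using hsqrt.const_mul (4 * (∑ k, ‖θ k‖) / η * (n * (n + C))))
    have h3 := h2.add h1
    rw [zero_add] at h3
    exact h3.congr fun m => sub_add_cancel _ _
  refine ⟨φ, μ, fun θ => ∫ y, Complex.exp (pairing θ.1 y) ∂μ,
    fun k θ => ∫ y, Complex.exp (pairing θ.1 y) ∂μ' k, hφ, hμ1, hcone, fun _ => rfl,
    ⟨⟨μ, hμ1, hcone, fun _ => rfl⟩, fun k => ⟨μ' k, hμ' k, hface k, fun _ => rfl⟩, fun θ => ?_⟩,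
    hlim, fun θ => ⟨hLlim θ.1 θ.2, hMlim θ.1 θ.2⟩⟩
  exact functionalEq_of_tendsto hn hν hν_pos hA hT hπ θ.2 (l := map (fun m => e (φ m)) atTop) heφ
    (tendsto_map'_iff.2 (hLlim θ.1 θ.2)) fun k => tendsto_map'_iff.2 (hMlim θ.1 θ.2 k)

end Subsequence

/-! ### Independent exponential variables and their minimum -/

lemma integral_expMeasure {r : ℝ} (hr : 0 < r) (f : ℝ → ℂ) :
    ∫ x, f x ∂expMeasure r = ∫ x in Set.Ioi (0 : ℝ), (r * Complex.exp (-(r : ℂ) * (x : ℂ))) * f x := by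
  have h : expMeasure r = volume.withDensity (exponentialPDF r) := rfl
  rw [h, integral_withDensity_eq_integral_toReal_smul
    (f := exponentialPDF r) (measurable_exponentialPDFReal r).ennreal_ofReal (.of_forall fun _ => ENNReal.ofReal_lt_top),
    ← integral_Ici_eq_integral_Ioi, ← integral_indicator measurableSet_Ici]
  refine integral_congr_ae (.of_forall fun x => ?_)
  simp only [exponentialPDF_eq]
  by_cases hx : 0 ≤ x
  · rw [Set.indicator_of_mem (Set.mem_Ici.2 hx), if_pos hx, ENNReal.toReal_ofReal (by positivity),
      Complex.real_smul]
    push_cast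
    rw [neg_mul]
  · rw [Set.indicator_of_notMem (by simpa using hx), if_neg hx]
    simp

lemma ae_pos_expMeasure (r : ℝ) : ∀ᵐ x ∂expMeasure r, 0 < x := by
  have h : expMeasure r = volume.withDensity (exponentialPDF r) := rfl
  have hm : Measurable (exponentialPDF r) := (measurable_exponentialPDFReal r).ennreal_ofReal
  rw [h, ae_withDensity_iff hm]
  filter_upwards [Measure.ae_ne volume (0 : ℝ)] with x hx h0
  by_contra! hneg
  exact h0 (exponentialPDF_of_neg (lt_of_le_of_ne hneg hx))

/-- The tail form is what conditioning on the minimum being `t` requires; `t = 0` gives the ordinary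
transform. -/
lemma integral_exp_expMeasure {r : ℝ} (hr : 0 < r) {a : ℂ} (ha : a.re < r) {t : ℝ} (ht : 0 ≤ t) :
    ∫ x, (Set.Ioi t).indicator (fun x : ℝ => Complex.exp (a * x)) x ∂expMeasure r =
      r / (r - a) * Complex.exp ((a - r) * t) := by
  have hne : (a - r : ℂ) ≠ 0 := fun h => by
    have := congrArg Complex.re h
    simp at this
    linarith
  have hne' : (r - a : ℂ) ≠ 0 := fun h => hne (by linear_combination -h)
  rw [integral_expMeasure hr]
  calc _ = ∫ x in Set.Ioi (0 : ℝ), (Set.Ioi t).indicator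
        (fun x : ℝ => r * Complex.exp ((a - r) * x)) x := by
        refine integral_congr_ae (.of_forall fun x => ?_)
        by_cases hx : x ∈ Set.Ioi t
        · simp only [Set.indicator_of_mem hx]
          rw [mul_assoc, ← Complex.exp_add]
          ring_nf
        · simp only [Set.indicator_of_notMem hx, mul_zero]
    _ = _ := by
        rw [setIntegral_indicator measurableSet_Ioi, Set.Ioi_inter_Ioi, sup_eq_right.2 ht,
          integral_const_mul, integral_exp_mul_complex_Ioi (by simpa using ha)]
        field_simp
        ring

lemma measurable_update_pair {ι : Type*} [DecidableEq ι] (m : ι) :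
    Measurable fun p : ℝ × (ι → ℝ) => Function.update p.2 m p.1 := by
  refine measurable_pi_lambda _ fun i => ?_
  by_cases h : i = m
  · subst h
    simpa using measurable_fst
  · simp only [Function.update_of_ne h]
    fun_prop

/-- Resampling one coordinate independently does not change a product law. This lets Fubini single
out coordinate `m` without splitting the index type. -/
lemma map_update_prod_pi {ι : Type*} [Fintype ι] [DecidableEq ι] (μ : ι → Measure ℝ)
    [∀ i, IsProbabilityMeasure (μ i)] (m : ι) :
    ((μ m).prod (Measure.pi μ)).map (fun p => Function.update p.2 m p.1) = Measure.pi μ := by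
  have hmeas := measurable_update_pair m
  refine (Measure.pi_eq fun s hs => ?_).symm
  rw [Measure.map_apply hmeas (MeasurableSet.univ_pi hs)]
  have : (fun p : ℝ × (ι → ℝ) => Function.update p.2 m p.1) ⁻¹' Set.pi Set.univ s =
      s m ×ˢ Set.pi Set.univ (Function.update s m Set.univ) := by
    ext p
    simp only [Set.mem_preimage, Set.mem_pi, Set.mem_univ, true_implies, Set.mem_prod]
    constructor
    · refine fun h => ⟨by simpa using h m, fun i => ?_⟩
      by_cases hi : i = m
      · subst hi; simp
      · simpa [hi] using h i
    · rintro ⟨h1, h2⟩ i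
      by_cases hi : i = m
      · subst hi; simpa using h1
      · simpa [hi] using h2 i
  rw [this, Measure.prod_prod, Measure.pi_pi, ← Finset.mul_prod_erase _ _ (Finset.mem_univ m),
    ← Finset.mul_prod_erase Finset.univ (fun i => μ i (s i)) (Finset.mem_univ m)]
  simp only [Function.update_self, measure_univ, one_mul]
  congr 1
  refine Finset.prod_congr rfl fun i hi => ?_
  rw [Function.update_of_ne (Finset.ne_of_mem_erase hi)]

section Min

variable {ι : Type*} [Fintype ι] [DecidableEq ι]

/-- The vectors whose minimal coordinate is `m`, and no other. -/
def strictArgmin (m : ι) : Set (ι → ℝ) := {x | ∀ l, l ≠ m → x m < x l}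

lemma measurableSet_strictArgmin (m : ι) : MeasurableSet (strictArgmin m) := by
  simp only [strictArgmin, Set.ofPred_forall]
  exact MeasurableSet.iInter fun l => MeasurableSet.iInter fun _ =>
    measurableSet_lt (measurable_pi_apply m) (measurable_pi_apply l)

lemma iInf_eq_of_mem_strictArgmin {m : ι} {x : ι → ℝ} (hx : x ∈ strictArgmin m) :
    ⨅ l, x l = x m := by
  have : Nonempty ι := ⟨m⟩
  refine le_antisymm (ciInf_le (Set.finite_range x).bddBelow m) (le_ciInf fun l => ?_)
  by_cases h : l = m
  · rw [h]
  · exact (hx l h).le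

lemma pairwise_disjoint_strictArgmin : Pairwise (Function.onFun Disjoint (strictArgmin (ι := ι))) :=
  fun m m' hne => Set.disjoint_left.2 fun _ hx hx' =>
    lt_asymm (hx m' hne.symm) (hx' m hne)

/-- Once the minimal value `t` is fixed, being the argmin is the conjunction of `x l > t` over the
other coordinates, so the integrand factorises. -/
lemma indicator_strictArgmin_update (a : ι → ℂ) (m : ι) (t : ℝ) (x : ι → ℝ) :
    (strictArgmin m).indicator (fun x : ι → ℝ => Complex.exp (∑ l, a l * ((x l - x m : ℝ) : ℂ)))
      (Function.update x m t) =
    ∏ l, (if l = m then 1 else Complex.exp (-a l * t) *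
      (Set.Ioi t).indicator (fun x : ℝ => Complex.exp (a l * x)) (x l)) := by
  by_cases hx : Function.update x m t ∈ strictArgmin m
  · rw [Set.indicator_of_mem hx, Complex.exp_sum]
    refine Finset.prod_congr rfl fun l _ => ?_
    by_cases hl : l = m
    · subst hl; simp
    · have := hx l hl
      rw [Function.update_self, Function.update_of_ne hl] at this
      rw [if_neg hl, Set.indicator_of_mem (Set.mem_Ioi.2 this), Function.update_self,
        Function.update_of_ne hl, ← Complex.exp_add]
      congr 1
      push_cast
      ring
  · rw [Set.indicator_of_notMem hx]
    have : ∃ l, l ≠ m ∧ x l ≤ t := by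
      by_contra! hcon
      refine hx fun l hl => ?_
      rw [Function.update_self, Function.update_of_ne hl]
      exact hcon l hl
    obtain ⟨l, hl, hle⟩ := this
    refine (Finset.prod_eq_zero (Finset.mem_univ l) ?_).symm
    rw [if_neg hl, Set.indicator_of_notMem (by simpa using hle), mul_zero]

lemma measurable_indicator_strictArgmin (a : ι → ℂ) (m : ι) :
    Measurable ((strictArgmin m).indicator
      (fun x : ι → ℝ => Complex.exp (∑ l, a l * ((x l - x m : ℝ) : ℂ)))) :=
  (by fun_prop : Continuous fun x : ι → ℝ =>
    Complex.exp (∑ l, a l * ((x l - x m : ℝ) : ℂ))).measurable.indicator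
    (measurableSet_strictArgmin m)

lemma norm_indicator_strictArgmin_le {a : ι → ℂ} (ha : ∀ l, (a l).re ≤ 0) (m : ι) (x : ι → ℝ) :
    ‖(strictArgmin m).indicator
      (fun x : ι → ℝ => Complex.exp (∑ l, a l * ((x l - x m : ℝ) : ℂ))) x‖ ≤ 1 := by
  by_cases hx : x ∈ strictArgmin m
  · rw [Set.indicator_of_mem hx, Complex.norm_exp, Real.exp_le_one_iff, Complex.re_sum]
    refine Finset.sum_nonpos fun l _ => ?_
    rw [Complex.re_mul_ofReal]
    refine mul_nonpos_of_nonpos_of_nonneg (ha l) ?_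
    by_cases hl : l = m
    · simp [hl]
    · linarith [hx l hl]
  · simp [Set.indicator_of_notMem hx]

/-- Memorylessness: given that coordinate `m` is the minimum, the excesses of the others are again
independent exponentials of rate `r`. By symmetry `m` is the minimum with probability `1 / card ι`.
-/
lemma integral_indicator_strictArgmin {r : ℝ} (hr : 0 < r) (a : ι → ℂ) (ha : ∀ l, (a l).re ≤ 0)
    (m : ι) :
    ∫ x, (strictArgmin m).indicator
        (fun x : ι → ℝ => Complex.exp (∑ l, a l * ((x l - x m : ℝ) : ℂ))) x
        ∂Measure.pi (fun _ => expMeasure r) =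
      1 / (Fintype.card ι : ℂ) * ∏ l ∈ Finset.univ.erase m, ((r : ℂ) / (r - a l)) := by
  have hprob := isProbabilityMeasure_expMeasure hr
  have hFm := measurable_indicator_strictArgmin a m
  have hF1 := norm_indicator_strictArgmin_le ha m
  have hmap := map_update_prod_pi (fun _ : ι => expMeasure r) m
  have hmeas := measurable_update_pair m
  rw [← hmap, integral_map hmeas.aemeasurable hFm.aestronglyMeasurable, integral_prod (fun p =>
      (strictArgmin m).indicator (fun x : ι → ℝ => Complex.exp (∑ l, a l * ((x l - x m : ℝ) : ℂ)))
        (Function.update p.2 m p.1))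
    (Integrable.of_bound (hFm.comp hmeas).aestronglyMeasurable 1 (.of_forall fun p => hF1 _))]
  have hinner : ∀ t : ℝ, 0 ≤ t → ∫ x, (strictArgmin m).indicator
      (fun x : ι → ℝ => Complex.exp (∑ l, a l * ((x l - x m : ℝ) : ℂ)))
      (Function.update x m t) ∂Measure.pi (fun _ => expMeasure r) =
      (∏ l ∈ Finset.univ.erase m, ((r : ℂ) / (r - a l))) *
        Complex.exp (-(((Fintype.card ι - 1 : ℕ) : ℂ) * r) * t) := by
    intro t ht
    simp only [indicator_strictArgmin_update]
    rw [integral_fintype_prod_eq_prod (fun l (x : ℝ) => if l = m then (1 : ℂ) else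
      Complex.exp (-a l * t) * (Set.Ioi t).indicator (fun x : ℝ => Complex.exp (a l * x)) x),
      ← Finset.mul_prod_erase _ _ (Finset.mem_univ m)]
    simp only [if_true, integral_const, probReal_univ, one_smul, one_mul]
    have : ∀ l ∈ Finset.univ.erase m, ∫ x, (if l = m then (1 : ℂ) else
        Complex.exp (-a l * t) * (Set.Ioi t).indicator (fun x : ℝ => Complex.exp (a l * x)) x)
        ∂expMeasure r = (r : ℂ) / (r - a l) * Complex.exp (-(r : ℂ) * t) := by
      intro l hl
      simp only [if_neg (Finset.ne_of_mem_erase hl)]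
      rw [integral_const_mul, integral_exp_expMeasure hr ((ha l).trans_lt hr) ht, mul_left_comm,
        ← Complex.exp_add]
      ring_nf
    rw [Finset.prod_congr rfl this, Finset.prod_mul_distrib, Finset.prod_const,
      Finset.card_erase_of_mem (Finset.mem_univ m), ← Complex.exp_nat_mul, Finset.card_univ]
    ring_nf
  rw [integral_congr_ae ((ae_pos_expMeasure r).mono fun t ht => hinner t ht.le),
    integral_const_mul, mul_comm]
  congr 1
  have hcard : 0 < Fintype.card ι := Fintype.card_pos_iff.2 ⟨m⟩
  have hca : ((-(((Fintype.card ι - 1 : ℕ) : ℂ) * r))).re < r := by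
    have : (0 : ℝ) ≤ ((Fintype.card ι - 1 : ℕ) : ℝ) * r := by positivity
    simp only [Complex.neg_re, Complex.re_mul_ofReal, Complex.natCast_re]
    linarith
  -- Each of the other `card ι - 1` coordinates contributed `e^{-rt}`; the transform at `-(card ι -
  -- 1) r` is `r / (card ι · r)`.
  have h0 := integral_exp_expMeasure hr hca le_rfl
  rw [integral_congr_ae ((ae_pos_expMeasure r).mono fun t ht =>
    Set.indicator_of_mem (Set.mem_Ioi.2 ht) _)] at h0
  rw [h0]
  have hcC : (Fintype.card ι : ℂ) ≠ 0 := Nat.cast_ne_zero.2 hcard.ne'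
  have hrC : (r : ℂ) ≠ 0 := Complex.ofReal_ne_zero.2 hr.ne'
  rw [Complex.ofReal_zero, mul_zero, Complex.exp_zero, mul_one, Nat.cast_sub hcard,
    Nat.cast_one, show (r : ℂ) - -((Fintype.card ι - 1) * r) = Fintype.card ι * r by ring]
  field_simp

/-- Taking `a = 0` in the previous formula, the disjoint events of a strict minimum at `m` each have
probability `1 / card ι`. They exhaust the total mass, so ties are negligible. -/
lemma ae_exists_mem_strictArgmin [Nonempty ι] {r : ℝ} (hr : 0 < r) :
    ∀ᵐ x ∂Measure.pi (fun _ : ι => expMeasure r), ∃ m, x ∈ strictArgmin m := by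
  have hprob := isProbabilityMeasure_expMeasure hr
  have hone : ∀ m : ι, (Measure.pi (fun _ : ι => expMeasure r)).real (strictArgmin m) =
      1 / (Fintype.card ι : ℝ) := by
    intro m
    have h := integral_indicator_strictArgmin hr (fun _ : ι => 0) (by simp) m
    have hrC : (r : ℂ) ≠ 0 := Complex.ofReal_ne_zero.2 hr.ne'
    simp only [zero_mul, Finset.sum_const_zero, Complex.exp_zero, sub_zero, div_self hrC,
      Finset.prod_const_one, mul_one] at h
    rw [integral_indicator (measurableSet_strictArgmin m), setIntegral_const] at h
    simp only [Complex.real_smul, mul_one] at h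
    exact Complex.ofReal_injective (by rw [h]; push_cast; rfl)
  have hU : MeasurableSet (⋃ m : ι, strictArgmin m) :=
    MeasurableSet.iUnion fun m => measurableSet_strictArgmin m
  have h1 : (Measure.pi (fun _ : ι => expMeasure r)).real (⋃ m : ι, strictArgmin m) = 1 := by
    rw [measureReal_iUnion_fintype pairwise_disjoint_strictArgmin
      (fun m => measurableSet_strictArgmin m)]
    simp only [hone, Finset.sum_const, Finset.card_univ, nsmul_eq_mul]
    have : (Fintype.card ι : ℝ) ≠ 0 := Nat.cast_ne_zero.2 Fintype.card_ne_zero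
    field_simp
  have h2 : Measure.pi (fun _ : ι => expMeasure r) (⋃ m : ι, strictArgmin m) = 1 := by
    rwa [← ENNReal.toReal_eq_one_iff]
  have h3 := (prob_compl_eq_zero_iff hU).2 h2
  filter_upwards [measure_eq_zero_iff_ae_notMem.1 h3] with x hx
  simpa using hx

/-- The Laplace transform of independent exponential variables reduced by their minimum. -/
lemma integral_exp_sub_iInf [Nonempty ι] {r : ℝ} (hr : 0 < r) (a : ι → ℂ)
    (ha : ∀ l, (a l).re ≤ 0) :
    ∫ x, Complex.exp (∑ l, a l * ((x l - ⨅ m, x m : ℝ) : ℂ))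
        ∂Measure.pi (fun _ : ι => expMeasure r) =
      ∑ m, 1 / (Fintype.card ι : ℂ) * ∏ l ∈ Finset.univ.erase m, ((r : ℂ) / (r - a l)) := by
  have hprob := isProbabilityMeasure_expMeasure hr
  simp only [← integral_indicator_strictArgmin hr a ha]
  rw [← integral_finsetSum]
  · refine integral_congr_ae ?_
    filter_upwards [ae_exists_mem_strictArgmin hr] with x ⟨m, hm⟩
    rw [Finset.sum_eq_single (s := Finset.univ) (f := fun m => (strictArgmin m).indicator
      (fun x : ι → ℝ => Complex.exp (∑ l, a l * ((x l - x m : ℝ) : ℂ))) x) m,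
      Set.indicator_of_mem hm, iInf_eq_of_mem_strictArgmin hm]
    · exact fun m' _ hne => Set.indicator_of_notMem
        (Set.disjoint_left.1 (pairwise_disjoint_strictArgmin hne.symm) hm) _
    · simp
  · intro m _
    exact Integrable.of_bound (measurable_indicator_strictArgmin a m).aestronglyMeasurable 1
      (.of_forall (norm_indicator_strictArgmin_le ha m))

end Min

/-! ### The explicit solution for equal variances -/

/-- The complex vector `Bᵀ θ`. -/
noncomputable def portSum (θ : Pair n → ℂ) (l : Port n) : ℂ := ∑ k, (incidence n k l : ℂ) * θ k

lemma portSum_inl (θ : Pair n → ℂ) (i : Fin n) : portSum θ (Sum.inl i) = ∑ j, θ (i, j) := by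
  simp [portSum, incidence, Fintype.sum_prod_type_right, apply_ite Complex.ofReal]

lemma portSum_inr (θ : Pair n → ℂ) (j : Fin n) : portSum θ (Sum.inr j) = ∑ i, θ (i, j) := by
  simp [portSum, incidence, Fintype.sum_prod_type, apply_ite Complex.ofReal]

lemma portSum_re_nonpos {θ : Pair n → ℂ} (hθ : θ ∈ transformDomain n) (l : Port n) :
    (portSum θ l).re ≤ 0 := by
  refine le_of_eq_of_le ?_ (hθ.2.2 l)
  simp [portSum, Matrix.mulVec, dotProduct, Complex.re_sum]

lemma pairing_incidence (θ : Pair n → ℂ) (r : Port n → ℝ) :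
    pairing θ (incidence n *ᵥ r) = ∑ l, portSum θ l * (r l : ℂ) := by
  simp only [pairing, portSum, Matrix.mulVec, dotProduct, Complex.ofReal_sum, Finset.mul_sum,
    Finset.sum_mul]
  rw [Finset.sum_comm]
  refine Finset.sum_congr rfl fun l _ => Finset.sum_congr rfl fun k _ => ?_
  push_cast
  ring

lemma continuous_exp_pairing (θ : Pair n → ℂ) : Continuous fun y => Complex.exp (pairing θ y) :=
  Complex.continuous_exp.comp (continuous_pairing θ)

/-- The pair vector with entries `r_i + r_{n+j} - 2 min r`. -/
noncomputable def reducedSum (r : Port n → ℝ) (k : Pair n) : ℝ :=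
  r (Sum.inl k.1) + r (Sum.inr k.2) - 2 * ⨅ l, r l

lemma reducedSum_eq (r : Port n → ℝ) : reducedSum r = incidence n *ᵥ fun l => r l - ⨅ m, r m := by
  ext k
  rw [incidence_mulVec, reducedSum]
  ring

lemma reducedSum_mem_collapseCone (r : Port n → ℝ) : reducedSum r ∈ collapseCone n :=
  ⟨_, fun l => sub_nonneg.2 (ciInf_le (Set.finite_range r).bddBelow l), reducedSum_eq r⟩

lemma measurable_reducedSum : Measurable (reducedSum (n := n)) := by
  have : Measurable fun r : Port n → ℝ => ⨅ l, r l := Measurable.iInf fun l => measurable_pi_apply l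
  refine measurable_pi_lambda _ fun k => ?_
  unfold reducedSum
  fun_prop

/-- The law of `reducedSum` of independent exponential variables of rate `r`. -/
noncomputable def interiorLaw (n : ℕ) (r : ℝ) : Measure (Pair n → ℝ) :=
  (Measure.pi fun _ : Port n => expMeasure r).map reducedSum

lemma integral_interiorLaw (hn : 0 < n) {r : ℝ} (hr : 0 < r) {θ : Pair n → ℂ}
    (hθ : θ ∈ transformDomain n) :
    ∫ y, Complex.exp (pairing θ y) ∂interiorLaw n r =
      ∑ m, 1 / (2 * n : ℂ) * ∏ l ∈ Finset.univ.erase m, ((r : ℂ) / (r - portSum θ l)) := by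
  have : Nonempty (Port n) := ⟨Sum.inl ⟨0, hn⟩⟩
  have h := integral_exp_sub_iInf hr (portSum θ) (portSum_re_nonpos hθ)
  rw [interiorLaw, integral_map measurable_reducedSum.aemeasurable
    (continuous_exp_pairing θ).aestronglyMeasurable]
  simp only [reducedSum_eq, pairing_incidence]
  rw [h, Fintype.card_sum, Fintype.card_fin]
  push_cast
  rw [two_mul]

/-- The vector `r` with the coordinates of the two ports of the pair `k` replaced by `0`. -/
noncomputable def clearPorts (k : Pair n) (r : Port n → ℝ) (l : Port n) : ℝ :=
  if l = Sum.inl k.1 ∨ l = Sum.inr k.2 then 0 else r l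

/-- The law of `B r`, with mass `1 / n`, where the coordinates of `r` at the ports of `k` are `0`
and the other ones are independent exponential variables. -/
noncomputable def boundaryLaw (r : ℝ) (k : Pair n) : Measure (Pair n → ℝ) :=
  ENNReal.ofReal (1 / n) • (Measure.pi fun _ : Port n => expMeasure r).map
    fun x => incidence n *ᵥ clearPorts k x

lemma measurable_incidence_clearPorts (k : Pair n) :
    Measurable fun x : Port n → ℝ => incidence n *ᵥ clearPorts k x := by
  have h : Measurable fun x : Port n → ℝ => clearPorts k x := by
    refine measurable_pi_lambda _ fun l => ?_
    unfold clearPorts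
    split_ifs <;> fun_prop
  refine measurable_pi_lambda _ fun k' => ?_
  simp only [incidence_mulVec]
  fun_prop

lemma ae_boundaryLaw (hn : 0 < n) {r : ℝ} (hr : 0 < r) (k : Pair n) :
    ∀ᵐ y ∂boundaryLaw r k, y ∈ coneFace k := by
  have hprob := isProbabilityMeasure_expMeasure hr
  refine Measure.ae_smul_measure ?_ _
  have hpos : ∀ᵐ x ∂Measure.pi fun _ : Port n => expMeasure r, ∀ l, 0 < x l :=
    eventually_all.2 fun l => (Measure.tendsto_eval_ae_ae (i := l)).eventually (ae_pos_expMeasure r)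
  have hface : MeasurableSet (coneFace k) :=
    (isClosed_collapseCone hn).measurableSet.inter
      (isClosed_eq (continuous_apply k) continuous_const).measurableSet
  refine (ae_map_iff (p := fun y => y ∈ coneFace k)
    (measurable_incidence_clearPorts k).aemeasurable hface).2 (hpos.mono fun x hx =>
      ⟨⟨_, fun l => ?_, rfl⟩, ?_⟩)
  · unfold clearPorts
    split_ifs
    exacts [le_rfl, (hx l).le]
  · simp [incidence_mulVec, clearPorts]

lemma integral_boundaryLaw {r : ℝ} (hr : 0 < r) {θ : Pair n → ℂ} (hθ : θ ∈ transformDomain n)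
    (k : Pair n) :
    ∫ y, Complex.exp (pairing θ y) ∂boundaryLaw r k =
      1 / (n : ℂ) * ∏ l, (if l = Sum.inl k.1 ∨ l = Sum.inr k.2 then 1 else
        (r : ℂ) / (r - portSum θ l)) := by
  have hprob := isProbabilityMeasure_expMeasure hr
  rw [boundaryLaw, integral_smul_measure, integral_map
    (measurable_incidence_clearPorts k).aemeasurable
    (continuous_exp_pairing θ).aestronglyMeasurable,
    ENNReal.toReal_ofReal (by positivity), Complex.real_smul]
  have e : ∀ x : Port n → ℝ, Complex.exp (pairing θ (incidence n *ᵥ clearPorts k x)) =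
      ∏ l, (if l = Sum.inl k.1 ∨ l = Sum.inr k.2 then 1 else Complex.exp (portSum θ l * x l)) := by
    intro x
    rw [pairing_incidence, Complex.exp_sum]
    refine Finset.prod_congr rfl fun l _ => ?_
    unfold clearPorts
    split_ifs <;> simp
  simp only [e]
  rw [integral_fintype_prod_eq_prod (fun l (x : ℝ) => if l = Sum.inl k.1 ∨ l = Sum.inr k.2 then
    (1 : ℂ) else Complex.exp (portSum θ l * x))]
  push_cast
  congr 1
  refine Finset.prod_congr rfl fun l _ => ?_
  split_ifs
  · simp
  · have h := integral_exp_expMeasure hr ((portSum_re_nonpos hθ l).trans_lt hr) le_rfl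
    rw [integral_congr_ae ((ae_pos_expMeasure r).mono fun t ht =>
      Set.indicator_of_mem (Set.mem_Ioi.2 ht) _)] at h
    rw [h]
    simp

lemma sum_prod_erase_inv {ι : Type*} [Fintype ι] [DecidableEq ι] {d : ι → ℂ} (hd : ∀ l, d l ≠ 0) :
    ∑ m, ∏ l ∈ Finset.univ.erase m, (d l)⁻¹ = (∑ m, d m) * ∏ l, (d l)⁻¹ := by
  rw [Finset.sum_mul]
  refine Finset.sum_congr rfl fun m _ => ?_
  rw [← Finset.mul_prod_erase _ _ (Finset.mem_univ m), mul_inv_cancel_left₀ (hd m)]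

lemma prod_ite_ports {d : Port n → ℂ} (hd : ∀ l, d l ≠ 0) (k : Pair n) :
    ∏ l, (if l = Sum.inl k.1 ∨ l = Sum.inr k.2 then 1 else (d l)⁻¹) =
      d (Sum.inl k.1) * d (Sum.inr k.2) * ∏ l, (d l)⁻¹ := by
  simp only [Fintype.prod_sum_type, Sum.inl.injEq, Sum.inr.injEq, reduceCtorEq, or_false, false_or]
  rw [← Finset.mul_prod_erase _ _ (Finset.mem_univ k.1),
    ← Finset.mul_prod_erase _ _ (Finset.mem_univ k.2),
    ← Finset.mul_prod_erase _ (fun i => (d (Sum.inl i))⁻¹) (Finset.mem_univ k.1),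
    ← Finset.mul_prod_erase _ (fun j => (d (Sum.inr j))⁻¹) (Finset.mem_univ k.2),
    Finset.prod_congr rfl fun i hi => if_neg (Finset.ne_of_mem_erase hi),
    Finset.prod_congr rfl fun i hi => if_neg (Finset.ne_of_mem_erase hi)]
  have h1 := hd (Sum.inl k.1)
  have h2 := hd (Sum.inr k.2)
  simp only [if_true]
  field_simp

/-- The polynomial identity behind the explicit solution. -/
lemma quadratic_mul_sum_eq (hn : 0 < n) {θ : Pair n → ℂ} {w : Port n → ℂ}
    (hw : ∀ k, θ k = w (Sum.inl k.1) + w (Sum.inr k.2)) (c : ℂ) :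
    (-(1 / (n : ℂ)) * ∑ k, θ k + c * ∑ k, θ k ^ 2) *
      (1 / (2 * n : ℂ) * ∑ l, (1 - c * portSum θ l)) =
    -∑ k, θ k * (1 / (n : ℂ) * ((1 - c * portSum θ (Sum.inl k.1)) *
      (1 - c * portSum θ (Sum.inr k.2)))) := by
  have hn' : (n : ℂ) ≠ 0 := Nat.cast_ne_zero.2 hn.ne'
  -- The freedom in the potential is used to give the input part `x` and the output part `y` the
  -- same sum `W`; all port sums are then `n x_i + W` or `n y_j + W`.
  set s : ℂ := (∑ j, w (Sum.inr j) - ∑ i, w (Sum.inl i)) / (2 * n) with hs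
  set x : Fin n → ℂ := fun i => w (Sum.inl i) + s with hx
  set y : Fin n → ℂ := fun j => w (Sum.inr j) - s with hy
  set W : ℂ := ∑ i, x i with hW
  have hWy : ∑ j, y j = W := by
    simp only [hW, hx, hy, Finset.sum_sub_distrib, Finset.sum_add_distrib, Finset.sum_const,
      Finset.card_univ, Fintype.card_fin, nsmul_eq_mul, hs]
    field_simp
    ring
  have hθ : ∀ i j, θ (i, j) = x i + y j := fun i j => by rw [hw]; simp only [hx, hy]; ring
  have hl : ∀ i, portSum θ (Sum.inl i) = n * x i + W := fun i => by
    rw [portSum_inl]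
    simp only [hθ, Finset.sum_add_distrib, hWy]
    simp
  have hr : ∀ j, portSum θ (Sum.inr j) = n * y j + W := fun j => by
    rw [portSum_inr]
    simp only [hθ, Finset.sum_add_distrib]
    simp [hW, add_comm]
  have h1 : ∑ k, θ k = 2 * n * W := by
    simp only [Fintype.sum_prod_type, hθ, Finset.sum_add_distrib, hWy]
    simp only [Finset.sum_const, Finset.card_univ, Fintype.card_fin, nsmul_eq_mul,
      ← Finset.mul_sum, ← hW]
    ring
  have h2 : ∑ k, θ k ^ 2 = n * ∑ i, x i ^ 2 + n * ∑ j, y j ^ 2 + 2 * W ^ 2 := by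
    have : ∑ i, ∑ j, x i * y j = W * W := by rw [← Finset.sum_mul_sum, hWy]
    have e : ∀ i j, θ (i, j) ^ 2 = x i ^ 2 + y j ^ 2 + 2 * (x i * y j) := fun i j => by
      rw [hθ]; ring
    simp only [Fintype.sum_prod_type, e, Finset.sum_add_distrib]
    rw [show ∑ i, ∑ j, 2 * (x i * y j) = 2 * (W * W) by rw [← this]; simp only [Finset.mul_sum]]
    simp only [Finset.sum_const, Finset.card_univ, Fintype.card_fin, nsmul_eq_mul,
      ← Finset.mul_sum]
    ring
  have h3 : ∑ l, (1 - c * portSum θ l) = 2 * n * (1 - 2 * c * W) := by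
    simp only [Fintype.sum_sum_type, hl, hr, Finset.sum_sub_distrib, ← Finset.mul_sum,
      Finset.sum_add_distrib, hWy, ← hW]
    simp only [Finset.sum_const, Finset.card_univ, Fintype.card_fin, nsmul_eq_mul]
    ring
  have h4 : ∑ k, θ k * (1 / (n : ℂ) * ((1 - c * portSum θ (Sum.inl k.1)) *
      (1 - c * portSum θ (Sum.inr k.2)))) =
      (1 - 2 * c * W) * (2 * (1 - c * W) * W - c * n * (∑ i, x i ^ 2 + ∑ j, y j ^ 2)) := by
    -- Splitting `θ = x + y` makes each summand a product of a function of `i` and a function of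
    -- `j`. The factor without the quadratic term sums to `n (1 - 2cW)`, the factor common to both
    -- sides of the identity.
    have e : ∀ i j, θ (i, j) * (1 / (n : ℂ) * ((1 - c * portSum θ (Sum.inl i)) *
        (1 - c * portSum θ (Sum.inr j)))) =
        1 / (n : ℂ) * (((1 - c * W) * x i - c * n * x i ^ 2) * (1 - c * W - c * n * y j)) +
        1 / (n : ℂ) * ((1 - c * W - c * n * x i) * ((1 - c * W) * y j - c * n * y j ^ 2)) := by
      intro i j
      rw [hθ, hl, hr]
      ring
    simp only [Fintype.sum_prod_type, e, Finset.sum_add_distrib, ← Finset.mul_sum]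
    rw [← Finset.sum_mul, ← Finset.sum_mul]
    simp only [Finset.sum_sub_distrib, ← Finset.mul_sum, hWy, ← hW]
    simp only [Finset.sum_const, Finset.card_univ, Fintype.card_fin, nsmul_eq_mul]
    field_simp
    ring
  rw [h1, h2, h3, h4]
  field_simp
  ring

/-- All transforms share the factor `∏ (1 - c β_l)⁻¹`, where `β` is `portSum θ`. Dividing it out
leaves the average of `1 - c β_l` for the interior and `(1/n)` times the product of `1 - c β_l` over
the two ports of `k` for the boundary; `quadratic_mul_sum_eq` relates them. -/
lemma isTransformSolution_interiorLaw (hn : 0 < n) {v : Pair n → ℝ} {c : ℝ} (hc : 0 < c)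
    (hv : ∀ k, v k = 2 * c) :
    IsTransformSolution v
      (fun θ => ∫ y, Complex.exp (pairing θ.1 y) ∂interiorLaw n c⁻¹)
      (fun k θ => ∫ y, Complex.exp (pairing θ.1 y) ∂boundaryLaw c⁻¹ k) := by
  have hr : 0 < c⁻¹ := inv_pos.2 hc
  have hprob := isProbabilityMeasure_expMeasure hr
  have hcC : (c : ℂ) ≠ 0 := Complex.ofReal_ne_zero.2 hc.ne'
  refine ⟨⟨_, Measure.isProbabilityMeasure_map measurable_reducedSum.aemeasurable, ?_,
    fun _ => rfl⟩, fun k => ⟨_, ?_, ae_boundaryLaw hn hr k, fun _ => rfl⟩, fun θ => ?_⟩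
  · exact (ae_map_iff (p := fun y => y ∈ collapseCone n) measurable_reducedSum.aemeasurable
      (isClosed_collapseCone hn).measurableSet).2 (.of_forall reducedSum_mem_collapseCone)
  · have := Measure.isFiniteMeasure_map (Measure.pi fun _ : Port n => expMeasure c⁻¹)
      fun x => incidence n *ᵥ clearPorts k x
    exact Measure.smul_finite _ ENNReal.ofReal_ne_top
  · obtain ⟨w, hw⟩ := exists_complex_potential θ.2
    have hd : ∀ l, 1 - (c : ℂ) * portSum θ.1 l ≠ 0 := fun l h => by
      have h1 := congrArg Complex.re h
      have h2 := mul_nonpos_of_nonneg_of_nonpos hc.le (portSum_re_nonpos θ.2 l)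
      simp only [Complex.sub_re, Complex.one_re, Complex.re_ofReal_mul, Complex.zero_re] at h1
      linarith
    have hdiv : ∀ l, ((c⁻¹ : ℝ) : ℂ) / ((c⁻¹ : ℝ) - portSum θ.1 l) =
        (1 - (c : ℂ) * portSum θ.1 l)⁻¹ := fun l => by
      have : ((c⁻¹ : ℝ) : ℂ) - portSum θ.1 l = (c : ℂ)⁻¹ * (1 - c * portSum θ.1 l) := by
        push_cast
        field_simp
      rw [this]
      have := hd l
      push_cast
      field_simp
    rw [FunctionalEq]
    simp only [integral_interiorLaw hn hr θ.2, integral_boundaryLaw hr θ.2, hdiv]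
    rw [← Finset.mul_sum, sum_prod_erase_inv hd]
    simp only [prod_ite_ports hd, hv]
    have key := quadratic_mul_sum_eq hn hw (c : ℂ)
    have e1 : (1 / 2 : ℂ) * ∑ k, ((2 * c : ℝ) : ℂ) * θ.1 k ^ 2 = c * ∑ k, θ.1 k ^ 2 := by
      rw [← Finset.mul_sum]
      push_cast
      ring
    rw [e1, ← mul_assoc (1 / (2 * n : ℂ)), ← mul_assoc, key, neg_mul, Finset.sum_mul]
    congr 1
    exact Finset.sum_congr rfl fun k _ => by ring

/-! ### Determination of measures on the cone by their transforms -/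

/-- The witness is row mean plus column mean minus grand mean, which has the row and column sums of
`ξ`. It is the orthogonal projection of `ξ` to `𝓢`. -/
lemma exists_mem_collapseSpace_transpose_eq (hn : 0 < n) (ξ : Pair n → ℝ) :
    ∃ p ∈ collapseSpace n, (incidence n)ᵀ *ᵥ p = (incidence n)ᵀ *ᵥ ξ := by
  have hn' : (n : ℝ) ≠ 0 := Nat.cast_ne_zero.2 hn.ne'
  set t : ℝ := ∑ i, ∑ j, ξ (i, j) with ht
  have ht' : t = ∑ j, ∑ i, ξ (i, j) := Finset.sum_comm
  refine ⟨fun k => ((∑ j, ξ (k.1, j)) / n - t / n ^ 2) + (∑ i, ξ (i, k.2)) / n,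
    mem_collapseSpace_iff.2 ⟨Sum.elim (fun i => (∑ j, ξ (i, j)) / n - t / n ^ 2)
      fun j => (∑ i, ξ (i, j)) / n, fun k => rfl⟩, ?_⟩
  ext l
  cases l with
  | inl i =>
    simp only [incidence_transpose_mulVec_inl, Finset.sum_add_distrib, ← Finset.sum_div, ← ht']
    simp only [Finset.sum_const, Finset.card_univ, Fintype.card_fin, nsmul_eq_mul]
    field_simp
    ring
  | inr j =>
    simp only [incidence_transpose_mulVec_inr, Finset.sum_add_distrib, Finset.sum_sub_distrib,
      ← Finset.sum_div, ← ht]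
    simp only [Finset.sum_const, Finset.card_univ, Fintype.card_fin, nsmul_eq_mul]
    field_simp
    ring

lemma mul_I_mem_transformDomain {p : Pair n → ℝ} (hp : p ∈ collapseSpace n) :
    (fun k => (p k : ℂ) * Complex.I) ∈ transformDomain n := by
  have h0 : (fun k => ((p k : ℂ) * Complex.I).re) = 0 := by ext k; simp
  refine ⟨?_, ?_, ?_⟩
  · rw [h0]
    exact ⟨0, by simp⟩
  · convert hp using 2 with k
    simp
  · rw [h0]
    simp

/-- On the cone a frequency acts only through its projection `p` to `𝓢`. Since `ip` has zero real
part it belongs to `Θ`, so the transforms on `Θ` contain the whole characteristic function. -/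
lemma eq_of_integral_exp_pairing_eq (hn : 0 < n) {μ μ' : Measure (Pair n → ℝ)} [IsFiniteMeasure μ]
    [IsFiniteMeasure μ'] (hμ : ∀ᵐ y ∂μ, y ∈ collapseCone n) (hμ' : ∀ᵐ y ∂μ', y ∈ collapseCone n)
    (h : ∀ θ ∈ transformDomain n,
      ∫ y, Complex.exp (pairing θ y) ∂μ = ∫ y, Complex.exp (pairing θ y) ∂μ') : μ = μ' := by
  refine Measure.ext_of_charFunDual (funext fun L => ?_)
  set ξ : Pair n → ℝ := fun k => L (Pi.single k 1) with hξ
  obtain ⟨p, hp, hpξ⟩ := exists_mem_collapseSpace_transpose_eq hn ξ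
  have key : ∀ y ∈ collapseCone n, Complex.exp (L y * Complex.I) =
      Complex.exp (pairing (fun k => (p k : ℂ) * Complex.I) y) := by
    rintro y ⟨r, -, rfl⟩
    have h1 : L (incidence n *ᵥ r) = ∑ k, ξ k * (incidence n *ᵥ r) k := by
      conv_lhs => rw [pi_eq_sum_univ' (incidence n *ᵥ r), map_sum]
      refine Finset.sum_congr rfl fun k _ => ?_
      rw [map_smul, smul_eq_mul, mul_comm]
    rw [h1, sum_incidence_mul, ← hpξ, ← sum_incidence_mul, pairing]
    congr 1
    push_cast
    rw [Finset.sum_mul]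
    exact Finset.sum_congr rfl fun k _ => by ring
  rw [charFunDual_apply, charFunDual_apply, integral_congr_ae (hμ.mono key),
    integral_congr_ae (hμ'.mono key)]
  exact h _ (mul_I_mem_transformDomain hp)

/-! ### Heavy-traffic limits under uniqueness -/

section Limits

variable {ν : Pair n → ℝ} {aMax : ℕ} {v : Pair n → ℝ} {T : Kernel (Counts n) (Counts n)}
  [IsMarkovKernel T] {A : ℝ → Pair n → Measure ℕ} [∀ ε k, IsProbabilityMeasure (A ε k)]
  {π : ℝ → Measure (Counts n)}

/-- Every sequence has a subsequence along which the transforms converge to some solution;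
uniqueness identifies it, so convergence holds along the full filter. -/
lemma exists_tendsto_transforms (hn : 0 < n) (hν : ν ∈ saturatedRates n)
    (hν_pos : ∀ k, 0 < ν k) (hA : IsHeavyTraffic ν aMax v A) (hT : IsMaxWeight T)
    (hπ : ∀ ε ∈ Set.Ioo (0 : ℝ) 1, IsSteadyState T (A ε) (π ε))
    (huniq : UniquenessConjecture n v) :
    ∃ (L : transformDomain n → ℂ) (M : Pair n → transformDomain n → ℂ),
      IsTransformSolution v L M ∧ ∀ θ : transformDomain n,
        Tendsto (fun ε => queueTransform (π ε) ε θ) (𝓝[>] (0 : ℝ)) (𝓝 (L θ)) ∧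
        ∀ k, Tendsto (fun ε => unusedTransform T (A ε) (π ε) ε k θ) (𝓝[>] (0 : ℝ))
          (𝓝 (M k θ)) := by
  obtain ⟨⟨L, M⟩, hsol, hu⟩ := huniq
  have hsub : ∀ e : ℕ → ℝ, Tendsto e atTop (𝓝[>] (0 : ℝ)) → ∃ φ : ℕ → ℕ,
      ∀ θ : transformDomain n,
        Tendsto (fun m => queueTransform (π (e (φ m))) (e (φ m)) θ) atTop (𝓝 (L θ)) ∧
        ∀ k, Tendsto (fun m => unusedTransform T (A (e (φ m))) (π (e (φ m))) (e (φ m)) k θ) atTop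
          (𝓝 (M k θ)) := by
    intro e he
    obtain ⟨φ, μ, L', M', -, -, -, -, hsol', -, hlim⟩ :=
      exists_subseq_limit hn hν hν_pos hA hT hπ he
    obtain ⟨rfl, rfl⟩ := Prod.mk.inj (hu (L', M') hsol')
    exact ⟨φ, hlim⟩
  refine ⟨L, M, hsol, fun θ => ⟨tendsto_of_subseq_tendsto fun e he => ?_,
    fun k => tendsto_of_subseq_tendsto fun e he => ?_⟩⟩
  · obtain ⟨φ, hφ⟩ := hsub e he
    exact ⟨φ, (hφ θ).1⟩
  · obtain ⟨φ, hφ⟩ := hsub e he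
    exact ⟨φ, (hφ θ).2 k⟩

/-- The conjecture concerns transforms only. It gives every subsequential weak limit the transform
of `interiorLaw`, and since both laws are carried by the cone they coincide. -/
lemma tendsto_integral_scaledLaw (hn : 0 < n) (hν : ν ∈ saturatedRates n)
    (hν_pos : ∀ k, 0 < ν k) (hA : IsHeavyTraffic ν aMax v A) (hT : IsMaxWeight T)
    (hπ : ∀ ε ∈ Set.Ioo (0 : ℝ) 1, IsSteadyState T (A ε) (π ε))
    (huniq : UniquenessConjecture n v) {c : ℝ} (hc : 0 < c) (hv : ∀ k, v k = 2 * c)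
    (F : BoundedContinuousFunction (Pair n → ℝ) ℂ) :
    Tendsto (fun ε => ∫ y, F y ∂scaledLaw (π ε) ε) (𝓝[>] (0 : ℝ))
      (𝓝 (∫ y, F y ∂interiorLaw n c⁻¹)) := by
  have hprob := isProbabilityMeasure_expMeasure (inv_pos.2 hc)
  have hfin : IsProbabilityMeasure (interiorLaw n c⁻¹) :=
    Measure.isProbabilityMeasure_map measurable_reducedSum.aemeasurable
  have hcone : ∀ᵐ y ∂interiorLaw n c⁻¹, y ∈ collapseCone n :=
    (ae_map_iff (p := fun y => y ∈ collapseCone n) measurable_reducedSum.aemeasurable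
      (isClosed_collapseCone hn).measurableSet).2 (.of_forall reducedSum_mem_collapseCone)
  refine tendsto_of_subseq_tendsto fun e he => ?_
  obtain ⟨φ, μ, L, M, -, hμ, hμcone, hL, hsol, hlim, -⟩ :=
    exists_subseq_limit hn hν hν_pos hA hT hπ he
  have heq := congrArg Prod.fst (huniq.unique (y₁ := (L, M)) (y₂ := (_, _)) hsol
    (isTransformSolution_interiorLaw hn hc hv))
  have : μ = interiorLaw n c⁻¹ := eq_of_integral_exp_pairing_eq hn hμcone hcone fun θ hθ => by
    rw [← hL ⟨θ, hθ⟩]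
    exact congrFun heq ⟨θ, hθ⟩
  subst this
  exact ⟨φ, hlim F⟩

end Limits

end InputQueuedSwitch

theorem corollary1 (n : ℕ) (hn : 0 < n)
    (ν : Pair n → ℝ) (hν : ν ∈ saturatedRates n) (hν_pos : ∀ k, 0 < ν k)
    (aMax : ℕ) (v : Pair n → ℝ)
    (A : ℝ → Pair n → Measure ℕ) [∀ ε k, IsProbabilityMeasure (A ε k)]
    (hA : IsHeavyTraffic ν aMax v A)
    (T : Kernel (Counts n) (Counts n)) [IsMarkovKernel T] (hT : IsMaxWeight T) :
    -- the steady state exists and is unique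
    (∀ ε ∈ Set.Ioo (0 : ℝ) 1, ∃! π : Measure (Counts n), IsSteadyState T (A ε) π) ∧
    ∀ (π : ℝ → Measure (Counts n)) [∀ ε, IsProbabilityMeasure (π ε)],
      (∀ ε ∈ Set.Ioo (0 : ℝ) 1, IsSteadyState T (A ε) (π ε)) →
      -- the transforms are finite and remain bounded in heavy traffic
      (∀ θ ∈ transformDomain n, ∃ C : ℝ, ∀ᶠ ε in 𝓝[>] (0 : ℝ),
        Integrable (expQueue ε θ) (π ε) ∧ ‖queueTransform (π ε) ε θ‖ ≤ C ∧
        ∀ k, ‖unusedTransform T (A ε) (π ε) ε k θ‖ ≤ C) ∧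
      -- their limits (along `ε → 0`, or along any subsequence) satisfy the functional equation
      (∀ θ ∈ transformDomain n, ∀ (l : Filter ℝ) [l.NeBot], l ≤ 𝓝[>] (0 : ℝ) →
        ∀ (L : ℂ) (M : Pair n → ℂ),
          Tendsto (fun ε => queueTransform (π ε) ε θ) l (𝓝 L) →
          (∀ k, Tendsto (fun ε => unusedTransform T (A ε) (π ε) ε k θ) l (𝓝 (M k))) →
          FunctionalEq v θ L M) ∧
      -- such limits exist, simultaneously for all `θ`, along a subsequence of any sequence `ε → 0`,
      -- and they are the Laplace transforms of limiting interior and boundary measures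
      (∀ e : ℕ → ℝ, Tendsto e atTop (𝓝[>] (0 : ℝ)) →
        ∃ (φ : ℕ → ℕ) (L : transformDomain n → ℂ) (M : Pair n → transformDomain n → ℂ),
          StrictMono φ ∧ IsTransformSolution v L M ∧ ∀ θ : transformDomain n,
            Tendsto (fun m => queueTransform (π (e (φ m))) (e (φ m)) θ) atTop (𝓝 (L θ)) ∧
            ∀ k, Tendsto
              (fun m => unusedTransform T (A (e (φ m))) (π (e (φ m))) (e (φ m)) k θ) atTop
              (𝓝 (M k θ))) ∧
      -- under the conjecture the limits as `ε → 0` exist and are the solution of the functional equation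
      (UniquenessConjecture n v →
        ∃ (L : transformDomain n → ℂ) (M : Pair n → transformDomain n → ℂ),
          IsTransformSolution v L M ∧ ∀ θ : transformDomain n,
            Tendsto (fun ε => queueTransform (π ε) ε θ) (𝓝[>] (0 : ℝ)) (𝓝 (L θ)) ∧
            ∀ k, Tendsto (fun ε => unusedTransform T (A ε) (π ε) ε k θ) (𝓝[>] (0 : ℝ))
              (𝓝 (M k θ))) ∧
      -- under the conjecture and symmetric variances, the heavy-traffic distribution
      (∀ σ : ℝ, 0 < σ → (∀ k, v k = σ ^ 2) → UniquenessConjecture n v →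
        ∀ {Ω : Type*} [MeasurableSpace Ω] (P : Measure Ω) [IsProbabilityMeasure P]
          (Υ : Port n → Ω → ℝ), iIndepFun Υ P →
          (∀ l, HasLaw (Υ l) (expMeasure (σ ^ 2 / 2)⁻¹) P) →
          TendstoInDistribution
            (fun (ε : ℝ) (q : Counts n) (k : Pair n) => ε * (q k : ℝ)) (𝓝[>] (0 : ℝ))
            (fun ω k => Υ (Sum.inl k.1) ω + Υ (Sum.inr k.2) ω - 2 * ⨅ l, Υ l ω) π P) := by
  refine ⟨fun ε hε => existsUnique_isSteadyState hT (hA.bounded ε hε) hν hν_pos hε (hA.mean ε hε),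
    fun π _ hπ => ⟨fun θ hθ => exists_eventually_transform_le hn hν hν_pos hA hT hπ hθ,
      fun θ hθ l _ hl L M hL hM => functionalEq_of_tendsto hn hν hν_pos hA hT hπ hθ hl hL hM,
      fun e he => ?_, fun huniq => exists_tendsto_transforms hn hν hν_pos hA hT hπ huniq,
      fun σ hσ hv huniq Ω _ P _ Υ hind hlaw => ?_⟩⟩
  · obtain ⟨φ, μ, L, M, hφ, -, -, -, hsol, -, hlim⟩ :=
      exists_subseq_limit hn hν hν_pos hA hT hπ he
    exact ⟨φ, L, M, hφ, hsol, hlim⟩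
  · have hc : 0 < σ ^ 2 / 2 := by positivity
    have hΥ : ∀ l, AEMeasurable (Υ l) P := fun l => (hlaw l).aemeasurable
    have hΥ' : AEMeasurable (fun ω l => Υ l ω) P := aemeasurable_pi_lambda _ hΥ
    -- The limit vector matters only through its law: by independence the joint law of `Υ` is the
    -- product of exponentials of rate `c⁻¹` with `c = σ²/2`, so that `v = 2c`.
    have hmap : P.map (fun ω => reducedSum fun l => Υ l ω) = interiorLaw n (σ ^ 2 / 2)⁻¹ := by
      have h := AEMeasurable.map_map_of_aemeasurable (g := reducedSum)
        measurable_reducedSum.aemeasurable hΥ'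
      rw [(iIndepFun_iff_map_fun_eq_pi_map hΥ).1 hind] at h
      simp only [(hlaw _).map_eq] at h
      exact h.symm
    refine ⟨fun ε => Measurable.of_discrete.aemeasurable,
      measurable_reducedSum.comp_aemeasurable hΥ',
      (ProbabilityMeasure.tendsto_iff_forall_integral_rclike_tendsto ℂ).2 fun F => ?_⟩
    have h := tendsto_integral_scaledLaw hn hν hν_pos hA hT hπ huniq hc
      (fun k => by rw [hv k]; ring) F
    rw [← hmap] at h
    exact h
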